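/- Let $n\ge 2$, let $G=\operatorname{SL}(n,\mathbb{C})$, let $K=\operatorname{SU}(n)$, and let $B\subset G$ be the subgroup of upper triangular matrices. Let $\Gamma\subset G$ be a torsion-free discrete subgroup (not necessarily cocompact or of finite covolume). Let $\Gamma$ act on the flag manifold $B\backslash G$ from the right by $(Bg)\cdot\gamma=Bg\gamma$ and on the symmetric space $G/K$ from the left by $\gamma\cdot hK=\gamma hK$. Let $$(B\backslash G)\times_\Gamma G/K=\bigl((B\backslash G)\times G/K\bigr)\big/\bigl((x\gamma,y)\sim(x,\gamma y)\ \text{for } \gamma\in\Gamma\bigr)$$ with the quotient topology, and let $$p\colon (B\backslash G)\times_\Gamma G/K\to\Gamma\backslash G/K,\qquad [Bg,hK]\mapsto \Gamma hK,$$ be the projection that collapses $B\backslash G$ to a point. Then for every $k\ge 0$ the induced map on singular cohomology with rational coefficients (without support condition) $$p^*\colon \operatorname{H}^k(\Gamma\backslash G/K;\mathbb{Q})\to\operatorname{H}^k\bigl((B\backslash G)\times_\Gamma G/K;\mathbb{Q}\bigr)$$ is injective, and the induced map on singular homology $$p_*\colon \operatorname{H}_k\bigl((B\backslash G)\times_\Gamma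 G/K;\mathbb{Q}\bigr)\to\operatorname{H}_k(\Gamma\backslash G/K;\mathbb{Q})$$ is surjective. -/

import Mathlib

open CategoryTheory

noncomputable section

/-! ### Singular cohomology -/

/-- The singular cochain complex `Hom(C_•(X; R), R)` of a space `X`, contravariantly functorial
in `X`: the `R`-linear dual of Mathlib's singular chain complex. -/
def singularCochainComplexFunctor (R : Type) [CommRing R] :
    TopCat.{0}ᵒᵖ ⥤ CochainComplex (ModuleCat.{0} R) ℕ :=
  ((AlgebraicTopology.singularChainComplexFunctor (ModuleCat.{0} R)).obj (ModuleCat.of R R)).op ⋙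
    HomologicalComplex.opFunctor (ModuleCat.{0} R) (ComplexShape.down ℕ) ⋙
    ((linearYoneda R (ModuleCat.{0} R)).obj (ModuleCat.of R R)).mapHomologicalComplex
      (ComplexShape.up ℕ)

/-- The `k`-th singular cohomology functor `H^k(-; R)` (arbitrary supports). -/
def singularCohomologyFunctor (R : Type) [CommRing R] (k : ℕ) :
    TopCat.{0}ᵒᵖ ⥤ ModuleCat.{0} R :=
  singularCochainComplexFunctor R ⋙ HomologicalComplex.homologyFunctor _ _ k

/-- The map `f^* : H^k(Y; R) → H^k(X; R)` induced by a continuous map `f : X → Y`. -/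
def singularCohomologyMap (R : Type) [CommRing R] (k : ℕ) {X Y : Type} [TopologicalSpace X]
    [TopologicalSpace Y] (f : C(X, Y)) :
    (singularCohomologyFunctor R k).obj (Opposite.op (TopCat.of Y)) →ₗ[R]
      (singularCohomologyFunctor R k).obj (Opposite.op (TopCat.of X)) :=
  ((singularCohomologyFunctor R k).map (TopCat.ofHom f).op).hom

/-- The map `f_* : H_k(X; R) → H_k(Y; R)` induced by a continuous map `f : X → Y`. -/
def singularHomologyMap (R : Type) [CommRing R] (k : ℕ) {X Y : Type} [TopologicalSpace X]
    [TopologicalSpace Y] (f : C(X, Y)) :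
    ((AlgebraicTopology.singularHomologyFunctor (ModuleCat.{0} R) k).obj
        (ModuleCat.of R R)).obj (TopCat.of X) →ₗ[R]
      ((AlgebraicTopology.singularHomologyFunctor (ModuleCat.{0} R) k).obj
        (ModuleCat.of R R)).obj (TopCat.of Y) :=
  (((AlgebraicTopology.singularHomologyFunctor (ModuleCat.{0} R) k).obj
    (ModuleCat.of R R)).map (TopCat.ofHom f)).hom

/-! ### Balanced products -/

/-- The balanced product `X ×_Γ Y` of a right `Γ`-space `X` (an action of `Γᵐᵒᵖ`) and a left
`Γ`-space `Y`: the equivalence relation on `X × Y` given by `(x · γ, y) ∼ (x, γ · y)`. -/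
def balancedSetoid (Γ X Y : Type) [Group Γ] [MulAction Γᵐᵒᵖ X] [MulAction Γ Y] :
    Setoid (X × Y) where
  r a b := ∃ γ : Γ, a.1 = MulOpposite.op γ • b.1 ∧ b.2 = γ • a.2
  iseqv :=
    { refl := fun a => ⟨1, by simp⟩
      symm := by
        rintro a b ⟨γ, h1, h2⟩
        refine ⟨γ⁻¹, ?_, ?_⟩
        · rw [h1, smul_smul, ← MulOpposite.op_mul, mul_inv_cancel, MulOpposite.op_one, one_smul]
        · rw [h2, inv_smul_smul]
      trans := by
        rintro a b c ⟨γ, h1, h2⟩ ⟨δ, h3, h4⟩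
        refine ⟨δ * γ, ?_, ?_⟩
        · rw [h1, h3, smul_smul, ← MulOpposite.op_mul]
        · rw [h4, h2, smul_smul] }

/-- The balanced product `X ×_Γ Y`, with the quotient topology. -/
abbrev BalancedProduct (Γ X Y : Type) [Group Γ] [MulAction Γᵐᵒᵖ X] [MulAction Γ Y] : Type :=
  Quotient (balancedSetoid Γ X Y)

/-- The projection `X ×_Γ Y → Γ \ Y`, `[x, y] ↦ Γy`, which collapses `X` to a point. -/
def balancedProj (Γ X Y : Type) [Group Γ] [MulAction Γᵐᵒᵖ X] [MulAction Γ Y]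
    [TopologicalSpace X] [TopologicalSpace Y] :
    C(BalancedProduct Γ X Y, MulAction.orbitRel.Quotient Γ Y) where
  toFun := Quotient.lift (fun a : X × Y => (Quotient.mk _ a.2 : MulAction.orbitRel.Quotient Γ Y))
    (by
      rintro a b ⟨γ, -, h⟩
      refine Quotient.sound (MulAction.orbitRel_apply.2 ⟨γ⁻¹, ?_⟩)
      simp [h])
  continuous_toFun := (continuous_quotient_mk'.comp continuous_snd).quotient_lift _

/-! ### The groups and spaces -/

/-- `SU(n)` as a subgroup of `SL(n, ℂ)`. -/
def specialUnitary (n : ℕ) : Subgroup (Matrix.SpecialLinearGroup (Fin n) ℂ) where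
  carrier := {g | (g : Matrix (Fin n) (Fin n) ℂ) ∈ Matrix.unitaryGroup (Fin n) ℂ}
  one_mem' := by simp
  mul_mem' := by
    intro a b ha hb
    simpa using mul_mem ha hb
  inv_mem' := by
    intro a ha
    have h : ((a⁻¹ : Matrix.SpecialLinearGroup (Fin n) ℂ) : Matrix (Fin n) (Fin n) ℂ)
        = star (a : Matrix (Fin n) (Fin n) ℂ) := by
      have h1 : ((a⁻¹ : Matrix.SpecialLinearGroup (Fin n) ℂ) : Matrix (Fin n) (Fin n) ℂ)
          * (a : Matrix (Fin n) (Fin n) ℂ) = 1 := by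
        rw [← Matrix.SpecialLinearGroup.coe_mul, inv_mul_cancel, Matrix.SpecialLinearGroup.coe_one]
      exact left_inv_eq_right_inv h1 (Matrix.mem_unitaryGroup_iff.1 ha)
    simp only [Set.mem_ofPred_eq] at ha ⊢
    rw [h]
    exact Unitary.star_mem ha

/-- The Borel subgroup of upper triangular matrices in `SL(n, ℂ)`. -/
def borelSubgroup (n : ℕ) : Subgroup (Matrix.SpecialLinearGroup (Fin n) ℂ) where
  carrier := {g | ∀ i j : Fin n, j < i → (g : Matrix (Fin n) (Fin n) ℂ) i j = 0}
  one_mem' := fun i j h => by simp [Matrix.one_apply_ne h.ne']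
  mul_mem' := by
    intro a b ha hb
    exact (show Matrix.BlockTriangular (a : Matrix (Fin n) (Fin n) ℂ) id from ha).mul
      (show Matrix.BlockTriangular (b : Matrix (Fin n) (Fin n) ℂ) id from hb)
  inv_mem' := by
    intro a ha
    have h1 : ((a⁻¹ : Matrix.SpecialLinearGroup (Fin n) ℂ) : Matrix (Fin n) (Fin n) ℂ)
        * (a : Matrix (Fin n) (Fin n) ℂ) = 1 := by
      rw [← Matrix.SpecialLinearGroup.coe_mul, inv_mul_cancel, Matrix.SpecialLinearGroup.coe_one]
    have h2 := Matrix.inv_eq_left_inv h1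
    letI := Matrix.invertibleOfIsUnitDet (a : Matrix (Fin n) (Fin n) ℂ) (by simp)
    have h3 := Matrix.blockTriangular_inv_of_blockTriangular
      (show Matrix.BlockTriangular (a : Matrix (Fin n) (Fin n) ℂ) id from ha)
    rw [h2] at h3
    exact h3

/-- The flag manifold `B \ G` of `G = SL(n, ℂ)`: the set of cosets `Bg`, with the quotient
topology. -/
abbrev FlagManifold (n : ℕ) : Type :=
  Quotient (QuotientGroup.rightRel (borelSubgroup n))

/-- `SL(n, ℂ)` acts on `B \ G` from the right by `(Bg) · h = B(gh)`. -/
instance flagManifoldRightAction (n : ℕ) :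
    MulAction (Matrix.SpecialLinearGroup (Fin n) ℂ)ᵐᵒᵖ (FlagManifold n) where
  smul h := Quotient.map (fun g => g * h.unop) (by
    intro a b hab
    rw [← Quotient.eq_iff_equiv, Quotient.eq, QuotientGroup.rightRel_apply] at hab ⊢
    simpa [mul_assoc] using hab)
  one_smul := by
    rintro ⟨g⟩
    exact congrArg (Quotient.mk _) (mul_one g)
  mul_smul := by
    rintro h k ⟨g⟩
    exact congrArg (Quotient.mk _) (mul_assoc g k.unop h.unop).symm

/-- The restriction of the right action on `B \ G` to a subgroup `Γ` of `SL(n, ℂ)`. -/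
instance flagManifoldRightActionSubgroup (n : ℕ)
    (Γ : Subgroup (Matrix.SpecialLinearGroup (Fin n) ℂ)) :
    MulAction Γᵐᵒᵖ (FlagManifold n) :=
  MulAction.compHom (FlagManifold n) (MonoidHom.op Γ.subtype)

/-- The symmetric space `G / K` with `G = SL(n, ℂ)` and `K = SU(n)`. -/
abbrev SymmetricSpace (n : ℕ) : Type :=
  Matrix.SpecialLinearGroup (Fin n) ℂ ⧸ specialUnitary n

/-- The locally symmetric space `Γ \ G / K`. -/
abbrev LocallySymmetricSpace (n : ℕ) (Γ : Subgroup (Matrix.SpecialLinearGroup (Fin n) ℂ)) :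
    Type :=
  MulAction.orbitRel.Quotient Γ (SymmetricSpace n)

/-- The total space `(B \ G) ×_Γ (G / K)`. -/
abbrev FlagBundle (n : ℕ) (Γ : Subgroup (Matrix.SpecialLinearGroup (Fin n) ℂ)) : Type :=
  BalancedProduct Γ (FlagManifold n) (SymmetricSpace n)

/-- The projection `p : (B \ G) ×_Γ (G / K) → Γ \ G / K`, `[Bg, hK] ↦ Γ h K`. -/
abbrev flagBundleProj (n : ℕ) (Γ : Subgroup (Matrix.SpecialLinearGroup (Fin n) ℂ)) :
    C(FlagBundle n Γ, LocallySymmetricSpace n Γ) :=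
  balancedProj Γ (FlagManifold n) (SymmetricSpace n)

end

/-! Write X = G/K and L = Γ\X. A compact discrete stabiliser is finite, hence trivial because Γ is
torsion-free. So Γ acts freely and X → L is a covering (`isQuotientCoveringMap_orbitRel`). Singular
chains of L are then chains of X modulo differences of translates (`push_surjective`,
`mem_translationChains_of_push_eq_zero`).

The argument is a splitting principle carried out on such chains. An ordered system of n mutually
orthogonal rank one idempotents with sum 1 determines a flag (`flagOf`). It therefore suffices to
find a Γ-space Y over X that carries an equivariant system of this kind and for which cycles modulo
translation lift from X to Y up to homology (`LiftsCycles`). The resulting map from Y to the flag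
bundle is Γ-invariant and lies over X → L, so every cycle of L comes from the flag bundle up to a
boundary (`exists_cycle_push_sub_mem_range`).

The space Y is a tower (`exists_isSplitting`). Each stage starts from an equivariant idempotent q of
rank r, passes to the bundle of rank one idempotents e below q, and continues with q - e. The crux
is `liftsCycles_idemBelow`: this bundle has an equivariant chain-level section. The bundle of pairs
(v, φ) with φ(v) = 1 has fibres homotopy equivalent to the sphere of dimension 2r - 1, so simplices
of dimension at most 2r - 1 can be lifted to it without obstruction. Mapping (v, φ) to the
idempotent vφ gives a partial section of the bundle of idempotents. Its fibre is homotopy equivalent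
to the projective space of lines in ℂ^r, which has no homology from degree 2r - 1 on, so the section
extends to all degrees. Equivariance is arranged by choosing lifts on one simplex of each free
Γ-orbit (`IsSection.exists_extend`). The section followed by the projection is equivariantly chain
homotopic to the identity (`bd_sectionHomotopy`).

The homology of the fibres is computed from cones, subdivision and Mayer–Vietoris
(`exactAt_punctured`, `exactAt_rankOneProj`). Surjectivity on homology gives injectivity on
cohomology by linear duality over ℚ. -/

noncomputable section

namespace AugmentedChains

/-! ### Augmented singular chains -/

open Finset

/-- The standard simplex with `m` vertices; it is empty for `m = 0`. -/
abbrev Simp (m : ℕ) : Type := stdSimplex ℝ (Fin m)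

/-- Singular simplices with `m` vertices. For `m = 0` there is exactly one, the empty simplex. -/
abbrev Sing (m : ℕ) (Y : Type) [TopologicalSpace Y] : Type := C(Simp m, Y)

/-- Augmented singular chains: chains on simplices with `m` vertices, of degree `m - 1`. -/
abbrev Ch (m : ℕ) (Y : Type) [TopologicalSpace Y] : Type := Sing m Y →₀ ℚ

/-- The inclusion of the `i`-th face of the standard simplex. -/
def coface {m : ℕ} (i : Fin (m + 1)) : C(Simp m, Simp (m + 1)) :=
  ⟨stdSimplex.map i.succAbove, stdSimplex.continuous_map _⟩

instance simpZero_isEmpty : IsEmpty (Simp 0) :=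
  ⟨fun s => by simpa using stdSimplex.sum_eq_one s⟩

variable {X Y Z : Type} [TopologicalSpace X] [TopologicalSpace Y] [TopologicalSpace Z]

/-- The single empty simplex makes the chains on zero vertices a copy of ℚ, and the lowest boundary
map becomes the augmentation. Counting vertices thus builds reduced homology into the complex. -/
instance singZero_unique : Unique (Sing 0 Y) where
  default := ⟨fun s => isEmptyElim s, continuous_of_discreteTopology⟩
  uniq f := by ext s; exact isEmptyElim s

/-- The `i`-th face of a singular simplex. -/
def face {m : ℕ} (i : Fin (m + 1)) (σ : Sing (m + 1) Y) : Sing m Y := σ.comp (coface i)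

/-- The chain map induced by a continuous map. -/
def push (m : ℕ) (f : C(X, Y)) : Ch m X →ₗ[ℚ] Ch m Y :=
  Finsupp.lmapDomain ℚ ℚ fun σ : Sing m X => f.comp σ

@[simp]
lemma push_single {m : ℕ} (f : C(X, Y)) (σ : Sing m X) (a : ℚ) :
    push m f (Finsupp.single σ a) = Finsupp.single (f.comp σ) a := by
  simp [push]

lemma push_push {m : ℕ} (g : C(Y, Z)) (f : C(X, Y)) (c : Ch m X) :
    push m g (push m f c) = push m (g.comp f) c := by
  induction c using Finsupp.induction_linear with
  | zero => simp
  | add a b ha hb => simp [ha, hb]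
  | single σ a => simp [ContinuousMap.comp_assoc]

@[simp]
lemma push_id {m : ℕ} (c : Ch m X) : push m (ContinuousMap.id X) c = c := by
  induction c using Finsupp.induction_linear with
  | zero => simp
  | add a b ha hb => simp [ha, hb]
  | single σ a => simp

/-- The linear map out of chains which takes prescribed values on simplices. -/
def extend {m : ℕ} {V : Type*} [AddCommGroup V] [Module ℚ V] (φ : Sing m Y → V) :
    Ch m Y →ₗ[ℚ] V := Finsupp.linearCombination ℚ φ

@[simp]
lemma extend_single {m : ℕ} {V : Type*} [AddCommGroup V] [Module ℚ V] (φ : Sing m Y → V)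
    (σ : Sing m Y) (a : ℚ) : extend φ (Finsupp.single σ a) = a • φ σ := by
  simp [extend]

lemma hom_ext {m : ℕ} {V : Type*} [AddCommGroup V] [Module ℚ V] {f g : Ch m Y →ₗ[ℚ] V}
    (h : ∀ σ, f (Finsupp.single σ 1) = g (Finsupp.single σ 1)) : f = g :=
  Finsupp.lhom_ext' fun σ => LinearMap.ext_ring (h σ)

/-- The boundary of the augmented singular chain complex. -/
def bd (m : ℕ) : Ch (m + 1) Y →ₗ[ℚ] Ch m Y :=
  extend fun σ => ∑ i : Fin (m + 1), (-1 : ℚ) ^ (i : ℕ) • Finsupp.single (face i σ) 1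

lemma bd_single {m : ℕ} (σ : Sing (m + 1) Y) :
    bd m (Finsupp.single σ 1) =
      ∑ i : Fin (m + 1), (-1 : ℚ) ^ (i : ℕ) • Finsupp.single (face i σ) 1 := by
  simp [bd]

lemma bd_push {m : ℕ} (f : C(X, Y)) (c : Ch (m + 1) X) :
    bd m (push (m + 1) f c) = push m f (bd m c) := by
  suffices h : (bd m).comp (push (m + 1) f) = (push m f).comp (bd m) from LinearMap.congr_fun h c
  refine hom_ext fun σ => ?_
  simp only [LinearMap.comp_apply, push_single, bd_single, map_sum, map_smul]
  rfl

/-- The simplicial identity in a form where the two pairs of indices are exchanged by an involution,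
so that the terms of a double boundary cancel in pairs. -/
lemma face_face {m : ℕ} (i : Fin (m + 2)) (j : Fin (m + 1)) (σ : Sing (m + 2) Y) :
    face j (face i σ) = face (j.predAbove i) (face (i.succAbove j) σ) := by
  ext t
  simp only [face, coface, ContinuousMap.comp_apply, ContinuousMap.coe_mk,
    stdSimplex.map_comp_apply]
  congr 2
  funext k
  exact (Fin.succAbove_succAbove_succAbove_predAbove i j k).symm

lemma bd_bd {m : ℕ} (c : Ch (m + 2) Y) : bd m (bd (m + 1) c) = 0 := by
  suffices h : (bd m).comp (bd (m + 1)) = (0 : Ch (m + 2) Y →ₗ[ℚ] Ch m Y) from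
    LinearMap.congr_fun h c
  refine hom_ext fun σ => ?_
  simp only [LinearMap.comp_apply, bd_single, map_sum, map_smul, Finset.smul_sum,
    LinearMap.zero_apply, smul_smul]
  rw [← Finset.sum_product']
  refine Finset.sum_involution (fun p _ => (p.1.succAbove p.2, p.2.predAbove p.1)) ?_ ?_ ?_ ?_
  · rintro ⟨i, j⟩ -
    simp only
    rw [← face_face, ← add_smul, ← pow_add, ← pow_add,
      Fin.neg_one_pow_succAbove_add_predAbove]
    simp
  · rintro ⟨i, j⟩ - - h
    exact Fin.succAbove_ne i j (congrArg Prod.fst h)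
  · simp
  · rintro ⟨i, j⟩ -
    simp [Fin.succAbove_succAbove_predAbove, Fin.predAbove_predAbove_succAbove]

/-- A chain is a cycle if its boundary vanishes; every chain on the empty simplex is one. -/
def IsCyc : (m : ℕ) → Ch m Y → Prop
  | 0, _ => True
  | m + 1, c => bd m c = 0

/-- Exactness of the augmented singular chain complex at simplices with `m` vertices, that is,
vanishing of reduced homology in degree `m - 1`. -/
def ExactAt (m : ℕ) (Y : Type) [TopologicalSpace Y] : Prop :=
  ∀ z : Ch m Y, IsCyc m z → ∃ c : Ch (m + 1) Y, bd m c = z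

lemma isCyc_bd {m : ℕ} (c : Ch (m + 1) Y) : IsCyc m (bd m c) := by
  cases m with
  | zero => trivial
  | succ m => exact bd_bd c

lemma IsCyc.push {m : ℕ} {z : Ch m X} (h : IsCyc m z) (f : C(X, Y)) :
    IsCyc m (push m f z) := by
  cases m with
  | zero => trivial
  | succ m =>
    change bd m _ = 0
    rw [bd_push, show bd m z = 0 from h, map_zero]

lemma push_zero_eq {c : Ch 0 X} (f g : C(X, Y)) : push 0 f c = push 0 g c := by
  suffices h : push 0 f = push 0 g by rw [h]
  refine hom_ext fun σ => ?_
  simp only [push_single]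
  rw [Subsingleton.elim (f.comp σ) (g.comp σ)]

end AugmentedChains

/-! ### Joins, cones and acyclicity of contractible spaces -/

namespace AugmentedChains

open Finset

variable {X Y Z : Type} [TopologicalSpace X] [TopologicalSpace Y] [TopologicalSpace Z]

lemma coface_apply_self {m : ℕ} (i : Fin (m + 1)) (s : Simp m) : coface i s i = 0 := by
  simp only [coface, ContinuousMap.coe_mk, stdSimplex.map_coe]
  rw [FunOnFinite.linearMap_apply_apply]
  refine Finset.sum_eq_zero fun j hj => ?_
  simp only [Finset.mem_filter] at hj
  exact absurd hj.2 (Fin.succAbove_ne i j)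

lemma coface_apply_succAbove {m : ℕ} (i : Fin (m + 1)) (s : Simp m) (j : Fin m) :
    coface i s (i.succAbove j) = s j := by
  simp only [coface, ContinuousMap.coe_mk, stdSimplex.map_coe]
  rw [FunOnFinite.linearMap_apply_apply]
  rw [Finset.sum_eq_single j]
  · intro k hk hkj
    simp only [Finset.mem_filter] at hk
    exact absurd (Fin.succAbove_right_injective hk.2) hkj
  · simp

/-- The point of the segment from the vertex `0` (at `u = 1`) to the point `s` of the opposite
face (at `u = 0`). -/
def join {m : ℕ} : C(unitInterval × Simp m, Simp (m + 1)) where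
  toFun p := ⟨Fin.cons (p.1 : ℝ) fun j => (1 - (p.1 : ℝ)) * p.2 j, by
    constructor
    · intro i
      refine Fin.cases ?_ (fun j => ?_) i
      · exact p.1.2.1
      · exact mul_nonneg (sub_nonneg.2 p.1.2.2) (stdSimplex.zero_le p.2 j)
    · rw [Fin.sum_univ_succ]
      simp [← Finset.mul_sum]⟩
  continuous_toFun := by
    refine Continuous.subtype_mk (continuous_pi fun i => ?_) _
    refine Fin.cases ?_ (fun j => ?_) i
    · exact continuous_subtype_val.comp continuous_fst
    · simp only [Fin.cons_succ]
      exact (continuous_const.sub (continuous_subtype_val.comp continuous_fst)).mul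
        ((continuous_apply j).comp (continuous_subtype_val.comp continuous_snd))

@[simp]
lemma join_apply_zero {m : ℕ} (p : unitInterval × Simp m) : join p 0 = p.1 := rfl

@[simp]
lemma join_apply_succ {m : ℕ} (p : unitInterval × Simp m) (j : Fin m) :
    join p j.succ = (1 - (p.1 : ℝ)) * p.2 j := rfl

lemma simp_ext {m : ℕ} {s t : Simp m} (h : ∀ i, s i = t i) : s = t :=
  stdSimplex.ext (funext h)

lemma join_one {m : ℕ} (s : Simp m) : join (1, s) = stdSimplex.vertex 0 := by
  refine simp_ext fun i => ?_
  refine Fin.cases ?_ (fun j => ?_) i <;> simp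

lemma eq_vertex_or_join {m : ℕ} (t : Simp (m + 1)) :
    t = stdSimplex.vertex 0 ∨ ∃ p : unitInterval × Simp m, t = join p := by
  have hsum : t 0 + ∑ j : Fin m, t j.succ = 1 := by
    rw [← Fin.sum_univ_succ]; exact stdSimplex.sum_eq_one t
  by_cases h : t 0 = 1
  · left
    have h0 : ∑ j : Fin m, t j.succ = 0 := by linarith
    rw [Finset.sum_eq_zero_iff_of_nonneg fun j _ => stdSimplex.zero_le t _] at h0
    refine simp_ext fun i => ?_
    refine Fin.cases ?_ (fun j => ?_) i
    · simp [h]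
    · simp [h0 j]
  · right
    have h1 : 0 < 1 - t 0 := by
      have := stdSimplex.le_one t 0
      exact sub_pos.2 (lt_of_le_of_ne this h)
    refine ⟨(⟨t 0, stdSimplex.zero_le t 0, stdSimplex.le_one t 0⟩,
      ⟨fun j => (1 - t 0)⁻¹ * t j.succ, fun j => mul_nonneg (inv_nonneg.2 h1.le)
        (stdSimplex.zero_le t _), ?_⟩), ?_⟩
    · rw [← Finset.mul_sum, show ∑ j : Fin m, t j.succ = 1 - t 0 by linarith,
        inv_mul_cancel₀ h1.ne']
    · refine simp_ext fun i => ?_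
      refine Fin.cases ?_ (fun j => ?_) i
      · rfl
      · rw [join_apply_succ]
        change t j.succ = (1 - t 0) * ((1 - t 0)⁻¹ * t j.succ)
        rw [← mul_assoc, mul_inv_cancel₀ h1.ne', one_mul]

/-- The opposite face must have a vertex: over the empty simplex the cylinder is empty and misses
the cone point. -/
lemma join_surjective {m : ℕ} :
    Function.Surjective (join : unitInterval × Simp (m + 1) → Simp (m + 2)) := by
  intro t
  rcases eq_vertex_or_join t with rfl | ⟨p, rfl⟩
  · exact ⟨(1, stdSimplex.vertex 0), join_one _⟩
  · exact ⟨p, rfl⟩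

/-- A continuous surjection from a compact space to a Hausdorff space is a quotient map. Cones on
singular simplices can therefore be defined on the cylinder. -/
lemma isQuotientMap_join {m : ℕ} :
    Topology.IsQuotientMap (join : unitInterval × Simp (m + 1) → Simp (m + 2)) :=
  join.continuous.isClosedMap.isQuotientMap join.continuous join_surjective

lemma join_eq_join {m : ℕ} {p p' : unitInterval × Simp m} (h : join p = join p') :
    p.1 = p'.1 ∧ (p.1 = 1 ∨ p.2 = p'.2) := by
  have h0 : p.1 = p'.1 := Subtype.ext (by simpa using DFunLike.congr_fun h 0)
  refine ⟨h0, ?_⟩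
  by_cases h1 : p.1 = 1
  · exact Or.inl h1
  right
  refine simp_ext fun j => ?_
  have h2 := DFunLike.congr_fun h j.succ
  rw [join_apply_succ, join_apply_succ, ← h0] at h2
  exact mul_left_cancel₀ (sub_ne_zero.2 fun h3 => h1 (Subtype.ext h3.symm)) h2

/-- A contraction of `Y` to the point `b`. -/
structure Contraction (Y : Type) [TopologicalSpace Y] where
  /-- the centre -/
  pt : Y
  /-- the homotopy from the identity to the constant map -/
  homotopy : C(unitInterval × Y, Y)
  apply_zero : ∀ y, homotopy (0, y) = y
  apply_one : ∀ y, homotopy (1, y) = pt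

/-- The only identification made by `join` collapses the end at time 1, where the contraction is
already constant. -/
lemma coneSing_factorsThrough (H : Contraction Y) {m : ℕ} (σ : Sing (m + 1) Y) :
    Function.FactorsThrough
      (⟨fun p => H.homotopy (p.1, σ p.2), by fun_prop⟩ : C(unitInterval × Simp (m + 1), Y))
      (join (m := m + 1)) := by
  rintro p p' h
  obtain ⟨h1, h2 | h2⟩ := join_eq_join h
  · change H.homotopy (p.1, σ p.2) = H.homotopy (p'.1, σ p'.2)
    rw [← h1, h2, H.apply_one, H.apply_one]
  · change H.homotopy (p.1, σ p.2) = H.homotopy (p'.1, σ p'.2)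
    rw [h1, h2]

/-- The cone on a singular simplex, with respect to a contraction. -/
def coneSing (H : Contraction Y) : {m : ℕ} → Sing m Y → Sing (m + 1) Y
  | 0, _ => ContinuousMap.const _ H.pt
  | _ + 1, σ => isQuotientMap_join.lift (f := join) _ (coneSing_factorsThrough H σ)

lemma coneSing_join (H : Contraction Y) {m : ℕ} (σ : Sing m Y) (p : unitInterval × Simp m) :
    coneSing H σ (join p) = H.homotopy (p.1, σ p.2) := by
  cases m with
  | zero => exact isEmptyElim p.2
  | succ m => exact ContinuousMap.congr_fun (isQuotientMap_join.lift_comp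
      (f := join) _ (coneSing_factorsThrough H σ)) p

lemma coneSing_vertex (H : Contraction Y) {m : ℕ} (σ : Sing m Y) :
    coneSing H σ (stdSimplex.vertex 0) = H.pt := by
  cases m with
  | zero => rfl
  | succ m => rw [← join_one (stdSimplex.vertex 0), coneSing_join, H.apply_one]

lemma coface_zero {m : ℕ} (s : Simp m) : coface 0 s = join (0, s) := by
  refine simp_ext fun i => ?_
  refine Fin.cases ?_ (fun j => ?_) i
  · rw [coface_apply_self]; simp
  · rw [← Fin.succAbove_zero_apply, coface_apply_succAbove]; simp

lemma coface_succ_join {m : ℕ} (i : Fin (m + 1)) (p : unitInterval × Simp m) :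
    coface i.succ (join p) = join (p.1, coface i p.2) := by
  refine simp_ext fun k => ?_
  refine Fin.cases ?_ (fun j => ?_) k
  · have := coface_apply_succAbove i.succ (join p) 0
    rw [Fin.succ_succAbove_zero] at this
    rw [this]; simp
  · rw [join_apply_succ]
    rcases Fin.eq_self_or_eq_succAbove i j with rfl | ⟨l, rfl⟩
    · rw [coface_apply_self, coface_apply_self, mul_zero]
    · rw [← Fin.succ_succAbove_succ, coface_apply_succAbove, coface_apply_succAbove,
        join_apply_succ]

lemma coface_succ_vertex {m : ℕ} (i : Fin (m + 1)) :
    coface i.succ (stdSimplex.vertex 0 : Simp (m + 1)) = stdSimplex.vertex 0 := by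
  simp only [coface, ContinuousMap.coe_mk, stdSimplex.map_vertex, Fin.succ_succAbove_zero]

lemma face_zero_coneSing (H : Contraction Y) {m : ℕ} (σ : Sing m Y) :
    face 0 (coneSing H σ) = σ := by
  ext s
  simp only [face, ContinuousMap.comp_apply]
  rw [coface_zero, coneSing_join, H.apply_zero]

lemma face_succ_coneSing (H : Contraction Y) {m : ℕ} (σ : Sing (m + 1) Y) (i : Fin (m + 1)) :
    face i.succ (coneSing H σ) = coneSing H (face i σ) := by
  ext t
  simp only [face, ContinuousMap.comp_apply]
  rcases eq_vertex_or_join t with rfl | ⟨p, rfl⟩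
  · rw [coface_succ_vertex, coneSing_vertex, coneSing_vertex]
  · rw [coface_succ_join, coneSing_join, coneSing_join]; rfl

/-- The cone operator on chains. -/
def cone (H : Contraction Y) (m : ℕ) : Ch m Y →ₗ[ℚ] Ch (m + 1) Y :=
  extend fun σ => Finsupp.single (coneSing H σ) 1

@[simp]
lemma cone_single (H : Contraction Y) {m : ℕ} (σ : Sing m Y) :
    cone H m (Finsupp.single σ 1) = Finsupp.single (coneSing H σ) 1 := by
  simp [cone]

/-- The face opposite the cone point returns the simplex. The other faces are cones on its faces,
with signs reversed by the index shift. -/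
lemma bd_cone_succ (H : Contraction Y) {m : ℕ} (c : Ch (m + 1) Y) :
    bd (m + 1) (cone H (m + 1) c) = c - cone H m (bd m c) := by
  suffices h : (bd (m + 1)).comp (cone H (m + 1)) =
      LinearMap.id - (cone H m).comp (bd m) from LinearMap.congr_fun h c
  refine hom_ext fun σ => ?_
  simp only [LinearMap.comp_apply, cone_single, bd_single, LinearMap.sub_apply,
    LinearMap.id_apply, map_sum, map_smul]
  rw [Fin.sum_univ_succ]
  simp only [face_zero_coneSing, face_succ_coneSing, Fin.val_succ, pow_succ, Fin.val_zero,
    pow_zero, one_smul, mul_neg, mul_one, neg_smul, Finset.sum_neg_distrib]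
  rw [sub_eq_add_neg]

lemma bd_cone_zero (H : Contraction Y) (c : Ch 0 Y) : bd 0 (cone H 0 c) = c := by
  suffices h : (bd 0).comp (cone H 0) = (LinearMap.id : Ch 0 Y →ₗ[ℚ] Ch 0 Y) from
    LinearMap.congr_fun h c
  refine hom_ext fun σ => ?_
  simp [bd_single, face_zero_coneSing]

lemma bd_cone_of_isCyc (H : Contraction Y) {m : ℕ} {c : Ch m Y} (h : IsCyc m c) :
    bd m (cone H m c) = c := by
  cases m with
  | zero => exact bd_cone_zero H c
  | succ m => rw [bd_cone_succ, show bd m c = 0 from h, map_zero, sub_zero]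

lemma Contraction.exactAt (H : Contraction Y) (m : ℕ) : ExactAt m Y :=
  fun z hz => ⟨cone H m z, bd_cone_of_isCyc H hz⟩

/-- Straight-line contraction of a standard simplex to one of its points. -/
def simpContraction {m : ℕ} (b : Simp m) : Contraction (Simp m) where
  pt := b
  homotopy :=
    { toFun p := ⟨fun i => (1 - (p.1 : ℝ)) * p.2 i + p.1 * b i, by
        constructor
        · intro i
          exact add_nonneg (mul_nonneg (sub_nonneg.2 p.1.2.2) (stdSimplex.zero_le _ _))
            (mul_nonneg p.1.2.1 (stdSimplex.zero_le _ _))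
        · rw [Finset.sum_add_distrib, ← Finset.mul_sum, ← Finset.mul_sum]
          simp⟩
      continuous_toFun := by
        refine Continuous.subtype_mk (continuous_pi fun i => ?_) _
        have h : Continuous fun p : unitInterval × Simp m => p.2 i :=
          (continuous_apply i).comp (continuous_subtype_val.comp continuous_snd)
        fun_prop }
  apply_zero y := simp_ext fun i => by
    change (1 - ((0 : unitInterval) : ℝ)) * y i + ((0 : unitInterval) : ℝ) * b i = y i
    simp
  apply_one y := simp_ext fun i => by
    change (1 - ((1 : unitInterval) : ℝ)) * y i + ((1 : unitInterval) : ℝ) * b i = b i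
    simp

/-- Straight-line contraction of the unit interval to `0`. -/
def intervalContraction : Contraction unitInterval where
  pt := 0
  homotopy := ⟨fun p => unitInterval.symm p.1 * p.2, by fun_prop⟩
  apply_zero y := by simp
  apply_one y := by simp

/-- The product of two contractions. -/
def Contraction.prod (H : Contraction X) (H' : Contraction Y) : Contraction (X × Y) where
  pt := (H.pt, H'.pt)
  homotopy := ⟨fun p => (H.homotopy (p.1, p.2.1), H'.homotopy (p.1, p.2.2)), by fun_prop⟩
  apply_zero y := by simp [H.apply_zero, H'.apply_zero]
  apply_one y := by simp [H.apply_one, H'.apply_one]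

end AugmentedChains

namespace AugmentedChains

open Finset

variable {X Y Z : Type} [TopologicalSpace X] [TopologicalSpace Y] [TopologicalSpace Z]

/-- The tautological singular simplex of the standard simplex. -/
def taut (m : ℕ) : Ch m (Simp m) := Finsupp.single (ContinuousMap.id _) 1

@[simp]
lemma push_taut {m : ℕ} (σ : Sing m Y) : push m σ (taut m) = Finsupp.single σ 1 := by
  simp [taut]

/-! ### Homotopy invariance -/

/-- The map `Y → I × Y` at time `s`. -/
def atTime (s : unitInterval) : C(Y, unitInterval × Y) := ⟨fun y => (s, y), by fun_prop⟩

/-- The map `id × f : I × X → I × Y`. -/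
def cyl (f : C(X, Y)) : C(unitInterval × X, unitInterval × Y) :=
  (ContinuousMap.id _).prodMap f

/-- The operator which sends a simplex `σ` to the image of a given chain of `I × Δ`. -/
def cylOp {m k : ℕ} (p : Ch k (unitInterval × Simp m)) : Ch m Y →ₗ[ℚ] Ch k (unitInterval × Y) :=
  extend fun σ => push k (cyl σ) p

/-- Naturality reduces identities between such operators to the tautological simplex. -/
lemma cylOp_push {m k : ℕ} (p : Ch k (unitInterval × Simp m)) (f : C(X, Y)) (c : Ch m X) :
    cylOp p (push m f c) = push k (cyl f) (cylOp p c) := by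
  suffices h : (cylOp p).comp (push m f) = (push k (cyl f)).comp (cylOp p) from
    LinearMap.congr_fun h c
  refine hom_ext fun σ => ?_
  simp only [LinearMap.comp_apply, push_single, cylOp, extend_single, one_smul, push_push]
  rfl

lemma cylOp_taut {m k : ℕ} (p : Ch k (unitInterval × Simp m)) : cylOp p (taut m) = p := by
  simp only [cylOp, taut, extend_single, one_smul]
  exact push_id p

/-- The prism on the standard simplex. -/
def prism : (m : ℕ) → Ch (m + 1) (unitInterval × Simp m)
  | 0 => 0
  | m + 1 => cone (intervalContraction.prod (simpContraction (stdSimplex.vertex 0))) (m + 1)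
      (push _ (atTime 1) (taut (m + 1)) - push _ (atTime 0) (taut (m + 1)) -
        cylOp (prism m) (bd m (taut (m + 1))))

lemma bd_cylOp_prism_zero (c : Ch 0 Y) :
    bd 0 (cylOp (prism 0) c) = push 0 (atTime 1) c - push 0 (atTime 0) c := by
  rw [push_zero_eq (atTime 1) (atTime 0), sub_self]
  suffices h : (cylOp (prism 0) : Ch 0 Y →ₗ[ℚ] _) = 0 by rw [h]; simp
  refine hom_ext fun σ => ?_
  simp [cylOp, prism]

/-- Acyclic models: by naturality it is enough to treat the tautological simplex. There the prism is
a cone on the required boundary, which is a cycle by the identity one degree lower. -/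
lemma bd_cylOp_prism_succ {m : ℕ} (c : Ch (m + 1) Y) :
    bd (m + 1) (cylOp (prism (m + 1)) c) =
      push _ (atTime 1) c - push _ (atTime 0) c - cylOp (prism m) (bd m c) := by
  induction m generalizing Y with
  | zero =>
    have key : bd 1 (prism 1) = push _ (atTime 1) (taut 1) - push _ (atTime 0) (taut 1) -
        cylOp (prism 0) (bd 0 (taut 1)) := by
      refine bd_cone_of_isCyc _ ?_
      change bd 0 _ = 0
      rw [map_sub, map_sub, bd_cylOp_prism_zero, bd_push, bd_push, sub_self]
    suffices h : (bd 1).comp (cylOp (prism 1)) = push _ (atTime 1) - push _ (atTime 0) -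
        (cylOp (prism 0)).comp (bd (Y := Y) 0) from LinearMap.congr_fun h c
    refine hom_ext fun σ => ?_
    simp only [LinearMap.comp_apply, LinearMap.sub_apply]
    rw [← push_taut, cylOp_push, bd_push, bd_push, cylOp_push]
    rw [cylOp_taut, key]
    simp only [map_sub, push_push]
    rfl
  | succ m ih =>
    have key : bd (m + 2) (prism (m + 2)) =
        push _ (atTime 1) (taut (m + 2)) - push _ (atTime 0) (taut (m + 2)) -
        cylOp (prism (m + 1)) (bd (m + 1) (taut (m + 2))) := by
      refine bd_cone_of_isCyc _ ?_
      change bd (m + 1) _ = 0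
      rw [map_sub, map_sub, ih, bd_push, bd_push, bd_bd, map_zero, sub_zero, sub_self]
    suffices h : (bd (m + 2)).comp (cylOp (prism (m + 2))) = push _ (atTime 1) -
        push _ (atTime 0) - (cylOp (prism (m + 1))).comp (bd (Y := Y) (m + 1)) from
      LinearMap.congr_fun h c
    refine hom_ext fun σ => ?_
    simp only [LinearMap.comp_apply, LinearMap.sub_apply]
    rw [← push_taut, cylOp_push, bd_push, bd_push, cylOp_push]
    rw [cylOp_taut, key]
    simp only [map_sub, push_push]
    rfl

lemma exists_bd_of_homotopic {f g : C(X, Y)} (h : f.Homotopic g) {m : ℕ} {z : Ch m X}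
    (hz : IsCyc m z) : ∃ c : Ch (m + 1) Y, bd m c = push m g z - push m f z := by
  obtain ⟨F⟩ := h
  refine ⟨push _ F.toContinuousMap (cylOp (prism m) z), ?_⟩
  have h0 : F.toContinuousMap.comp (atTime 0) = f := by ext x; exact F.apply_zero x
  have h1 : F.toContinuousMap.comp (atTime 1) = g := by ext x; exact F.apply_one x
  rw [bd_push]
  cases m with
  | zero => rw [bd_cylOp_prism_zero, map_sub, push_push, push_push, h0, h1]
  | succ m =>
    rw [bd_cylOp_prism_succ, show bd m z = 0 from hz, map_zero, sub_zero, map_sub, push_push,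
      push_push, h0, h1]

/-- Exactness passes to homotopy retracts. -/
lemma ExactAt.of_homotopic {m : ℕ} (hY : ExactAt m Y) (f : C(X, Y)) (g : C(Y, X))
    (h : (g.comp f).Homotopic (ContinuousMap.id X)) : ExactAt m X := by
  intro z hz
  obtain ⟨c, hc⟩ := hY _ (hz.push f)
  obtain ⟨d, hd⟩ := exists_bd_of_homotopic h hz
  refine ⟨push _ g c + d, ?_⟩
  rw [map_add, bd_push, hc, hd, push_push, push_id]
  abel

/-- Exactness passes to retracts. -/
lemma ExactAt.of_retract {m : ℕ} (hY : ExactAt m Y) (f : C(X, Y)) (g : C(Y, X))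
    (h : ∀ x, g (f x) = x) : ExactAt m X :=
  hY.of_homotopic f g (by rw [show g.comp f = ContinuousMap.id X from ContinuousMap.ext h])

lemma ExactAt.of_homeomorph {m : ℕ} (hY : ExactAt m Y) (e : X ≃ₜ Y) : ExactAt m X :=
  hY.of_retract ⟨e, e.continuous⟩ ⟨e.symm, e.symm.continuous⟩ e.symm_apply_apply

/-! ### Barycentric subdivision -/

/-- The natural operator which sends a simplex `σ` to the image of a given chain of `Δ`. -/
def natOp {m k : ℕ} (u : Ch k (Simp m)) : Ch m Y →ₗ[ℚ] Ch k Y := extend fun σ => push k σ u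

lemma natOp_single {m k : ℕ} (u : Ch k (Simp m)) (σ : Sing m Y) :
    natOp u (Finsupp.single σ 1) = push k σ u := by simp [natOp]

lemma natOp_push {m k : ℕ} (u : Ch k (Simp m)) (f : C(X, Y)) (c : Ch m X) :
    natOp u (push m f c) = push k f (natOp u c) := by
  suffices h : (natOp u).comp (push m f) = (push k f).comp (natOp u) from LinearMap.congr_fun h c
  refine hom_ext fun σ => ?_
  simp only [LinearMap.comp_apply, push_single, natOp_single, push_push]

lemma natOp_taut {m k : ℕ} (u : Ch k (Simp m)) : natOp u (taut m) = u := by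
  simp [taut, natOp_single]

/-- The barycentric subdivision of the standard simplex. -/
def sdChain : (m : ℕ) → Ch m (Simp m)
  | 0 => taut 0
  | m + 1 => cone (simpContraction stdSimplex.barycenter) m
      (natOp (sdChain m) (bd m (taut (m + 1))))

/-- Barycentric subdivision. -/
def sd (m : ℕ) : Ch m Y →ₗ[ℚ] Ch m Y := natOp (sdChain m)

/-- On the tautological simplex, subdivision is the cone from the barycentre on the subdivided
boundary, and that boundary is a cycle by induction. -/
lemma bd_sd {m : ℕ} (c : Ch (m + 1) Y) : bd m (sd (m + 1) c) = sd m (bd m c) := by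
  induction m generalizing Y with
  | zero =>
    suffices h : (bd 0).comp (sd 1) = (sd 0).comp (bd (Y := Y) 0) from LinearMap.congr_fun h c
    refine hom_ext fun σ => ?_
    simp only [LinearMap.comp_apply]
    rw [← push_taut, sd, sd, natOp_push, bd_push, bd_push, natOp_push, natOp_taut]
    congr 1
    exact bd_cone_zero _ _
  | succ m ih =>
    suffices h : (bd (m + 1)).comp (sd (m + 2)) = (sd (m + 1)).comp (bd (Y := Y) (m + 1)) from
      LinearMap.congr_fun h c
    refine hom_ext fun σ => ?_
    simp only [LinearMap.comp_apply]
    rw [← push_taut, sd, sd, natOp_push, bd_push, bd_push, natOp_push, natOp_taut]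
    congr 1
    refine bd_cone_of_isCyc _ ?_
    change bd m (sd (m + 1) _) = 0
    rw [ih, bd_bd, map_zero]

/-- The homotopy between barycentric subdivision and the identity, on the standard simplex. -/
def sdHomotopyChain : (m : ℕ) → Ch (m + 1) (Simp m)
  | 0 => 0
  | m + 1 => cone (simpContraction (stdSimplex.vertex 0)) (m + 1)
      (taut (m + 1) - sdChain (m + 1) - natOp (sdHomotopyChain m) (bd m (taut (m + 1))))

lemma sd_zero (c : Ch 0 Y) : sd 0 c = c := by
  suffices h : sd 0 = (LinearMap.id : Ch 0 Y →ₗ[ℚ] Ch 0 Y) by rw [h]; rfl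
  refine hom_ext fun σ => ?_
  simp [sd, natOp_single, sdChain]

/-- Acyclic models again: the homotopy is a cone on a chain of the simplex whose boundary vanishes
because subdivision is a chain map. -/
lemma bd_sdHomotopy {m : ℕ} (c : Ch (m + 1) Y) :
    bd (m + 1) (natOp (sdHomotopyChain (m + 1)) c) =
      c - sd (m + 1) c - natOp (sdHomotopyChain m) (bd m c) := by
  induction m generalizing Y with
  | zero =>
    suffices h : (bd 1).comp (natOp (sdHomotopyChain 1)) = LinearMap.id - sd 1 -
        (natOp (sdHomotopyChain 0)).comp (bd (Y := Y) 0) from LinearMap.congr_fun h c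
    refine hom_ext fun σ => ?_
    simp only [LinearMap.comp_apply, LinearMap.sub_apply, LinearMap.id_apply]
    rw [← push_taut, sd, natOp_push, bd_push, bd_push, natOp_push, natOp_push, natOp_taut,
      natOp_taut, ← map_sub, ← map_sub]
    congr 1
    refine bd_cone_of_isCyc _ ?_
    change bd 0 _ = 0
    have h0 (d : Ch 0 (Simp 1)) : bd 0 (natOp (sdHomotopyChain 0) d) = 0 := by
      suffices h : (bd 0).comp (natOp (sdHomotopyChain 0)) = (0 : Ch 0 (Simp 1) →ₗ[ℚ] _) from
        LinearMap.congr_fun h d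
      refine hom_ext fun σ => ?_
      simp [natOp_single, sdHomotopyChain]
    rw [map_sub, map_sub, h0, sub_zero, ← natOp_taut (sdChain 1)]
    change _ - bd 0 (sd 1 _) = 0
    rw [bd_sd, sd_zero, sub_self]
  | succ m ih =>
    suffices h : (bd (m + 2)).comp (natOp (sdHomotopyChain (m + 2))) = LinearMap.id - sd (m + 2) -
        (natOp (sdHomotopyChain (m + 1))).comp (bd (Y := Y) (m + 1)) from LinearMap.congr_fun h c
    refine hom_ext fun σ => ?_
    simp only [LinearMap.comp_apply, LinearMap.sub_apply, LinearMap.id_apply]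
    rw [← push_taut, sd, natOp_push, bd_push, bd_push, natOp_push, natOp_push, natOp_taut,
      natOp_taut, ← map_sub, ← map_sub]
    congr 1
    refine bd_cone_of_isCyc _ ?_
    change bd (m + 1) _ = 0
    rw [map_sub, map_sub, ih, bd_bd, map_zero, sub_zero, ← natOp_taut (sdChain (m + 2))]
    change _ - bd (m + 1) (sd (m + 2) _) - _ = 0
    rw [bd_sd, sub_self]

lemma exists_bd_sub_sd_iterate {m : ℕ} {z : Ch (m + 1) Y} (hz : bd m z = 0) (N : ℕ) :
    ∃ c : Ch (m + 2) Y, bd (m + 1) c = z - (sd (m + 1))^[N] z := by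
  induction N with
  | zero => exact ⟨0, by simp⟩
  | succ N ih =>
    obtain ⟨c, hc⟩ := ih
    -- Telescoping: z - sd z is bounded by the homotopy, and sd z minus the next iterate by the
    -- subdivision of the earlier chain.
    refine ⟨natOp (sdHomotopyChain (m + 1)) z + sd (m + 2) c, ?_⟩
    rw [map_add, bd_sdHomotopy, hz, map_zero, sub_zero, bd_sd, hc, map_sub,
      Function.iterate_succ_apply']
    abel

end AugmentedChains

/-! ### Mesh of iterated subdivisions and small simplices -/

namespace AugmentedChains

open Finset

variable {X Y Z : Type} [TopologicalSpace X] [TopologicalSpace Y] [TopologicalSpace Z]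

lemma map_mem_of_mem_supported {m : ℕ} {V : Type*} [AddCommGroup V] [Module ℚ V]
    (f : Ch m Y →ₗ[ℚ] V) (P : Submodule ℚ V) {S : Set (Sing m Y)}
    (h : ∀ σ ∈ S, f (Finsupp.single σ 1) ∈ P) {c : Ch m Y}
    (hc : c ∈ Finsupp.supported ℚ ℚ S) : f c ∈ P := by
  rw [Finsupp.supported_eq_span_single] at hc
  have : Submodule.span ℚ ((fun i => Finsupp.single i (1 : ℚ)) '' S) ≤ P.comap f := by
    rw [Submodule.span_le]
    rintro _ ⟨σ, hσ, rfl⟩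
    exact h σ hσ
  exact this hc

lemma single_mem_supported {m : ℕ} {S : Set (Sing m Y)} {σ : Sing m Y} (h : σ ∈ S) :
    Finsupp.single σ (1 : ℚ) ∈ Finsupp.supported ℚ ℚ S :=
  Finsupp.single_mem_supported ℚ 1 h

/-- The linear map `A` has mesh at most `D` on the vertices of the standard simplex. -/
def MeshLE {m M : ℕ} (A : (Fin m → ℝ) →ₗ[ℝ] (Fin M → ℝ)) (D : ℝ) : Prop :=
  ∀ i j, ‖A (Pi.single i 1) - A (Pi.single j 1)‖ ≤ D

lemma linearMap_apply_eq_sum {m M : ℕ} (A : (Fin m → ℝ) →ₗ[ℝ] (Fin M → ℝ)) (v : Fin m → ℝ) :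
    A v = ∑ i, v i • A (Pi.single i 1) := by
  conv_lhs => rw [pi_eq_sum_univ' v]
  simp only [map_sum, map_smul]

/-- Barycentric coordinates sum to one, so the difference is a convex combination of the differences
to the vertices. -/
lemma MeshLE.norm_sub_le_of_vertex {m M : ℕ} {A : (Fin m → ℝ) →ₗ[ℝ] (Fin M → ℝ)} {D : ℝ}
    {x : Fin M → ℝ} (h : ∀ j, ‖x - A (Pi.single j 1)‖ ≤ D) (w : Simp m) :
    ‖x - A w‖ ≤ D := by
  have : x - A w = ∑ j, w j • (x - A (Pi.single j 1)) := by
    simp only [smul_sub, Finset.sum_sub_distrib, ← Finset.sum_smul, stdSimplex.sum_eq_one,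
      one_smul]
    rw [linearMap_apply_eq_sum A w]
  rw [this]
  calc ‖∑ j, w j • (x - A (Pi.single j 1))‖ ≤ ∑ j, w j * D := by
        refine norm_sum_le_of_le _ fun j _ => ?_
        rw [norm_smul, Real.norm_of_nonneg (stdSimplex.zero_le w j)]
        exact mul_le_mul_of_nonneg_left (h j) (stdSimplex.zero_le w j)
    _ = D := by rw [← Finset.sum_mul, stdSimplex.sum_eq_one, one_mul]

lemma MeshLE.norm_sub_le {m M : ℕ} {A : (Fin m → ℝ) →ₗ[ℝ] (Fin M → ℝ)} {D : ℝ}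
    (h : MeshLE A D) (s t : Simp m) : ‖A s - A t‖ ≤ D := by
  refine norm_sub_le_of_vertex (fun j => ?_) t
  rw [norm_sub_rev]
  exact norm_sub_le_of_vertex (fun i => h j i) s

/-- The distance to a vertex is an average over m + 1 vertices, in which the vertex itself
contributes zero; this gives the factor. -/
lemma MeshLE.norm_barycenter_sub_le {m M : ℕ} {A : (Fin (m + 1) → ℝ) →ₗ[ℝ] (Fin M → ℝ)} {D : ℝ}
    (h : MeshLE A D) (w : Simp (m + 1)) :
    ‖A (stdSimplex.barycenter : Simp (m + 1)) - A w‖ ≤ m / (m + 1) * D := by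
  refine norm_sub_le_of_vertex (fun j => ?_) w
  have h1 : A (stdSimplex.barycenter : Simp (m + 1)) - A (Pi.single j 1) =
      ∑ i, ((m : ℝ) + 1)⁻¹ • (A (Pi.single i 1) - A (Pi.single j 1)) := by
    rw [linearMap_apply_eq_sum]
    simp only [smul_sub, Finset.sum_sub_distrib, Finset.sum_const, Finset.card_univ,
      Fintype.card_fin, ← Nat.cast_smul_eq_nsmul ℝ, smul_smul]
    have h2 (i : Fin (m + 1)) : (stdSimplex.barycenter : Simp (m + 1)) i = ((m : ℝ) + 1)⁻¹ := by
      rw [show (stdSimplex.barycenter : Simp (m + 1)) i = (Fintype.card (Fin (m + 1)) : ℝ)⁻¹ from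
        stdSimplex.barycenter_apply i]
      simp
    simp only [h2]
    push_cast
    rw [mul_inv_cancel₀ (by positivity), one_smul]
  rw [h1]
  calc _ ≤ ∑ i, ((m : ℝ) + 1)⁻¹ * (if i = j then 0 else D) := by
        refine norm_sum_le_of_le _ fun i _ => ?_
        rw [norm_smul, Real.norm_of_nonneg (by positivity)]
        refine mul_le_mul_of_nonneg_left ?_ (by positivity)
        split_ifs with hij
        · simp [hij]
        · exact h i j
    _ = m / (m + 1) * D := by
        rw [← Finset.mul_sum, Finset.sum_ite, Finset.sum_const_zero, zero_add, Finset.sum_const,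
          Finset.filter_not, Finset.card_sdiff]
        simp [Finset.filter_eq']
        ring

/-- Affine simplices of a standard simplex, of mesh at most `D`. -/
def affineSing (m M : ℕ) (D : ℝ) : Set (Sing m (Simp M)) :=
  {τ | ∃ L : (Fin m → ℝ) →ₗ[ℝ] (Fin M → ℝ), (∀ t, (τ t : Fin M → ℝ) = L t) ∧ MeshLE L D}

/-- Affine simplices of the standard simplex which shrink the mesh by the factor `m / (m + 1)`. -/
def shrinkingSing (m : ℕ) : Set (Sing m (Simp m)) :=
  {τ | ∃ L : (Fin m → ℝ) →ₗ[ℝ] (Fin m → ℝ), (∀ t, (τ t : Fin m → ℝ) = L t) ∧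
    ∀ (M : ℕ) (A : (Fin m → ℝ) →ₗ[ℝ] (Fin M → ℝ)) (D : ℝ), MeshLE A D →
      MeshLE (A ∘ₗ L) (m / (m + 1) * D)}

lemma coface_coe {m : ℕ} (i : Fin (m + 1)) (s : Simp m) :
    (coface i s : Fin (m + 1) → ℝ) = FunOnFinite.linearMap ℝ ℝ i.succAbove s := rfl

lemma coneSing_mem_shrinkingSing {m : ℕ} {τ : Sing m (Simp m)} (hτ : τ ∈ shrinkingSing m)
    (i : Fin (m + 1)) :
    coneSing (simpContraction stdSimplex.barycenter) ((coface i).comp τ) ∈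
      shrinkingSing (m + 1) := by
  obtain ⟨L, hL, hmesh⟩ := hτ
  set F := FunOnFinite.linearMap ℝ ℝ i.succAbove
  set b : Simp (m + 1) := stdSimplex.barycenter
  -- In join coordinates the cone is linear: the first coordinate multiplies the barycentre and the
  -- tail goes through the affine simplex of the face.
  let L' : (Fin (m + 1) → ℝ) →ₗ[ℝ] (Fin (m + 1) → ℝ) :=
    (LinearMap.proj 0).smulRight (b : Fin (m + 1) → ℝ) +
      F ∘ₗ L ∘ₗ LinearMap.funLeft ℝ ℝ Fin.succ
  have hL' (v) : L' v = v 0 • (b : Fin (m + 1) → ℝ) + F (L (v ∘ Fin.succ)) := rfl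
  have hval : ∀ t, (coneSing (simpContraction b) ((coface i).comp τ) t : Fin (m + 1) → ℝ) =
      L' t := by
    intro t
    rw [hL']
    rcases eq_vertex_or_join t with rfl | ⟨p, rfl⟩
    · rw [coneSing_vertex]
      have : ((Pi.single 0 1 : Fin (m + 1) → ℝ) ∘ Fin.succ) = 0 := by
        funext j; simp
      change (b : Fin (m + 1) → ℝ) = (Pi.single 0 1 : Fin (m + 1) → ℝ) 0 • _ +
        F (L ((Pi.single 0 1 : Fin (m + 1) → ℝ) ∘ Fin.succ))
      rw [this]
      simp
    · rw [coneSing_join]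
      have h1 : ((join p : Simp (m + 1)) : Fin (m + 1) → ℝ) ∘ Fin.succ =
          (1 - (p.1 : ℝ)) • (p.2 : Fin m → ℝ) := by
        funext j; exact join_apply_succ p j
      have h2 : ((join p : Simp (m + 1)) : Fin (m + 1) → ℝ) 0 = p.1 := rfl
      rw [h1, h2, map_smul, map_smul]
      have h3 : F (L p.2) = coface i (τ p.2) := by rw [coface_coe, ← hL]
      rw [h3]
      funext j
      change (1 - (p.1 : ℝ)) * (coface i (τ p.2)) j + p.1 * b j =
        p.1 * b j + (1 - (p.1 : ℝ)) * (coface i (τ p.2)) j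
      ring
  refine ⟨L', hval, fun M A D hA => ?_⟩
  have hD : 0 ≤ D := (norm_nonneg _).trans (hA 0 0)
  -- Edges inside the face and edges at the barycentre both shrink by m / (m + 1), which is stronger
  -- than the factor demanded one dimension up.
  have hle : (m : ℝ) / (m + 1) * D ≤ ((m + 1 : ℕ) : ℝ) / ((m + 1 : ℕ) + 1) * D := by
    refine mul_le_mul_of_nonneg_right ?_ hD
    rw [div_le_div_iff₀ (by positivity) (by positivity)]
    push_cast
    nlinarith
  have hL0 : L' (Pi.single 0 1) = b := by
    have := hval (stdSimplex.vertex 0)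
    rw [coneSing_vertex] at this
    exact this.symm
  have hLs (j : Fin m) : L' (Pi.single j.succ 1) = coface i (τ (stdSimplex.vertex j)) := by
    rw [hL', coface_coe]
    have : ((Pi.single j.succ 1 : Fin (m + 1) → ℝ) ∘ Fin.succ) = Pi.single j 1 := by
      funext k
      simp [Pi.single_apply]
    rw [this, Pi.single_eq_of_ne (Fin.succ_ne_zero j).symm, zero_smul, zero_add]
    congr 1
    exact (hL (stdSimplex.vertex j)).symm
  have hF : MeshLE (A ∘ₗ F) D := by
    intro a c
    have h (a : Fin m) : F (Pi.single a 1) = Pi.single (i.succAbove a) 1 := by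
      simp [F]
    simp only [LinearMap.comp_apply, h]
    exact hA _ _
  have hss := hmesh M (A ∘ₗ F) D hF
  intro a c
  refine le_trans ?_ hle
  simp only [LinearMap.comp_apply]
  refine Fin.cases ?_ (fun a' => ?_) a <;> refine Fin.cases ?_ (fun c' => ?_) c
  · simp only [sub_self, norm_zero]
    positivity
  · rw [hL0, hLs]
    exact hA.norm_barycenter_sub_le _
  · rw [hL0, hLs, norm_sub_rev]
    exact hA.norm_barycenter_sub_le _
  · have h4 := hss a' c'
    simp only [LinearMap.comp_apply] at h4
    rw [hLs, hLs, coface_coe, coface_coe]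
    rw [← stdSimplex.vertex_coe, ← stdSimplex.vertex_coe, ← hL, ← hL] at h4
    exact h4

lemma sdChain_mem_supported (m : ℕ) :
    sdChain m ∈ Finsupp.supported ℚ ℚ (shrinkingSing m) := by
  induction m with
  | zero =>
    refine single_mem_supported ⟨LinearMap.id, fun t => isEmptyElim t, fun M A D _ a => ?_⟩
    exact a.elim0
  | succ m ih =>
    rw [sdChain]
    refine map_mem_of_mem_supported (cone _ m) _
      (S := {τ | ∃ i, ∃ τ' ∈ shrinkingSing m, τ = (coface i).comp τ'}) ?_ ?_
    · rintro _ ⟨i, τ, hτ, rfl⟩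
      rw [cone_single]
      exact single_mem_supported (coneSing_mem_shrinkingSing hτ i)
    · rw [taut, bd_single, map_sum]
      refine Submodule.sum_mem _ fun i _ => ?_
      rw [map_smul, natOp_single]
      refine Submodule.smul_mem _ _ ?_
      refine map_mem_of_mem_supported (push m _) _ (fun τ hτ => ?_) ih
      rw [push_single]
      exact single_mem_supported ⟨i, τ, hτ, rfl⟩

lemma sd_mem_supported_affineSing {m M : ℕ} {D : ℝ} {c : Ch m (Simp M)}
    (hc : c ∈ Finsupp.supported ℚ ℚ (affineSing m M D)) :
    sd m c ∈ Finsupp.supported ℚ ℚ (affineSing m M (m / (m + 1) * D)) := by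
  refine map_mem_of_mem_supported _ _ ?_ hc
  rintro σ ⟨A, hA, hD⟩
  rw [sd, natOp_single]
  refine map_mem_of_mem_supported (push m σ) _ ?_ (sdChain_mem_supported m)
  rintro τ ⟨L, hL, hmesh⟩
  rw [push_single]
  refine single_mem_supported ⟨A ∘ₗ L, fun t => ?_, hmesh M A D hD⟩
  rw [ContinuousMap.comp_apply, hA, LinearMap.comp_apply, ← hL]

lemma sd_iterate_taut_mem_supported (m N : ℕ) :
    (sd m)^[N] (taut m) ∈ Finsupp.supported ℚ ℚ (affineSing m m (((m : ℝ) / (m + 1)) ^ N)) := by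
  induction N with
  | zero =>
    refine single_mem_supported ⟨LinearMap.id, fun t => rfl, fun i j => ?_⟩
    rw [pow_zero, pi_norm_le_iff_of_nonneg zero_le_one]
    intro k
    simp only [LinearMap.id_apply, Pi.sub_apply, Pi.single_apply]
    split_ifs <;> simp
  | succ N ih =>
    rw [Function.iterate_succ_apply', pow_succ']
    exact sd_mem_supported_affineSing ih

lemma sd_iterate_push {m N : ℕ} (f : C(X, Y)) (c : Ch m X) :
    (sd m)^[N] (push m f c) = push m f ((sd m)^[N] c) := by
  induction N with
  | zero => rfl
  | succ N ih =>
    rw [Function.iterate_succ_apply', ih, Function.iterate_succ_apply', sd, sd, natOp_push]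

/-- Simplices contained in `U`. -/
def singIn (m : ℕ) (U : Set Y) : Set (Sing m Y) := {σ | ∀ t, σ t ∈ U}

/-- Pull the cover back to the compact simplex and iterate until the mesh, a power of a number below
1, falls under its Lebesgue number. Covering all later iterates as well lets the finitely many
simplices of a chain share one bound. -/
lemma exists_sd_iterate_single_mem_supported {m : ℕ} {U V : Set Y} (hU : IsOpen U)
    (hV : IsOpen V) (h : U ∪ V = Set.univ) (σ : Sing m Y) :
    ∃ N, ∀ N' ≥ N, (sd m)^[N'] (Finsupp.single σ 1) ∈
      Finsupp.supported ℚ ℚ (singIn m U ∪ singIn m V) := by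
  cases m with
  | zero =>
    refine ⟨0, fun N' _ => ?_⟩
    have : singIn 0 U ∪ singIn 0 V = Set.univ :=
      Set.eq_univ_of_forall fun σ => Or.inl fun t => isEmptyElim t
    rw [this, Finsupp.supported_univ]
    trivial
  | succ m =>
  obtain ⟨δ, hδ, hball⟩ := lebesgue_number_lemma_of_metric (s := (Set.univ : Set (Simp (m + 1))))
    (c := fun b : Bool => cond b (σ ⁻¹' U) (σ ⁻¹' V)) isCompact_univ (by
      rintro (_ | _)
      · exact hV.preimage σ.continuous
      · exact hU.preimage σ.continuous) (by
      intro t _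
      rcases (h ▸ Set.mem_univ (σ t) : σ t ∈ U ∪ V) with h | h
      · exact Set.mem_iUnion.2 ⟨true, h⟩
      · exact Set.mem_iUnion.2 ⟨false, h⟩)
  have hρ : ((m + 1 : ℕ) : ℝ) / ((m + 1 : ℕ) + 1) < 1 := by
    rw [div_lt_one (by positivity)]; linarith
  have hρ0 : 0 ≤ ((m + 1 : ℕ) : ℝ) / ((m + 1 : ℕ) + 1) := by positivity
  obtain ⟨N, hN⟩ := exists_pow_lt_of_lt_one hδ hρ
  refine ⟨N, fun N' hN' => ?_⟩
  rw [← push_taut, sd_iterate_push]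
  refine map_mem_of_mem_supported (push (m + 1) σ) _ ?_ (sd_iterate_taut_mem_supported (m + 1) N')
  rintro τ ⟨L, hL, hmesh⟩
  rw [push_single]
  refine single_mem_supported ?_
  obtain ⟨b, hb⟩ := hball (τ (stdSimplex.vertex 0)) (Set.mem_univ _)
  have hτ (t) : τ t ∈ Metric.ball (τ (stdSimplex.vertex 0)) δ := by
    rw [Metric.mem_ball, Subtype.dist_eq, dist_eq_norm]
    have h1 : ((τ t : Simp (m + 1)) : Fin (m + 1) → ℝ) = L t := hL t
    have h2 : ((τ (stdSimplex.vertex 0) : Simp (m + 1)) : Fin (m + 1) → ℝ) =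
      L (stdSimplex.vertex 0 : Simp (m + 1)) := hL _
    refine lt_of_le_of_lt ?_ hN
    refine le_trans ?_ (pow_le_pow_of_le_one hρ0 hρ.le hN')
    have := hmesh.norm_sub_le t (stdSimplex.vertex 0)
    rw [← h1, ← h2] at this
    exact this
  rcases b with _ | _
  · exact Or.inr fun t => hb (hτ t)
  · exact Or.inl fun t => hb (hτ t)

lemma exists_sd_iterate_mem_supported {m : ℕ} {U V : Set Y} (hU : IsOpen U)
    (hV : IsOpen V) (h : U ∪ V = Set.univ) (c : Ch m Y) :
    ∃ N, ∀ N' ≥ N, (sd m)^[N'] c ∈ Finsupp.supported ℚ ℚ (singIn m U ∪ singIn m V) := by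
  simp only [← Module.End.pow_apply]
  induction c using Finsupp.induction_linear with
  | zero => exact ⟨0, fun N' _ => by rw [map_zero]; exact Submodule.zero_mem _⟩
  | add a b ha hb =>
    obtain ⟨N₁, h₁⟩ := ha
    obtain ⟨N₂, h₂⟩ := hb
    refine ⟨max N₁ N₂, fun N' hN' => ?_⟩
    rw [map_add]
    exact Submodule.add_mem _ (h₁ N' (le_trans (le_max_left _ _) hN'))
      (h₂ N' (le_trans (le_max_right _ _) hN'))
  | single σ a =>
    obtain ⟨N, hN⟩ := exists_sd_iterate_single_mem_supported hU hV h σ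
    refine ⟨N, fun N' hN' => ?_⟩
    rw [← mul_one a, ← smul_eq_mul, ← Finsupp.smul_single, map_smul]
    refine Submodule.smul_mem _ _ ?_
    rw [Module.End.pow_apply]
    exact hN N' hN'

/-! ### Mayer–Vietoris -/

/-- The inclusion of a subspace. -/
def incl (U : Set Y) : C(U, Y) := ⟨Subtype.val, continuous_subtype_val⟩

lemma push_incl_injective {m : ℕ} (U : Set Y) : Function.Injective (push m (incl U)) := by
  refine Finsupp.mapDomain_injective fun σ τ h => ?_
  ext t
  exact congrArg (fun f : Sing m Y => f t) h

lemma push_incl_mem_supported {m : ℕ} {U : Set Y} (c : Ch m U) :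
    push m (incl U) c ∈ Finsupp.supported ℚ ℚ (singIn m U) := by
  induction c using Finsupp.induction_linear with
  | zero => rw [map_zero]; exact Submodule.zero_mem _
  | add a b ha hb => rw [map_add]; exact Submodule.add_mem _ ha hb
  | single σ a =>
    rw [push_single]
    exact Finsupp.single_mem_supported ℚ a fun t => (σ t).2

lemma exists_push_incl_eq {m : ℕ} {U : Set Y} {c : Ch m Y}
    (hc : c ∈ Finsupp.supported ℚ ℚ (singIn m U)) : ∃ c' : Ch m U, push m (incl U) c' = c := by
  have : (LinearMap.id : Ch m Y →ₗ[ℚ] Ch m Y) c ∈ LinearMap.range (push m (incl U)) := by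
    refine map_mem_of_mem_supported _ _ (fun σ hσ => ?_) hc
    exact ⟨Finsupp.single ⟨fun t => ⟨σ t, hσ t⟩, by fun_prop⟩ 1, by rw [push_single]; rfl⟩
  exact this

lemma isCyc_of_push_incl {m : ℕ} {U : Set Y} {c : Ch m U} (h : IsCyc m (push m (incl U) c)) :
    IsCyc m c := by
  cases m with
  | zero => trivial
  | succ m =>
    refine push_incl_injective U ?_
    rw [← bd_push, map_zero]
    exact h

/-- If `U` is exact then cycles supported in `U` bound chains supported in `U`. -/
lemma ExactAt.exists_bd_eq {m : ℕ} {U : Set Y} (hU : ExactAt m U) {z : Ch m Y}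
    (hz : z ∈ Finsupp.supported ℚ ℚ (singIn m U)) (hc : IsCyc m z) :
    ∃ c ∈ Finsupp.supported ℚ ℚ (singIn (m + 1) U), bd m c = z := by
  obtain ⟨z', rfl⟩ := exists_push_incl_eq hz
  obtain ⟨c, hc⟩ := hU z' (isCyc_of_push_incl hc)
  exact ⟨push _ (incl U) c, push_incl_mem_supported c, by rw [bd_push, hc]⟩

lemma bd_mem_supported {m : ℕ} {U : Set Y} {c : Ch (m + 1) Y}
    (hc : c ∈ Finsupp.supported ℚ ℚ (singIn (m + 1) U)) :
    bd m c ∈ Finsupp.supported ℚ ℚ (singIn m U) := by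
  obtain ⟨c', rfl⟩ := exists_push_incl_eq hc
  rw [bd_push]
  exact push_incl_mem_supported _

/-- The part of the Mayer–Vietoris sequence which bounds the homology of a union. -/
theorem ExactAt.union {m : ℕ} {U V : Set Y} (hU : IsOpen U) (hV : IsOpen V)
    (h : U ∪ V = Set.univ) (eU : ExactAt (m + 1) U) (eV : ExactAt (m + 1) V)
    (eUV : ExactAt m (U ∩ V : Set Y)) : ExactAt (m + 1) Y := by
  intro z hz
  obtain ⟨N, hN⟩ := exists_sd_iterate_mem_supported hU hV h z
  obtain ⟨c, hc⟩ := exists_bd_sub_sd_iterate hz N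
  have hs := hN N le_rfl
  -- A small cycle splits as a + b with a in U and b in V. The boundary of a equals minus that of b,
  -- so it lies in the intersection.
  rw [Finsupp.supported_union, Submodule.mem_sup] at hs
  obtain ⟨a, ha, b, hb, hab⟩ := hs
  have hcyc : bd m (a + b) = 0 := by
    rw [hab, show (sd (m + 1))^[N] z = z - bd (m + 1) c by rw [hc]; abel, map_sub, bd_bd,
      show bd m z = 0 from hz, sub_zero]
  have hab' : bd m a = -bd m b := by rw [map_add] at hcyc; exact eq_neg_of_add_eq_zero_left hcyc
  have hmem : bd m a ∈ Finsupp.supported ℚ ℚ (singIn m (U ∩ V)) := by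
    have h1 : singIn m (U ∩ V) = singIn m U ∩ singIn m V := by
      ext σ; exact forall_and
    rw [h1, Finsupp.supported_inter]
    refine ⟨bd_mem_supported ha, ?_⟩
    rw [hab']
    exact Submodule.neg_mem _ (bd_mem_supported hb)
  -- Filling the common boundary in the intersection makes a - e a cycle in U and b + e a cycle in
  -- V, and each of these bounds.
  obtain ⟨e, he, hbe⟩ := eUV.exists_bd_eq hmem (isCyc_bd a)
  have hmono (W : Set Y) (hW : U ∩ V ⊆ W) : e ∈ Finsupp.supported ℚ ℚ (singIn (m + 1) W) :=
    Finsupp.supported_mono (show singIn (m + 1) (U ∩ V) ⊆ singIn (m + 1) W from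
      fun σ hσ t => hW (hσ t)) he
  obtain ⟨f, -, hf⟩ := eU.exists_bd_eq (Submodule.sub_mem _ ha (hmono U Set.inter_subset_left))
    (show bd m _ = 0 by rw [map_sub, hbe, sub_self])
  obtain ⟨g, -, hg⟩ := eV.exists_bd_eq (Submodule.add_mem _ hb (hmono V Set.inter_subset_right))
    (show bd m _ = 0 by rw [map_add, hbe, hab', add_neg_cancel])
  refine ⟨f + g + c, ?_⟩
  rw [map_add, map_add, hf, hg, hc, ← hab]
  abel

/-- A single point already makes the augmentation surjective. -/
lemma exactAt_zero_of_nonempty [Nonempty Y] : ExactAt 0 Y := by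
  intro z _
  obtain ⟨y⟩ := ‹Nonempty Y›
  refine ⟨z default • Finsupp.single (ContinuousMap.const _ y) 1, ?_⟩
  rw [map_smul, bd_single]
  ext
  simp [Subsingleton.elim (face 0 _) (default : Sing 0 Y)]

end AugmentedChains

namespace AugmentedChains

/-! ### Punctured vector spaces -/

section Punctured

variable {E : Type} [NormedAddCommGroup E]

/-- The part of a punctured space `(E × ℝ) ∖ 0` off the closed half line `-ε · ℝ≥0`. -/
def offRay (E : Type) [NormedAddCommGroup E] (ε : ℝ) : Set {p : E × ℝ // p ≠ 0} :=
  {p | p.1.1 ≠ 0 ∨ 0 < ε * p.1.2}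

lemma isOpen_offRay (ε : ℝ) : IsOpen (offRay E ε) := by
  refine IsOpen.union ?_ ?_
  · exact isOpen_ne_fun (continuous_fst.comp continuous_subtype_val) continuous_const
  · exact isOpen_lt continuous_const
      (continuous_const.mul (continuous_snd.comp continuous_subtype_val))

lemma offRay_union : offRay E 1 ∪ offRay E (-1) = Set.univ := by
  refine Set.eq_univ_of_forall fun p => ?_
  by_cases h : p.1.1 = 0
  · have h2 : p.1.2 ≠ 0 := fun h2 => p.2 (Prod.ext h h2)
    rcases h2.lt_or_gt with h3 | h3
    · exact Or.inr (Or.inr (by linarith))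
    · exact Or.inl (Or.inr (by linarith))
  · exact Or.inl (Or.inl h)

lemma offRay_inter_fst_ne {p : {p : E × ℝ // p ≠ 0}} (hp : p ∈ offRay E 1 ∩ offRay E (-1)) :
    p.1.1 ≠ 0 := by
  rcases hp with ⟨h1 | h1, h2 | h2⟩
  · exact h1
  · exact h1
  · exact h2
  · linarith

/-- Removing both opposite rays leaves (E ∖ 0) × ℝ, and shrinking the last coordinate retracts this
onto E ∖ 0. -/
lemma ExactAt.offRay_inter {m : ℕ} (h : ExactAt m {x : E // x ≠ 0}) :
    ExactAt m (offRay E 1 ∩ offRay E (-1) : Set {p : E × ℝ // p ≠ 0}) := by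
  refine h.of_homotopic ⟨fun p => ⟨p.1.1.1, offRay_inter_fst_ne p.2⟩, by fun_prop⟩
    ⟨fun x => ⟨⟨(x.1, 0), fun h => x.2 (Prod.ext_iff.1 h).1⟩, Or.inl x.2, Or.inl x.2⟩,
      by fun_prop⟩ ⟨⟨⟨fun p => ⟨⟨(p.2.1.1.1, p.1 * p.2.1.1.2), fun h =>
        offRay_inter_fst_ne p.2.2 (Prod.ext_iff.1 h).1⟩, Or.inl (offRay_inter_fst_ne (p := p.2.1) p.2.2),
        Or.inl (offRay_inter_fst_ne (p := p.2.1) p.2.2)⟩, by fun_prop⟩, ?_, ?_⟩⟩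
  · intro x; simp
  · intro x; simp

variable [NormedSpace ℝ E]

/-- The complement of a ray is star-shaped. -/
def offRayContraction (ε : ℝ) (hε : 0 < ε * ε) : Contraction (offRay E ε) where
  pt := ⟨⟨(0, ε), fun h => by simp [Prod.ext_iff] at h; simp [h] at hε⟩, Or.inr hε⟩
  homotopy :=
    { toFun p := ⟨⟨((1 - (p.1 : ℝ)) • p.2.1.1.1, (1 - (p.1 : ℝ)) * p.2.1.1.2 + p.1 * ε), by
        intro h
        obtain ⟨h1, h2⟩ := Prod.ext_iff.1 h
        simp only [Prod.fst_zero, smul_eq_zero, Prod.snd_zero] at h1 h2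
        rcases h1 with h1 | h1
        · rw [h1, zero_mul, zero_add, show (p.1 : ℝ) = 1 by linarith, one_mul] at h2
          simp [h2] at hε
        · rcases p.2.2 with h3 | h3
          · exact h3 h1
          · have h4 : (1 - (p.1 : ℝ)) * (ε * p.2.1.1.2) + p.1 * (ε * ε) = 0 := by
              linear_combination ε * h2
            have h5 := p.1.2.1
            have h6 := p.1.2.2
            rcases h5.lt_or_eq with h7 | h7
            · nlinarith [mul_pos h7 hε, mul_nonneg (sub_nonneg.2 h6) h3.le]
            · rw [← h7] at h4; simp at h4; rcases h4 with h4 | h4 <;> simp [h4] at h3⟩, by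
        by_cases h : (1 - (p.1 : ℝ)) • p.2.1.1.1 = 0
        · right
          rw [smul_eq_zero] at h
          change 0 < ε * ((1 - (p.1 : ℝ)) * p.2.1.1.2 + p.1 * ε)
          rcases h with h1 | h1
          · rw [h1, zero_mul, zero_add, show (p.1 : ℝ) = 1 by linarith, one_mul]
            exact hε
          · rcases p.2.2 with h3 | h3
            · exact absurd h1 h3
            · have h5 := p.1.2.1
              have h6 := p.1.2.2
              rw [show ε * ((1 - (p.1 : ℝ)) * p.2.1.1.2 + p.1 * ε) =
                (1 - (p.1 : ℝ)) * (ε * p.2.1.1.2) + p.1 * (ε * ε) by ring]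
              rcases h5.lt_or_eq with h7 | h7
              · exact add_pos_of_nonneg_of_pos (mul_nonneg (sub_nonneg.2 h6) h3.le)
                  (mul_pos h7 hε)
              · rw [← h7]; simpa using h3
        · exact Or.inl h⟩
      continuous_toFun := by fun_prop }
  apply_zero y := by simp
  apply_one y := by simp

/-- Suspension: two contractible open sets cover the space, so Mayer–Vietoris raises the degree by
one. -/
lemma ExactAt.punctured_prod {m : ℕ} (h : ExactAt m {x : E // x ≠ 0}) :
    ExactAt (m + 1) {p : E × ℝ // p ≠ 0} :=
  ExactAt.union (isOpen_offRay 1) (isOpen_offRay (-1)) offRay_union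
    ((offRayContraction 1 (by norm_num)).exactAt _)
    ((offRayContraction (-1) (by norm_num)).exactAt _) h.offRay_inter

/-- A punctured vector space has the reduced homology of a sphere. -/
theorem exactAt_punctured [FiniteDimensional ℝ E] {j : ℕ} (hj : j ≠ Module.finrank ℝ E) :
    ExactAt j {x : E // x ≠ 0} := by
  induction hd : Module.finrank ℝ E generalizing E j with
  | zero =>
    -- In dimension zero the punctured space is empty, and its only simplex is the one without
    -- vertices, whose index is excluded.
    obtain ⟨k, rfl⟩ := Nat.exists_eq_succ_of_ne_zero (hd ▸ hj)
    have : Subsingleton E := Module.finrank_zero_iff.1 hd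
    intro z _
    have : IsEmpty (Sing (k + 1) {x : E // x ≠ 0}) :=
      ⟨fun σ => (σ (stdSimplex.vertex 0)).2 (Subsingleton.elim _ _)⟩
    exact ⟨0, Subsingleton.elim _ _⟩
  | succ d ih =>
    let e : E ≃L[ℝ] (Fin d → ℝ) × ℝ := ContinuousLinearEquiv.ofFinrankEq (by simp [hd])
    have e' : {x : E // x ≠ 0} ≃ₜ {x : (Fin d → ℝ) × ℝ // x ≠ 0} :=
      e.toHomeomorph.subtype fun x => by
        change x ≠ 0 ↔ e x ≠ 0
        simp
    refine ExactAt.of_homeomorph ?_ e'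
    cases j with
    | zero =>
      have : Nonempty {x : (Fin d → ℝ) × ℝ // x ≠ 0} := ⟨⟨(0, 1), by simp [Prod.ext_iff]⟩⟩
      exact exactAt_zero_of_nonempty
    | succ k =>
      refine ExactAt.punctured_prod (ih ?_ (by simp))
      simp only [Module.finrank_fintype_fun_eq_card, Fintype.card_fin]
      omega

end Punctured

end AugmentedChains

namespace AugmentedChains

open Matrix
open scoped ComplexOrder

/-! ### Idempotent matrices of trace one -/

/-- The trace of a projection is the dimension of its range; a basis of the range supplies the
factors. -/
lemma exists_factor_of_idempotent {n r : ℕ} {q : Matrix (Fin n) (Fin n) ℂ} (hq : q * q = q)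
    (ht : q.trace = r) :
    ∃ (P : Matrix (Fin n) (Fin r) ℂ) (Q : Matrix (Fin r) (Fin n) ℂ), Q * P = 1 ∧ P * Q = q := by
  set f := Matrix.toLin' q with hf
  have hidem : IsIdempotentElem f := by
    change f * f = f
    rw [Module.End.mul_eq_comp, hf, ← Matrix.toLin'_mul, hq]
  have hproj := LinearMap.IsIdempotentElem.isProj_range f hidem
  have hrank : Module.finrank ℂ (LinearMap.range f) = r := by
    have h1 := hproj.trace
    rw [hf, Matrix.trace_toLin'_eq, ht] at h1
    exact_mod_cast h1.symm
  let b := Module.finBasisOfFinrankEq ℂ (LinearMap.range f) hrank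
  let P' : (Fin r → ℂ) →ₗ[ℂ] (Fin n → ℂ) :=
    (LinearMap.range f).subtype ∘ₗ b.equivFun.symm.toLinearMap
  let Q' : (Fin n → ℂ) →ₗ[ℂ] (Fin r → ℂ) := b.equivFun.toLinearMap ∘ₗ f.rangeRestrict
  refine ⟨LinearMap.toMatrix' P', LinearMap.toMatrix' Q', ?_, ?_⟩
  · rw [← LinearMap.toMatrix'_comp, ← LinearMap.toMatrix'_id]
    congr 1
    refine LinearMap.ext fun x => ?_
    change b.equivFun (f.rangeRestrict (b.equivFun.symm x : LinearMap.range f)) = x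
    have : f.rangeRestrict (b.equivFun.symm x : LinearMap.range f) = b.equivFun.symm x :=
      Subtype.ext (hproj.map_id _ (b.equivFun.symm x).2)
    rw [this, LinearEquiv.apply_symm_apply]
  · rw [← LinearMap.toMatrix'_comp]
    have : P' ∘ₗ Q' = f := by
      refine LinearMap.ext fun x => ?_
      change ((b.equivFun.symm (b.equivFun (f.rangeRestrict x)) : LinearMap.range f) :
        Fin n → ℂ) = f x
      rw [LinearEquiv.symm_apply_apply]
      rfl
    rw [this, hf, LinearMap.toMatrix'_toLin']

/-- Idempotent matrices of trace one, that is, of rank one. -/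
abbrev RankOneIdem (r : ℕ) : Type :=
  {e : Matrix (Fin r) (Fin r) ℂ // e * e = e ∧ e.trace = 1}

/-- Hermitian idempotent matrices of trace one: complex projective space. -/
abbrev RankOneProj (r : ℕ) : Type :=
  {e : Matrix (Fin r) (Fin r) ℂ // e.IsHermitian ∧ e * e = e ∧ e.trace = 1}

/-- Pairs of a vector and a covector whose pairing is one. -/
abbrev DualPair (r : ℕ) : Type := {p : (Fin r → ℂ) × (Fin r → ℂ) // p.2 ⬝ᵥ p.1 = 1}

variable {r : ℕ}

lemma exists_eq_vecMulVec {e : Matrix (Fin r) (Fin r) ℂ} (he : e * e = e) (ht : e.trace = 1) :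
    ∃ v φ : Fin r → ℂ, φ ⬝ᵥ v = 1 ∧ e = vecMulVec v φ := by
  obtain ⟨P, Q, h1, h2⟩ := exists_factor_of_idempotent (r := 1) he (by simpa using ht)
  refine ⟨fun i => P i 0, fun j => Q 0 j, ?_, ?_⟩
  · have := congrFun (congrFun h1 0) 0
    simpa [Matrix.mul_apply, dotProduct] using this
  · rw [← h2]
    ext i j
    simp [Matrix.mul_apply, vecMulVec_apply]

/-- Rescaling a matrix to trace one. -/
def normalize (M : Matrix (Fin r) (Fin r) ℂ) : Matrix (Fin r) (Fin r) ℂ := M.trace⁻¹ • M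

lemma normalize_smul {c : ℂ} (hc : c ≠ 0) (M : Matrix (Fin r) (Fin r) ℂ) :
    normalize (c • M) = normalize M := by
  rw [normalize, normalize, trace_smul, smul_smul, smul_eq_mul, mul_inv, mul_comm c⁻¹,
    mul_assoc, inv_mul_cancel₀ hc, mul_one]

lemma normalize_of_trace_eq_one {M : Matrix (Fin r) (Fin r) ℂ} (h : M.trace = 1) :
    normalize M = M := by
  rw [normalize, h, inv_one, one_smul]

/-- The orthogonal projection onto the line spanned by `v`. -/
def lineProj (v : Fin r → ℂ) : Matrix (Fin r) (Fin r) ℂ := normalize (vecMulVec v (star v))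

lemma trace_vecMulVec_star (v : Fin r → ℂ) : (vecMulVec v (star v)).trace = star v ⬝ᵥ v := by
  rw [trace_vecMulVec, dotProduct_comm]

lemma star_dotProduct_self_ne_zero {v : Fin r → ℂ} (hv : v ≠ 0) : star v ⬝ᵥ v ≠ 0 := by
  rwa [Ne, dotProduct_star_self_eq_zero]

lemma lineProj_mem {v : Fin r → ℂ} (hv : v ≠ 0) :
    (lineProj v).IsHermitian ∧ lineProj v * lineProj v = lineProj v ∧ (lineProj v).trace = 1 := by
  have h := star_dotProduct_self_ne_zero hv
  have hr : star (star v ⬝ᵥ v) = star v ⬝ᵥ v := by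
    rw [← star_dotProduct_star, star_star, dotProduct_comm]
  unfold lineProj normalize
  rw [trace_vecMulVec_star]
  refine ⟨?_, ?_, ?_⟩
  · rw [Matrix.IsHermitian, conjTranspose_smul, conjTranspose_vecMulVec, star_star, star_inv₀, hr]
  · rw [smul_mul_smul_comm, vecMulVec_mul_vecMulVec, vecMulVec_smul, smul_smul]
    congr 1
    rw [mul_assoc, inv_mul_cancel₀ h, mul_one]
  · rw [trace_smul, trace_vecMulVec_star, smul_eq_mul, inv_mul_cancel₀ h]

/-- Linear maps act on lines by a formula in the projection matrix alone, so continuity never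
requires a continuous choice of vector. If the vector is killed, both sides are zero. -/
lemma normalize_conj_eq_lineProj {k : ℕ} {v : Fin r → ℂ} (hv : v ≠ 0)
    (L : Matrix (Fin k) (Fin r) ℂ) :
    normalize (L * lineProj v * Lᴴ) = lineProj (L *ᵥ v) := by
  rw [lineProj, normalize.eq_def (vecMulVec v (star v)), Matrix.mul_smul, Matrix.smul_mul,
    normalize_smul, mul_vecMulVec, vecMulVec_mul, ← star_mulVec]
  · rfl
  · rw [trace_vecMulVec_star]
    exact inv_ne_zero (star_dotProduct_self_ne_zero hv)

lemma trace_conj_lineProj_ne_zero {k : ℕ} {v : Fin r → ℂ} (hv : v ≠ 0)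
    {L : Matrix (Fin k) (Fin r) ℂ} (hL : L *ᵥ v ≠ 0) : (L * lineProj v * Lᴴ).trace ≠ 0 := by
  rw [lineProj, normalize, Matrix.mul_smul, Matrix.smul_mul, mul_vecMulVec,
    vecMulVec_mul, ← star_mulVec, trace_smul, trace_vecMulVec_star, trace_vecMulVec_star]
  exact mul_ne_zero (inv_ne_zero (star_dotProduct_self_ne_zero hv))
    (star_dotProduct_self_ne_zero hL)

lemma lineProj_smul {c : ℂ} (hc : c ≠ 0) (v : Fin r → ℂ) : lineProj (c • v) = lineProj v := by
  rw [lineProj, star_smul, smul_vecMulVec, vecMulVec_smul, smul_smul, normalize_smul]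
  · rfl
  · exact mul_ne_zero hc (star_ne_zero.2 hc)

/-- For e = vφ the product of e with its adjoint is a nonzero multiple of the matrix of v with its
conjugate; the covector only enters the scalar. -/
lemma normalize_mul_conjTranspose (v φ : Fin r → ℂ) (h : φ ⬝ᵥ v = 1) :
    normalize (vecMulVec v φ * (vecMulVec v φ)ᴴ) = lineProj v := by
  have hφ : star φ ≠ 0 := by
    rw [star_ne_zero]
    rintro rfl
    simp at h
  rw [conjTranspose_vecMulVec, vecMulVec_mul_vecMulVec, vecMulVec_smul, normalize_smul]
  · rfl
  · have := star_dotProduct_self_ne_zero hφ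
    rwa [star_star] at this

lemma ne_zero_of_dotProduct_eq_one {v φ : Fin r → ℂ} (h : φ ⬝ᵥ v = 1) : v ≠ 0 := by
  rintro rfl
  simp at h

lemma exists_eq_lineProj (e : RankOneProj r) : ∃ v : Fin r → ℂ, v ≠ 0 ∧ e.1 = lineProj v := by
  obtain ⟨v, φ, h1, h2⟩ := exists_eq_vecMulVec e.2.2.1 e.2.2.2
  refine ⟨v, ne_zero_of_dotProduct_eq_one h1, ?_⟩
  rw [← normalize_mul_conjTranspose v φ h1, ← h2]
  have h3 : e.1ᴴ = e.1 := e.2.1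
  rw [h3, e.2.2.1, normalize_of_trace_eq_one e.2.2.2]

lemma continuous_normalize {X : Type*} [TopologicalSpace X] {f : X → Matrix (Fin r) (Fin r) ℂ}
    (hf : Continuous f) (h : ∀ x, (f x).trace ≠ 0) : Continuous fun x => normalize (f x) :=
  (hf.matrix_trace.inv₀ h).smul hf

lemma continuous_lineProj {X : Type*} [TopologicalSpace X] {f : X → Fin r → ℂ}
    (hf : Continuous f) (h : ∀ x, f x ≠ 0) : Continuous fun x => lineProj (f x) := by
  refine continuous_normalize (hf.matrix_vecMulVec hf.star) fun x => ?_
  rw [trace_vecMulVec_star]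
  exact star_dotProduct_self_ne_zero (h x)

lemma lineProj_apply (v : Fin r → ℂ) (i j : Fin r) :
    lineProj v i j = (star v ⬝ᵥ v)⁻¹ * (v i * star (v j)) := by
  rw [lineProj, normalize, trace_vecMulVec_star]
  rfl

/-! ### The affine chart of projective space -/

/-- The locus where the first homogeneous coordinate does not vanish. -/
def chart (r : ℕ) : Set (RankOneProj (r + 1)) := {e | e.1 0 0 ≠ 0}

/-- The locus where some homogeneous coordinate other than the first does not vanish. -/
def offPoint (r : ℕ) : Set (RankOneProj (r + 1)) := {e | e.1 0 0 ≠ 1}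

lemma isOpen_chart : IsOpen (chart r) :=
  isOpen_ne_fun (continuous_subtype_val.matrix_elem 0 0) continuous_const

lemma isOpen_offPoint : IsOpen (offPoint r) :=
  isOpen_ne_fun (continuous_subtype_val.matrix_elem 0 0) continuous_const

lemma chart_union_offPoint : chart r ∪ offPoint r = Set.univ := by
  refine Set.eq_univ_of_forall fun e => ?_
  by_cases h : e.1 0 0 = 0
  · right
    change e.1 0 0 ≠ 1
    rw [h]
    exact zero_ne_one
  · exact Or.inl h

lemma mem_chart_iff {e : RankOneProj (r + 1)} {v : Fin (r + 1) → ℂ} (hv : v ≠ 0)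
    (he : e.1 = lineProj v) : e ∈ chart r ↔ v 0 ≠ 0 := by
  change e.1 0 0 ≠ 0 ↔ _
  rw [he, lineProj_apply]
  simp [star_dotProduct_self_ne_zero hv]

/-- The corner entry is |v₀|² / |v|², which equals 1 exactly when the other coordinates vanish. -/
lemma mem_offPoint_iff {e : RankOneProj (r + 1)} {v : Fin (r + 1) → ℂ} (hv : v ≠ 0)
    (he : e.1 = lineProj v) : e ∈ offPoint r ↔ v ∘ Fin.succ ≠ 0 := by
  change e.1 0 0 ≠ 1 ↔ _
  rw [not_iff_not, he, lineProj_apply]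
  have h1 : star v ⬝ᵥ v = v 0 * star (v 0) + star (v ∘ Fin.succ) ⬝ᵥ (v ∘ Fin.succ) := by
    simp only [dotProduct, Fin.sum_univ_succ, Pi.star_apply, Function.comp_apply]
    rw [mul_comm (star (v 0))]
  rw [inv_mul_eq_one₀ (star_dotProduct_self_ne_zero hv), h1, add_eq_left,
    dotProduct_star_self_eq_zero]

/-- Affine coordinates on the chart. -/
def chartCoord : C(chart r, Fin r → ℂ) where
  toFun e i := e.1.1 i.succ 0 / e.1.1 0 0
  continuous_toFun := continuous_pi fun _ =>
    ((continuous_subtype_val.comp continuous_subtype_val).matrix_elem _ _).div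
      ((continuous_subtype_val.comp continuous_subtype_val).matrix_elem _ _) fun e => e.2

lemma cons_one_ne_zero (x : Fin r → ℂ) : (Fin.cons 1 x : Fin (r + 1) → ℂ) ≠ 0 := fun h => by
  simpa using congrFun h 0

/-- The parametrization of the chart. -/
def chartParam : C(Fin r → ℂ, RankOneProj (r + 1)) where
  toFun x := ⟨lineProj (Fin.cons 1 x), lineProj_mem (cons_one_ne_zero x)⟩
  continuous_toFun := Continuous.subtype_mk (continuous_lineProj (by
    refine continuous_pi fun i => ?_
    refine Fin.cases ?_ (fun j => ?_) i
    · exact continuous_const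
    · exact continuous_apply j) cons_one_ne_zero) _

lemma chartParam_mem_chart (x : Fin r → ℂ) : chartParam x ∈ chart r :=
  (mem_chart_iff (cons_one_ne_zero x) rfl).2 (by simp)

lemma chartParam_mem_offPoint {x : Fin r → ℂ} (hx : x ≠ 0) : chartParam x ∈ offPoint r :=
  (mem_offPoint_iff (cons_one_ne_zero x) rfl).2 (by simpa [Function.comp_def] using hx)

lemma chartCoord_eq {e : chart r} {v : Fin (r + 1) → ℂ} (hv : v ≠ 0)
    (he : e.1.1 = lineProj v) : chartCoord e = (v 0)⁻¹ • (v ∘ Fin.succ) := by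
  have h0 := (mem_chart_iff hv he).1 e.2
  funext i
  change e.1.1 i.succ 0 / e.1.1 0 0 = _
  rw [he, lineProj_apply, lineProj_apply]
  have := star_dotProduct_self_ne_zero hv
  have h2 : star (v 0) ≠ 0 := star_ne_zero.2 h0
  simp only [Pi.smul_apply, Function.comp_apply, smul_eq_mul]
  field_simp

lemma chartParam_chartCoord (e : chart r) : chartParam (chartCoord e) = e.1 := by
  obtain ⟨v, hv, he⟩ := exists_eq_lineProj e.1
  have h0 := (mem_chart_iff hv he).1 e.2
  refine Subtype.ext ?_
  change lineProj (Fin.cons 1 (chartCoord e)) = e.1.1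
  rw [he, chartCoord_eq hv he, ← lineProj_smul (inv_ne_zero h0) v]
  congr 1
  funext i
  refine Fin.cases ?_ (fun j => ?_) i
  · simp [h0]
  · simp

/-- Straight-line contraction of a vector space. -/
def vectorContraction (E : Type) [NormedAddCommGroup E] [NormedSpace ℝ E] : Contraction E where
  pt := 0
  homotopy := ⟨fun p => (1 - (p.1 : ℝ)) • p.2, by fun_prop⟩
  apply_zero y := by simp
  apply_one y := by simp

lemma exactAt_chart (m : ℕ) : ExactAt m (chart r) := by
  exact ((vectorContraction (Fin r → ℂ)).exactAt m).of_retract chartCoord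
    ⟨fun x => ⟨chartParam x, chartParam_mem_chart x⟩, by fun_prop⟩
    fun e => Subtype.ext (chartParam_chartCoord e)

/-- Affine coordinates identify the intersection with punctured ℂ^r, of real dimension 2r. -/
lemma exactAt_chart_inter {m : ℕ} (h : m ≠ 2 * r) :
    ExactAt m (chart r ∩ offPoint r : Set (RankOneProj (r + 1))) := by
  have h1 : ExactAt m {x : Fin r → ℂ // x ≠ 0} := exactAt_punctured (by
    rw [Module.finrank_pi_fintype]
    simpa [mul_comm] using h)
  have hne (e : (chart r ∩ offPoint r : Set (RankOneProj (r + 1)))) :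
      chartCoord ⟨e.1, e.2.1⟩ ≠ 0 := by
    obtain ⟨v, hv, he⟩ := exists_eq_lineProj e.1
    rw [chartCoord_eq hv he]
    exact smul_ne_zero (inv_ne_zero ((mem_chart_iff hv he).1 e.2.1))
      ((mem_offPoint_iff hv he).1 e.2.2)
  exact h1.of_retract ⟨fun e => ⟨chartCoord ⟨e.1, e.2.1⟩, hne e⟩, by fun_prop⟩
    ⟨fun x => ⟨chartParam x.1, chartParam_mem_chart x.1, chartParam_mem_offPoint x.2⟩,
      by fun_prop⟩ fun e => Subtype.ext (chartParam_chartCoord ⟨e.1, e.2.1⟩)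

/-- The matrix of the projection which forgets the first coordinate. -/
def dropFirst (r : ℕ) : Matrix (Fin r) (Fin (r + 1)) ℂ := fun i j => if j = i.succ then 1 else 0

lemma dropFirst_mulVec (v : Fin (r + 1) → ℂ) : dropFirst r *ᵥ v = v ∘ Fin.succ := by
  funext i
  simp [dropFirst, mulVec, dotProduct]

lemma dropFirst_conjTranspose_mulVec (u : Fin r → ℂ) :
    (dropFirst r)ᴴ *ᵥ u = (Fin.cons 0 u : Fin (r + 1) → ℂ) := by
  funext i
  simp only [dropFirst, mulVec, dotProduct, conjTranspose_apply]
  refine Fin.cases ?_ (fun j => ?_) i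
  · simp [(Fin.succ_ne_zero _).symm]
  · simp

/-- The diagonal matrix `diag(s, 1, …, 1)`. -/
def scaleFirst (r : ℕ) (s : ℂ) : Matrix (Fin (r + 1)) (Fin (r + 1)) ℂ :=
  Matrix.diagonal (Fin.cons s 1)

lemma scaleFirst_mulVec (s : ℂ) (v : Fin (r + 1) → ℂ) :
    scaleFirst r s *ᵥ v = (Fin.cons (s * v 0) (v ∘ Fin.succ) : Fin (r + 1) → ℂ) := by
  funext i
  rw [scaleFirst, mulVec_diagonal]
  refine Fin.cases ?_ (fun j => ?_) i <;> simp

lemma continuous_scaleFirst : Continuous (scaleFirst r) := by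
  refine Continuous.matrix_diagonal (continuous_pi fun i => ?_)
  refine Fin.cases ?_ (fun j => ?_) i
  · exact continuous_id
  · exact continuous_const

lemma scaleFirst_mulVec_ne_zero (s : ℂ) {v : Fin (r + 1) → ℂ} (hv : v ∘ Fin.succ ≠ 0) :
    scaleFirst r s *ᵥ v ≠ 0 := fun h => hv (by
  rw [scaleFirst_mulVec] at h
  funext j
  simpa using congrFun h j.succ)

lemma cons_zero_ne_zero {u : Fin r → ℂ} (hu : u ≠ 0) : (Fin.cons 0 u : Fin (r + 1) → ℂ) ≠ 0 :=
  fun h => hu (by funext j; simpa using congrFun h j.succ)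

/-- Projective space minus a point retracts onto the hyperplane at infinity by scaling the first
homogeneous coordinate to zero. -/
lemma ExactAt.offPoint {m : ℕ} (h : ExactAt m (RankOneProj r)) :
    ExactAt m (offPoint r) := by
  have hrep (e : AugmentedChains.offPoint r) :
      ∃ v : Fin (r + 1) → ℂ, v ≠ 0 ∧ v ∘ Fin.succ ≠ 0 ∧ e.1.1 = lineProj v := by
    obtain ⟨v, hv, he⟩ := exists_eq_lineProj e.1
    exact ⟨v, hv, (mem_offPoint_iff hv he).1 e.2, he⟩
  have cval : Continuous fun e : AugmentedChains.offPoint r => e.1.1 :=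
    continuous_subtype_val.comp continuous_subtype_val
  let f : C(AugmentedChains.offPoint r, RankOneProj r) :=
    { toFun e := ⟨normalize (dropFirst r * e.1.1 * (dropFirst r)ᴴ), by
        obtain ⟨v, hv, hv', he⟩ := hrep e
        rw [he, normalize_conj_eq_lineProj hv, dropFirst_mulVec]
        exact lineProj_mem hv'⟩
      continuous_toFun := by
        exact Continuous.subtype_mk (continuous_normalize
        ((continuous_const.matrix_mul cval).matrix_mul continuous_const) fun e => by
          obtain ⟨v, hv, hv', he⟩ := hrep e
          rw [he]
          refine trace_conj_lineProj_ne_zero hv ?_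
          rwa [dropFirst_mulVec]) _ }
  have hg (e : RankOneProj r) : ∃ u : Fin r → ℂ, u ≠ 0 ∧ e.1 = lineProj u ∧
      normalize ((dropFirst r)ᴴ * e.1 * (dropFirst r)ᴴᴴ) = lineProj (Fin.cons 0 u) := by
    obtain ⟨u, hu, he⟩ := exists_eq_lineProj e
    refine ⟨u, hu, he, ?_⟩
    rw [he, normalize_conj_eq_lineProj hu, dropFirst_conjTranspose_mulVec]
  let g : C(RankOneProj r, AugmentedChains.offPoint r) :=
    { toFun e := ⟨⟨normalize ((dropFirst r)ᴴ * e.1 * (dropFirst r)ᴴᴴ), by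
        obtain ⟨u, hu, -, he⟩ := hg e
        rw [he]
        exact lineProj_mem (cons_zero_ne_zero hu)⟩, by
        obtain ⟨u, hu, -, he⟩ := hg e
        exact (mem_offPoint_iff (cons_zero_ne_zero hu) he).2
          (by simpa [Function.comp_def] using hu)⟩
      continuous_toFun := by
        exact Continuous.subtype_mk (Continuous.subtype_mk (continuous_normalize
        ((continuous_const.matrix_mul continuous_subtype_val).matrix_mul continuous_const)
          fun e => by
          obtain ⟨u, hu, he, -⟩ := hg e
          rw [he]
          refine trace_conj_lineProj_ne_zero hu ?_
          rw [dropFirst_conjTranspose_mulVec]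
          exact cons_zero_ne_zero hu) _) _ }
  refine h.of_homotopic f g ⟨⟨⟨fun p => ⟨⟨normalize (scaleFirst r (p.1 : ℝ) * p.2.1.1 *
    (scaleFirst r (p.1 : ℝ))ᴴ), ?_⟩, ?_⟩, ?_⟩, ?_, ?_⟩⟩
  · obtain ⟨v, hv, hv', he⟩ := hrep p.2
    rw [he, normalize_conj_eq_lineProj hv]
    exact lineProj_mem (scaleFirst_mulVec_ne_zero _ hv')
  · obtain ⟨v, hv, hv', he⟩ := hrep p.2
    refine (mem_offPoint_iff (scaleFirst_mulVec_ne_zero ((p.1 : ℝ) : ℂ) hv')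
      (by
        change normalize (scaleFirst r ((p.1 : ℝ) : ℂ) * p.2.1.1 * _) = _
        rw [he, normalize_conj_eq_lineProj hv])).2 ?_
    rw [scaleFirst_mulVec]
    simpa [Function.comp_def] using hv'
  · have c1 : Continuous fun p : unitInterval × AugmentedChains.offPoint r =>
        scaleFirst r (p.1 : ℝ) :=
      continuous_scaleFirst.comp (Complex.continuous_ofReal.comp
        (continuous_subtype_val.comp continuous_fst))
    refine Continuous.subtype_mk (Continuous.subtype_mk (continuous_normalize
      ((c1.matrix_mul (cval.comp continuous_snd)).matrix_mul c1.matrix_conjTranspose)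
        fun p => ?_) _) _
    obtain ⟨v, hv, hv', he⟩ := hrep p.2
    change ((scaleFirst r (p.1 : ℝ)) * p.2.1.1 * _).trace ≠ 0
    rw [he]
    exact trace_conj_lineProj_ne_zero hv (scaleFirst_mulVec_ne_zero _ hv')
  · intro e
    refine Subtype.ext (Subtype.ext ?_)
    obtain ⟨v, hv, hv', he⟩ := hrep e
    change normalize (scaleFirst r ((0 : ℝ) : ℂ) * e.1.1 * (scaleFirst r ((0 : ℝ) : ℂ))ᴴ) =
      normalize ((dropFirst r)ᴴ * normalize (dropFirst r * e.1.1 * (dropFirst r)ᴴ) *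
        (dropFirst r)ᴴᴴ)
    rw [he, normalize_conj_eq_lineProj hv, normalize_conj_eq_lineProj hv, dropFirst_mulVec,
      normalize_conj_eq_lineProj hv', dropFirst_conjTranspose_mulVec, scaleFirst_mulVec]
    simp
  · intro e
    refine Subtype.ext (Subtype.ext ?_)
    obtain ⟨v, hv, hv', he⟩ := hrep e
    change normalize (scaleFirst r ((1 : ℝ) : ℂ) * e.1.1 * (scaleFirst r ((1 : ℝ) : ℂ))ᴴ) = e.1.1
    rw [he, normalize_conj_eq_lineProj hv, scaleFirst_mulVec]
    congr 1
    funext i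
    refine Fin.cases ?_ (fun j => ?_) i <;> simp

/-- Complex projective space has no homology above its dimension. -/
theorem exactAt_rankOneProj {j : ℕ} (hr : 1 ≤ r) (hj : 2 * r ≤ j) :
    ExactAt j (RankOneProj r) := by
  induction r, hr using Nat.le_induction generalizing j with
  | base =>
    have hs : Subsingleton (RankOneProj 1) := ⟨fun a b => Subtype.ext (by
      ext i k
      have ha := a.2.2.2
      have hb := b.2.2.2
      simp only [Matrix.trace_fin_one] at ha hb
      rw [Subsingleton.elim i 0, Subsingleton.elim k 0, ha, hb])⟩
    let H : Contraction (RankOneProj 1) :=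
      { pt := ⟨lineProj 1, lineProj_mem one_ne_zero⟩
        homotopy := ⟨fun p => p.2, by fun_prop⟩
        apply_zero := fun y => rfl
        apply_one := fun y => Subsingleton.elim _ _ }
    exact H.exactAt j
  | succ r hr ih =>
    -- Here m is at least 2r + 1, so the one index 2r at which the chart intersection may fail to be
    -- exact is avoided.
    obtain ⟨m, rfl⟩ : ∃ m, j = m + 1 := ⟨j - 1, by omega⟩
    exact ExactAt.union isOpen_chart isOpen_offPoint chart_union_offPoint (exactAt_chart _)
      (ih (by omega)).offPoint (exactAt_chart_inter (by omega))

/-- An idempotent e and the orthogonal projection p onto its range satisfy ep = p and pe = e. The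
segment between them hence consists of idempotents, which gives a deformation onto projective space.
-/
theorem exactAt_rankOneIdem {j : ℕ} (hr : 1 ≤ r) (hj : 2 * r ≤ j) :
    ExactAt j (RankOneIdem r) := by
  have hrep (e : RankOneIdem r) : ∃ v φ : Fin r → ℂ, v ≠ 0 ∧ φ ⬝ᵥ v = 1 ∧ e.1 = vecMulVec v φ ∧
      normalize (e.1 * e.1ᴴ) = lineProj v ∧ (e.1 * e.1ᴴ).trace ≠ 0 := by
    obtain ⟨v, φ, h1, h2⟩ := exists_eq_vecMulVec e.2.1 e.2.2
    have hn : normalize (e.1 * e.1ᴴ) = lineProj v := by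
      rw [h2, normalize_mul_conjTranspose v φ h1]
    have hv := ne_zero_of_dotProduct_eq_one h1
    refine ⟨v, φ, hv, h1, h2, hn, fun h0 => ?_⟩
    have := (lineProj_mem hv).2.2
    rw [← hn, normalize, trace_smul, h0, smul_zero] at this
    exact zero_ne_one this
  have cn : Continuous fun e : RankOneIdem r => normalize (e.1 * e.1ᴴ) :=
    continuous_normalize (continuous_subtype_val.matrix_mul
      continuous_subtype_val.matrix_conjTranspose) fun e => by
        obtain ⟨v, φ, -, -, -, -, h⟩ := hrep e
        exact h
  have hmem (e : RankOneIdem r) : (normalize (e.1 * e.1ᴴ)).IsHermitian ∧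
      normalize (e.1 * e.1ᴴ) * normalize (e.1 * e.1ᴴ) = normalize (e.1 * e.1ᴴ) ∧
      (normalize (e.1 * e.1ᴴ)).trace = 1 := by
    obtain ⟨v, φ, hv, -, -, hn, -⟩ := hrep e
    rw [hn]
    exact lineProj_mem hv
  have hmul (e : RankOneIdem r) : e.1 * normalize (e.1 * e.1ᴴ) = normalize (e.1 * e.1ᴴ) ∧
      normalize (e.1 * e.1ᴴ) * e.1 = e.1 := by
    obtain ⟨v, φ, hv, h1, he, hn, -⟩ := hrep e
    rw [hn, he, lineProj, normalize, trace_vecMulVec_star, Matrix.mul_smul, Matrix.smul_mul,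
      vecMulVec_mul_vecMulVec, vecMulVec_mul_vecMulVec, h1, one_smul, vecMulVec_smul, smul_smul,
      inv_mul_cancel₀ (star_dotProduct_self_ne_zero hv), one_smul]
    exact ⟨rfl, rfl⟩
  refine (exactAt_rankOneProj hr hj).of_homotopic
    ⟨fun e => ⟨normalize (e.1 * e.1ᴴ), hmem e⟩, Continuous.subtype_mk cn _⟩
    ⟨fun e => ⟨e.1, e.2.2⟩, by fun_prop⟩
    ⟨⟨⟨fun p => ⟨(1 - ((p.1 : ℝ) : ℂ)) • normalize (p.2.1 * p.2.1ᴴ) + ((p.1 : ℝ) : ℂ) • p.2.1,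
      ?_, ?_⟩, ?_⟩, ?_, ?_⟩⟩
  · obtain ⟨h1, h2⟩ := hmul p.2
    have h3 := (hmem p.2).2.1
    have h4 := p.2.2.1
    simp only [add_mul, mul_add, Matrix.smul_mul, Matrix.mul_smul, h1, h2, h3, h4, smul_smul]
    module
  · rw [trace_add, trace_smul, trace_smul, (hmem p.2).2.2, p.2.2.2]
    simp
  · refine Continuous.subtype_mk ?_ _
    have c0 : Continuous fun p : unitInterval × RankOneIdem r => ((p.1 : ℝ) : ℂ) :=
      Complex.continuous_ofReal.comp (continuous_subtype_val.comp continuous_fst)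
    exact ((continuous_const.sub c0).smul (cn.comp continuous_snd)).add
      (c0.smul (continuous_subtype_val.comp continuous_snd))
  · intro e
    refine Subtype.ext ?_
    simp
  · intro e
    refine Subtype.ext ?_
    simp

/-- For fixed v the admissible covectors form an affine space with base point v* / |v|². The pairs
therefore deform onto the nonzero vectors of ℂ^r. -/
theorem exactAt_dualPair {j : ℕ} (hj : j ≠ 2 * r) : ExactAt j (DualPair r) := by
  have h1 : ExactAt j {x : Fin r → ℂ // x ≠ 0} := exactAt_punctured (by
    rw [Module.finrank_pi_fintype]
    simpa [mul_comm] using hj)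
  have cw : Continuous fun x : {x : Fin r → ℂ // x ≠ 0} => (star x.1 ⬝ᵥ x.1)⁻¹ • star x.1 :=
    ((continuous_subtype_val.star.dotProduct continuous_subtype_val).inv₀
      fun x => star_dotProduct_self_ne_zero x.2).smul continuous_subtype_val.star
  have hw {x : Fin r → ℂ} (hx : x ≠ 0) : ((star x ⬝ᵥ x)⁻¹ • star x) ⬝ᵥ x = 1 := by
    rw [smul_dotProduct, smul_eq_mul, inv_mul_cancel₀ (star_dotProduct_self_ne_zero hx)]
  let f : C(DualPair r, {x : Fin r → ℂ // x ≠ 0}) :=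
    ⟨fun p => ⟨p.1.1, ne_zero_of_dotProduct_eq_one p.2⟩, by fun_prop⟩
  refine h1.of_homotopic f ⟨fun x => ⟨(x.1, (star x.1 ⬝ᵥ x.1)⁻¹ • star x.1), hw x.2⟩,
      Continuous.subtype_mk (continuous_subtype_val.prodMk cw) _⟩
    ⟨⟨⟨fun p => ⟨(p.2.1.1, (1 - ((p.1 : ℝ) : ℂ)) • ((star (f p.2).1 ⬝ᵥ (f p.2).1)⁻¹ •
      star (f p.2).1) + ((p.1 : ℝ) : ℂ) • p.2.1.2), ?_⟩, ?_⟩, ?_, ?_⟩⟩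
  · have h2 := hw (f p.2).2
    have h3 := p.2.2
    rw [add_dotProduct, smul_dotProduct]
    change (1 - ((p.1 : ℝ) : ℂ)) • (((star (f p.2).1 ⬝ᵥ (f p.2).1)⁻¹ •
      star (f p.2).1) ⬝ᵥ (f p.2).1) + _ = 1
    rw [h2, smul_dotProduct, h3]
    simp
  · have c0 : Continuous fun p : unitInterval × DualPair r => ((p.1 : ℝ) : ℂ) :=
      Complex.continuous_ofReal.comp (continuous_subtype_val.comp continuous_fst)
    have c1 := (cw.comp f.continuous).comp (continuous_snd (X := unitInterval))
    refine Continuous.subtype_mk (Continuous.prodMk (by fun_prop) ?_) _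
    exact ((continuous_const.sub c0).smul c1).add (c0.smul (by fun_prop))
  · intro p
    refine Subtype.ext ?_
    simp [f]
  · intro p
    refine Subtype.ext ?_
    simp

end AugmentedChains

namespace AugmentedChains

open Matrix Topology

/-! ### Trivializing idempotent-valued functions -/

section Transport

variable {n r : ℕ} {T : Type} [TopologicalSpace T]

/-- The standard intertwiner `pq + (1 - p)(1 - q)` between two close idempotents. -/
def intertwiner (p q : Matrix (Fin n) (Fin n) ℂ) : Matrix (Fin n) (Fin n) ℂ :=
  p * q + (1 - p) * (1 - q)

lemma mul_intertwiner {p q : Matrix (Fin n) (Fin n) ℂ} (hp : p * p = p) (hq : q * q = q) :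
    p * intertwiner p q = intertwiner p q * q := by
  have h1 : p * intertwiner p q = p * q := by
    have h : p * (1 - p) = 0 := by rw [mul_sub, mul_one, hp, sub_self]
    rw [intertwiner, mul_add, ← mul_assoc, ← mul_assoc, hp, h, zero_mul, add_zero]
  have h2 : intertwiner p q * q = p * q := by
    have h : (1 - q) * q = 0 := by rw [sub_mul, one_mul, hq, sub_self]
    rw [intertwiner, add_mul, mul_assoc, mul_assoc, hq, h, mul_zero, add_zero]
  rw [h1, h2]

lemma intertwiner_self {p : Matrix (Fin n) (Fin n) ℂ} (hp : p * p = p) : intertwiner p p = 1 := by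
  rw [intertwiner, mul_sub, sub_mul, sub_mul, hp]
  simp

/-- Nearby idempotents are conjugate through `intertwiner`, which is the identity when they coincide
and so remains invertible close by. Connectedness of the interval turns the local statement into a
global one. -/
lemma exists_transport [CompactSpace T] (κ : C(unitInterval × T, Matrix (Fin n) (Fin n) ℂ))
    (hκ : ∀ x, κ x * κ x = κ x) (s s' : unitInterval) :
    ∃ g : T → Matrix (Fin n) (Fin n) ℂ, Continuous g ∧ (∀ t, (g t).det ≠ 0) ∧
      ∀ t, κ (s', t) * g t = g t * κ (s, t) := by
  refine PreconnectedSpace.induction₂' (fun s s' : unitInterval =>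
    ∃ g : T → Matrix (Fin n) (Fin n) ℂ, Continuous g ∧ (∀ t, (g t).det ≠ 0) ∧
      ∀ t, κ (s', t) * g t = g t * κ (s, t)) (fun s₀ => ?_) ⟨?_⟩ s s'
  -- Compactness of T makes the neighbourhood of the time s₀ uniform over T.
  · have key (D : unitInterval × T → ℂ) (hD : Continuous D) (h1 : ∀ t, D (s₀, t) ≠ 0) :
        ∀ᶠ s in 𝓝 s₀, ∀ t, D (s, t) ≠ 0 := by
      have := (isCompact_univ (X := T)).eventually_forall_of_forall_eventually
        (P := fun s t => D (s, t) ≠ 0) (x₀ := s₀) fun t _ =>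
          hD.continuousAt.eventually_ne (h1 t)
      simpa using this
    have c0 : Continuous fun x : unitInterval × T => κ (s₀, x.2) := by fun_prop
    have ci : Continuous fun x : unitInterval × T => intertwiner (κ x) (κ (s₀, x.2)) :=
      (κ.continuous.matrix_mul c0).add
        ((continuous_const.sub κ.continuous).matrix_mul (continuous_const.sub c0))
    have ci' : Continuous fun x : unitInterval × T => intertwiner (κ (s₀, x.2)) (κ x) :=
      (c0.matrix_mul κ.continuous).add
        ((continuous_const.sub c0).matrix_mul (continuous_const.sub κ.continuous))
    filter_upwards [key _ ci.matrix_det fun t => by rw [intertwiner_self (hκ _)]; simp,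
      key _ ci'.matrix_det fun t => by rw [intertwiner_self (hκ _)]; simp] with s h1 h2
    exact ⟨⟨fun t => intertwiner (κ (s, t)) (κ (s₀, t)), ci.comp (by fun_prop :
        Continuous fun t : T => (s, t)), h1, fun t => mul_intertwiner (hκ _) (hκ _)⟩,
      ⟨fun t => intertwiner (κ (s₀, t)) (κ (s, t)), ci'.comp (by fun_prop :
        Continuous fun t : T => (s, t)), h2, fun t => mul_intertwiner (hκ _) (hκ _)⟩⟩
  · rintro a b c ⟨g, hg, hg0, hgc⟩ ⟨g', hg', hg0', hgc'⟩
    refine ⟨fun t => g' t * g t, hg'.matrix_mul hg, fun t => ?_, fun t => ?_⟩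
    · rw [det_mul]
      exact mul_ne_zero (hg0' t) (hg0 t)
    · rw [← mul_assoc, hgc', mul_assoc, hgc, mul_assoc]

lemma continuous_matrix_inv {g : T → Matrix (Fin n) (Fin n) ℂ} (hg : Continuous g)
    (h : ∀ t, (g t).det ≠ 0) : Continuous fun t => (g t)⁻¹ := by
  simp only [Matrix.inv_def, Ring.inverse_eq_inv']
  exact (hg.matrix_det.inv₀ h).smul hg.matrix_adjugate

/-- Over a contractible compact space, an idempotent of trace `r` is given by a frame. -/
lemma exists_frame [CompactSpace T] (H : Contraction T) (q : C(T, Matrix (Fin n) (Fin n) ℂ))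
    (hq : ∀ t, q t * q t = q t) (ht : ∀ t, (q t).trace = r) :
    ∃ (P : T → Matrix (Fin n) (Fin r) ℂ) (Q : T → Matrix (Fin r) (Fin n) ℂ),
      Continuous P ∧ Continuous Q ∧ ∀ t, Q t * P t = 1 ∧ P t * Q t = q t := by
  -- Time 1 is the constant idempotent at the centre and time 0 is q, so a single frame at the
  -- centre can be transported.
  obtain ⟨g, hg, hg0, hgc⟩ := exists_transport (q.comp H.homotopy) (fun x => hq _) 1 0
  simp only [ContinuousMap.comp_apply, H.apply_zero, H.apply_one] at hgc
  obtain ⟨P₀, Q₀, h1, h2⟩ := exists_factor_of_idempotent (hq H.pt) (ht H.pt)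
  have hu (t) : IsUnit (g t).det := isUnit_iff_ne_zero.2 (hg0 t)
  refine ⟨fun t => g t * P₀, fun t => Q₀ * (g t)⁻¹, hg.matrix_mul continuous_const,
    continuous_const.matrix_mul (continuous_matrix_inv hg hg0), fun t => ⟨?_, ?_⟩⟩
  · rw [Matrix.mul_assoc, ← Matrix.mul_assoc (g t)⁻¹, Matrix.nonsing_inv_mul _ (hu t),
      Matrix.one_mul, h1]
  · rw [Matrix.mul_assoc, ← Matrix.mul_assoc P₀, h2, ← Matrix.mul_assoc, ← hgc, Matrix.mul_assoc,
      Matrix.mul_nonsing_inv _ (hu t), Matrix.mul_one]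

/-! ### Bundles of rank one idempotents and of dual pairs over a contractible base -/

/-- Rank one idempotents below the idempotent `q`. -/
def idemBelow (q : Matrix (Fin n) (Fin n) ℂ) : Set (Matrix (Fin n) (Fin n) ℂ) :=
  {e | e * e = e ∧ e.trace = 1 ∧ q * e = e ∧ e * q = e}

/-- Dual pairs of vectors and covectors fixed by the idempotent `q`. -/
def pairBelow (q : Matrix (Fin n) (Fin n) ℂ) : Set ((Fin n → ℂ) × (Fin n → ℂ)) :=
  {p | p.2 ⬝ᵥ p.1 = 1 ∧ q *ᵥ p.1 = p.1 ∧ p.2 ᵥ* q = p.2}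

/-- The total space over `T` of a family of subsets of `B`. -/
def totalSpace {T B : Type} (R : T → Set B) : Set (T × B) := {p | p.2 ∈ R p.1}

/-- Change of frame: read e in the first frame and write it in the second. Taking identity matrices
for one frame passes between a fibre and its r by r model. -/
lemma conj_mem_idemBelow {a b : ℕ} {q : Matrix (Fin a) (Fin a) ℂ} {q' : Matrix (Fin b) (Fin b) ℂ}
    {P : Matrix (Fin a) (Fin r) ℂ} {Q : Matrix (Fin r) (Fin a) ℂ}
    {P' : Matrix (Fin b) (Fin r) ℂ} {Q' : Matrix (Fin r) (Fin b) ℂ}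
    (h : P * Q = q) (h' : Q' * P' = 1) (h'' : P' * Q' = q') {e : Matrix (Fin a) (Fin a) ℂ}
    (he : e ∈ idemBelow q) : P' * (Q * e * P) * Q' ∈ idemBelow q' := by
  obtain ⟨h1, h2, h3, h4⟩ := he
  have hQ : Q * e * P * (Q * e * P) = Q * e * P := by
    calc Q * e * P * (Q * e * P) = Q * (e * (P * Q) * e) * P := by
          simp only [Matrix.mul_assoc]
      _ = Q * e * P := by rw [h, h4, h1]
  refine ⟨?_, ?_, ?_, ?_⟩
  · calc P' * (Q * e * P) * Q' * (P' * (Q * e * P) * Q')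
        = P' * (Q * e * P * (Q' * P') * (Q * e * P)) * Q' := by simp only [Matrix.mul_assoc]
      _ = _ := by rw [h', Matrix.mul_one, hQ]
  · rw [Matrix.trace_mul_comm, ← Matrix.mul_assoc, h', Matrix.one_mul, Matrix.trace_mul_comm,
      ← Matrix.mul_assoc, h, h3, h2]
  · rw [← h'', Matrix.mul_assoc, ← Matrix.mul_assoc Q', ← Matrix.mul_assoc Q', h',
      Matrix.one_mul, ← Matrix.mul_assoc]
  · rw [← h'', ← Matrix.mul_assoc, Matrix.mul_assoc _ Q', h', Matrix.mul_one]

/-- A frame trivialises the family, and contracting the base leaves the model fibre. -/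
lemma exactAt_totalSpace_idemBelow [CompactSpace T] (H : Contraction T)
    (q : C(T, Matrix (Fin n) (Fin n) ℂ)) (hq : ∀ t, q t * q t = q t) (ht : ∀ t, (q t).trace = r)
    {j : ℕ} (hr : 1 ≤ r) (hj : 2 * r ≤ j) :
    ExactAt j (totalSpace fun t => idemBelow (q t)) := by
  obtain ⟨P, Q, hP, hQ, hPQ⟩ := exists_frame H q hq ht
  have hone (e : RankOneIdem r) : e.1 ∈ idemBelow (1 : Matrix (Fin r) (Fin r) ℂ) :=
    ⟨e.2.1, e.2.2, one_mul _, mul_one _⟩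
  have hmem (x : totalSpace fun t => idemBelow (q t)) (t : T) :
      P t * (Q x.1.1 * x.1.2 * P x.1.1) * Q t ∈ idemBelow (q t) :=
    conj_mem_idemBelow (hPQ _).2 (hPQ _).1 (hPQ _).2 x.2
  have cT : Continuous fun x : totalSpace fun t => idemBelow (q t) => x.1.1 := by fun_prop
  have ce : Continuous fun x : totalSpace fun t => idemBelow (q t) => x.1.2 := by fun_prop
  have cf : Continuous fun x : totalSpace fun t => idemBelow (q t) =>
      Q x.1.1 * x.1.2 * P x.1.1 :=
    ((hQ.comp cT).matrix_mul ce).matrix_mul (hP.comp cT)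
  let f : C(totalSpace fun t => idemBelow (q t), RankOneIdem r) :=
    { toFun x := ⟨Q x.1.1 * x.1.2 * P x.1.1, by
        have := conj_mem_idemBelow (P' := (1 : Matrix (Fin r) (Fin r) ℂ)) (Q' := 1)
          (hPQ x.1.1).2 (mul_one 1) (mul_one 1) x.2
        simp only [Matrix.one_mul, Matrix.mul_one] at this
        exact ⟨this.1, this.2.1⟩⟩
      continuous_toFun := by exact Continuous.subtype_mk cf _ }
  let g : C(RankOneIdem r, totalSpace fun t => idemBelow (q t)) :=
    { toFun e := ⟨(H.pt, P H.pt * e.1 * Q H.pt), by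
        have := conj_mem_idemBelow (P := (1 : Matrix (Fin r) (Fin r) ℂ)) (Q := 1)
          (mul_one 1) (hPQ H.pt).1 (hPQ H.pt).2 (hone e)
        simp only [Matrix.one_mul, Matrix.mul_one] at this
        exact this⟩
      continuous_toFun := by
        exact Continuous.subtype_mk (continuous_const.prodMk ((continuous_const.matrix_mul
          continuous_subtype_val).matrix_mul continuous_const)) _ }
  -- Time is reversed because the homotopy must end at the identity, where a contraction begins.
  have cH : Continuous fun p : unitInterval × (totalSpace fun t => idemBelow (q t)) =>
      H.homotopy (unitInterval.symm p.1, p.2.1.1) := by fun_prop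
  refine (exactAt_rankOneIdem hr hj).of_homotopic f g ⟨⟨⟨fun p =>
    ⟨(H.homotopy (unitInterval.symm p.1, p.2.1.1), _), hmem p.2 _⟩, ?_⟩, ?_, ?_⟩⟩
  · exact Continuous.subtype_mk (cH.prodMk (((hP.comp cH).matrix_mul
      (cf.comp continuous_snd)).matrix_mul (hQ.comp cH))) _
  · intro x
    refine Subtype.ext ?_
    simp only [unitInterval.symm_zero]
    change (H.homotopy (1, x.1.1),
      P (H.homotopy (1, x.1.1)) * (Q x.1.1 * x.1.2 * P x.1.1) * Q (H.homotopy (1, x.1.1))) = _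
    rw [H.apply_one]
    rfl
  · intro x
    refine Subtype.ext ?_
    simp only [unitInterval.symm_one, ContinuousMap.id_apply]
    change (H.homotopy (0, x.1.1),
      P (H.homotopy (0, x.1.1)) * (Q x.1.1 * x.1.2 * P x.1.1) * Q (H.homotopy (0, x.1.1))) = _
    rw [H.apply_zero]
    refine Prod.ext rfl ?_
    change P x.1.1 * (Q x.1.1 * x.1.2 * P x.1.1) * Q x.1.1 = x.1.2
    obtain ⟨-, -, h3, h4⟩ : x.1.2 ∈ idemBelow (q x.1.1) := x.2
    calc _ = (P x.1.1 * Q x.1.1) * x.1.2 * (P x.1.1 * Q x.1.1) := by simp only [Matrix.mul_assoc]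
      _ = x.1.2 := by rw [(hPQ x.1.1).2, h3, h4]

lemma mulVec_mem_pairBelow {a b : ℕ} {q : Matrix (Fin a) (Fin a) ℂ} {q' : Matrix (Fin b) (Fin b) ℂ}
    {P : Matrix (Fin a) (Fin r) ℂ} {Q : Matrix (Fin r) (Fin a) ℂ}
    {P' : Matrix (Fin b) (Fin r) ℂ} {Q' : Matrix (Fin r) (Fin b) ℂ}
    (h : P * Q = q) (h' : Q' * P' = 1) (h'' : P' * Q' = q') {p : (Fin a → ℂ) × (Fin a → ℂ)}
    (hp : p ∈ pairBelow q) : (P' *ᵥ (Q *ᵥ p.1), (p.2 ᵥ* P) ᵥ* Q') ∈ pairBelow q' := by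
  obtain ⟨h1, h2, h3⟩ := hp
  refine ⟨?_, ?_, ?_⟩
  · simp only
    rw [← dotProduct_mulVec, mulVec_mulVec, h', one_mulVec, ← dotProduct_mulVec, mulVec_mulVec, h,
      h2, h1]
  · simp only
    rw [← h'', ← mulVec_mulVec _ P', mulVec_mulVec _ Q', h', one_mulVec]
  · simp only
    rw [← h'', ← vecMul_vecMul, vecMul_vecMul _ Q', h', vecMul_one]

lemma exactAt_totalSpace_pairBelow [CompactSpace T] (H : Contraction T)
    (q : C(T, Matrix (Fin n) (Fin n) ℂ)) (hq : ∀ t, q t * q t = q t) (ht : ∀ t, (q t).trace = r)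
    {j : ℕ} (hj : j ≠ 2 * r) :
    ExactAt j (totalSpace fun t => pairBelow (q t)) := by
  obtain ⟨P, Q, hP, hQ, hPQ⟩ := exists_frame H q hq ht
  have hone (p : DualPair r) : p.1 ∈ pairBelow (1 : Matrix (Fin r) (Fin r) ℂ) :=
    ⟨p.2, one_mulVec _, vecMul_one _⟩
  have hmem (x : totalSpace fun t => pairBelow (q t)) (t : T) :
      (P t *ᵥ (Q x.1.1 *ᵥ x.1.2.1), (x.1.2.2 ᵥ* P x.1.1) ᵥ* Q t) ∈ pairBelow (q t) :=
    mulVec_mem_pairBelow (hPQ _).2 (hPQ _).1 (hPQ _).2 x.2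
  have cT : Continuous fun x : totalSpace fun t => pairBelow (q t) => x.1.1 := by fun_prop
  have cv : Continuous fun x : totalSpace fun t => pairBelow (q t) => Q x.1.1 *ᵥ x.1.2.1 :=
    (hQ.comp cT).matrix_mulVec (by fun_prop)
  have cw : Continuous fun x : totalSpace fun t => pairBelow (q t) => x.1.2.2 ᵥ* P x.1.1 :=
    Continuous.matrix_vecMul (by fun_prop) (hP.comp cT)
  let f : C(totalSpace fun t => pairBelow (q t), DualPair r) :=
    { toFun x := ⟨(Q x.1.1 *ᵥ x.1.2.1, x.1.2.2 ᵥ* P x.1.1), by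
        have := mulVec_mem_pairBelow (P' := (1 : Matrix (Fin r) (Fin r) ℂ)) (Q' := 1)
          (hPQ x.1.1).2 (mul_one 1) (mul_one 1) x.2
        simp only [one_mulVec, vecMul_one] at this
        exact this.1⟩
      continuous_toFun := by exact Continuous.subtype_mk (cv.prodMk cw) _ }
  let g : C(DualPair r, totalSpace fun t => pairBelow (q t)) :=
    { toFun p := ⟨(H.pt, P H.pt *ᵥ p.1.1, p.1.2 ᵥ* Q H.pt), by
        have := mulVec_mem_pairBelow (P := (1 : Matrix (Fin r) (Fin r) ℂ)) (Q := 1)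
          (mul_one 1) (hPQ H.pt).1 (hPQ H.pt).2 (hone p)
        simp only [one_mulVec, vecMul_one] at this
        exact this⟩
      continuous_toFun := by
        exact Continuous.subtype_mk (continuous_const.prodMk
          ((continuous_const.matrix_mulVec (by fun_prop)).prodMk
            (Continuous.matrix_vecMul (by fun_prop) continuous_const))) _ }
  have cH : Continuous fun p : unitInterval × (totalSpace fun t => pairBelow (q t)) =>
      H.homotopy (unitInterval.symm p.1, p.2.1.1) := by fun_prop
  refine (exactAt_dualPair hj).of_homotopic f g ⟨⟨⟨fun p =>
    ⟨(H.homotopy (unitInterval.symm p.1, p.2.1.1), _), hmem p.2 _⟩, ?_⟩, ?_, ?_⟩⟩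
  · exact Continuous.subtype_mk (cH.prodMk (((hP.comp cH).matrix_mulVec
      (cv.comp continuous_snd)).prodMk ((cw.comp continuous_snd).matrix_vecMul (hQ.comp cH)))) _
  · intro x
    refine Subtype.ext ?_
    simp only [unitInterval.symm_zero]
    change (H.homotopy (1, x.1.1),
      P (H.homotopy (1, x.1.1)) *ᵥ (Q x.1.1 *ᵥ x.1.2.1),
      (x.1.2.2 ᵥ* P x.1.1) ᵥ* Q (H.homotopy (1, x.1.1))) = _
    rw [H.apply_one]
    rfl
  · intro x
    refine Subtype.ext ?_
    simp only [unitInterval.symm_one, ContinuousMap.id_apply]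
    change (H.homotopy (0, x.1.1),
      P (H.homotopy (0, x.1.1)) *ᵥ (Q x.1.1 *ᵥ x.1.2.1),
      (x.1.2.2 ᵥ* P x.1.1) ᵥ* Q (H.homotopy (0, x.1.1))) = _
    rw [H.apply_zero]
    obtain ⟨-, h3, h4⟩ : x.1.2 ∈ pairBelow (q x.1.1) := x.2
    refine Prod.ext rfl (Prod.ext ?_ ?_)
    · change P x.1.1 *ᵥ (Q x.1.1 *ᵥ x.1.2.1) = x.1.2.1
      rw [mulVec_mulVec, (hPQ x.1.1).2, h3]
    · change (x.1.2.2 ᵥ* P x.1.1) ᵥ* Q x.1.1 = x.1.2.2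
      rw [vecMul_vecMul, (hPQ x.1.1).2, h4]

end Transport

end AugmentedChains

namespace AugmentedChains

/-! ### Equivariant sections up to homotopy -/

section Sections

variable {X Y Z T S B B' : Type} [TopologicalSpace X] [TopologicalSpace Y] [TopologicalSpace Z]
  [TopologicalSpace T] [TopologicalSpace S] [TopologicalSpace B] [TopologicalSpace B']
  {Γ : Type} [Group Γ] [MulAction Γ Y] [ContinuousConstSMul Γ Y]

/-- Translation by a group element. -/
def translate (Y : Type) [TopologicalSpace Y] [MulAction Γ Y] [ContinuousConstSMul Γ Y] (γ : Γ) :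
    C(Y, Y) := ⟨fun y => γ • y, continuous_const_smul γ⟩

@[simp]
lemma translate_apply (γ : Γ) (y : Y) : translate Y γ y = γ • y := rfl

lemma translate_one : translate Y (1 : Γ) = ContinuousMap.id Y := by
  ext y; simp

lemma translate_mul (γ δ : Γ) : translate Y (γ * δ) = (translate Y γ).comp (translate Y δ) := by
  ext y; simp [mul_smul]

/-- An action of `Γ` by continuous maps, as unbundled data. -/
structure ContAction (Γ B : Type) [Group Γ] [TopologicalSpace B] where
  /-- The action map. -/
  act : Γ → C(B, B)
  act_one : act 1 = ContinuousMap.id B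
  act_mul (γ δ : Γ) : act (γ * δ) = (act γ).comp (act δ)

/-- The product of a map of the base with the identity of the fibre. -/
def along (B : Type) [TopologicalSpace B] (f : C(S, T)) : C(S × B, T × B) :=
  f.prodMap (ContinuousMap.id B)

/-- The product of the identity of the base with a map of the fibre. -/
def onFibre (T : Type) [TopologicalSpace T] (f : C(B, B')) : C(T × B, T × B') :=
  (ContinuousMap.id T).prodMap f

lemma along_comp (f : C(S, T)) (g : C(X, S)) : along B (f.comp g) = (along B f).comp (along B g) :=
  rfl

lemma along_comp_onFibre (f : C(S, T)) (g : C(B, B')) :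
    (along B' f).comp (onFibre S g) = (onFibre T g).comp (along B f) := rfl

lemma fst_comp_along (f : C(S, T)) :
    ContinuousMap.fst.comp (along B f) = f.comp ContinuousMap.fst := rfl

lemma fst_comp_onFibre (f : C(B, B')) :
    ContinuousMap.fst.comp (onFibre T f) = ContinuousMap.fst := rfl

/-- A choice of a chain in `Δ × B` for every singular simplex of `Y`. -/
abbrev ChainFamily (Y B : Type) [TopologicalSpace Y] [TopologicalSpace B] : Type :=
  ∀ m : ℕ, Sing m Y → Ch m (Simp m × B)

/-- The operator on chains of a space over `Y` defined by a chain family. -/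
def lift (c : ChainFamily Y B) (φ : C(T, Y)) (m : ℕ) : Ch m T →ₗ[ℚ] Ch m (T × B) :=
  extend fun τ => push m (along B τ) (c m (φ.comp τ))

lemma lift_push (c : ChainFamily Y B) (φ : C(T, Y)) (f : C(S, T)) {m : ℕ} (x : Ch m S) :
    lift c φ m (push m f x) = push m (along B f) (lift c (φ.comp f) m x) := by
  suffices h : (lift c φ m).comp (push m f) = (push m (along B f)).comp (lift c (φ.comp f) m) from
    LinearMap.congr_fun h x
  refine hom_ext fun τ => ?_
  simp only [lift, LinearMap.comp_apply, push_single, extend_single, one_smul, push_push,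
    along_comp, ContinuousMap.comp_assoc]

lemma lift_taut (c : ChainFamily Y B) {m : ℕ} (σ : Sing m Y) : lift c σ m (taut m) = c m σ := by
  have : along B (ContinuousMap.id (Simp m)) = ContinuousMap.id _ := rfl
  simp only [lift, taut, extend_single, one_smul, this, push_id, ContinuousMap.comp_id]

/-- Chain families which up to simplices with `N` vertices define an equivariant chain map into the
total space of `R`. -/
structure IsSection (a : ContAction Γ B) (R : Y → Set B) (N : ℕ) (c : ChainFamily Y B) :
    Prop where
  zero (σ : Sing 0 Y) : c 0 σ = Finsupp.single default 1
  mem (m : ℕ) (hm : m ≤ N) (σ : Sing m Y) :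
    c m σ ∈ Finsupp.supported ℚ ℚ (singIn m (totalSpace (R ∘ σ)))
  bd_eq (m : ℕ) (hm : m < N) (σ : Sing (m + 1) Y) :
    bd m (c (m + 1) σ) = lift c σ m (bd m (taut (m + 1)))
  smul (m : ℕ) (hm : m ≤ N) (γ : Γ) (σ : Sing m Y) :
    c m ((translate Y γ).comp σ) = push m (onFibre _ (a.act γ)) (c m σ)

variable {a : ContAction Γ B} {a' : ContAction Γ B'} {R : Y → Set B} {R' : Y → Set B'} {N : ℕ}
  {c : ChainFamily Y B}

lemma push_mem_supported {m : ℕ} {U : Set X} {V : Set Z} (f : C(X, Z)) (hf : ∀ x ∈ U, f x ∈ V)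
    {x : Ch m X} (hx : x ∈ Finsupp.supported ℚ ℚ (singIn m U)) :
    push m f x ∈ Finsupp.supported ℚ ℚ (singIn m V) := by
  refine map_mem_of_mem_supported (push m f) _ (fun σ hσ => ?_) hx
  rw [push_single]
  exact single_mem_supported fun t => hf _ (hσ t)

/-- The boundary condition is imposed only on tautological simplices; naturality of `lift` spreads
it to all chains. -/
lemma IsSection.bd_lift (h : IsSection a R N c) {m : ℕ} (hm : m < N) (φ : C(T, Y))
    (x : Ch (m + 1) T) : bd m (lift c φ (m + 1) x) = lift c φ m (bd m x) := by
  suffices h : (bd m).comp (lift c φ (m + 1)) = (lift c φ m).comp (bd m) from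
    LinearMap.congr_fun h x
  refine hom_ext fun τ => ?_
  simp only [LinearMap.comp_apply]
  rw [← push_taut τ, lift_push, bd_push, bd_push, lift_push, lift_taut, h.bd_eq m hm]

lemma IsSection.lift_smul (h : IsSection a R N c) {m : ℕ} (hm : m ≤ N) (φ : C(T, Y)) (γ : Γ)
    (x : Ch m T) :
    lift c ((translate Y γ).comp φ) m x = push m (onFibre _ (a.act γ)) (lift c φ m x) := by
  suffices h : lift c ((translate Y γ).comp φ) m =
      (push m (onFibre _ (a.act γ))).comp (lift c φ m) from LinearMap.congr_fun h x
  refine hom_ext fun τ => ?_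
  simp only [LinearMap.comp_apply, lift, extend_single, one_smul, ContinuousMap.comp_assoc]
  rw [h.smul m hm, push_push, push_push, along_comp_onFibre]

lemma IsSection.lift_mem (h : IsSection a R N c) {m : ℕ} (hm : m ≤ N) (φ : C(T, Y)) (x : Ch m T) :
    lift c φ m x ∈ Finsupp.supported ℚ ℚ (singIn m (totalSpace (R ∘ φ))) := by
  refine map_mem_of_mem_supported (S := Set.univ) (lift c φ m) _ (fun τ _ => ?_)
    (by simp [Finsupp.supported_univ])
  simp only [lift, extend_single, one_smul]
  exact push_mem_supported _ (fun p hp => hp) (h.mem m hm (φ.comp τ))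

/-- The obstruction to extending over σ is a cycle, so an acyclic fibre removes it. -/
lemma IsSection.isCyc_lift (h : IsSection a R N c) (σ : Sing (N + 1) Y) :
    IsCyc N (lift c σ N (bd N (taut (N + 1)))) := by
  cases N with
  | zero => trivial
  | succ N =>
    change bd N _ = 0
    rw [h.bd_lift (Nat.lt_succ_self N), bd_bd, map_zero]

lemma IsSection.congr (h : IsSection a R N c) {c' : ChainFamily Y B} (hc : ∀ m ≤ N, c' m = c m) :
    IsSection a R N c' where
  zero σ := by rw [hc 0 (Nat.zero_le _), h.zero]
  mem m hm σ := by rw [hc m hm]; exact h.mem m hm σ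
  bd_eq m hm σ := by
    have : lift c' σ m = lift c σ m := by simp only [lift, hc m hm.le]
    rw [hc (m + 1) hm, this]; exact h.bd_eq m hm σ
  smul m hm γ σ := by rw [hc m hm]; exact h.smul m hm γ σ

lemma IsSection.mono (h : IsSection a R N c) {M : ℕ} (hM : M ≤ N) : IsSection a R M c where
  zero := h.zero
  mem m hm := h.mem m (hm.trans hM)
  bd_eq m hm := h.bd_eq m (hm.trans_le hM)
  smul m hm := h.smul m (hm.trans hM)

lemma exists_isSection_zero (a : ContAction Γ B) (R : Y → Set B) :
    ∃ c : ChainFamily Y B, IsSection a R 0 c := by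
  refine ⟨fun m σ => match m with
    | 0 => Finsupp.single default 1
    | _ + 1 => 0, fun σ => rfl, ?_, fun m hm => absurd hm (Nat.not_lt_zero _), ?_⟩
  · intro m hm σ
    obtain rfl := Nat.le_zero.1 hm
    exact single_mem_supported fun t => isEmptyElim t
  · intro m hm γ σ
    obtain rfl := Nat.le_zero.1 hm
    simp only [push_single]
    rw [Subsingleton.elim (ContinuousMap.comp _ _) (default : Sing 0 (Simp 0 × B))]

lemma IsSection.map (h : IsSection a R N c) (f : C(B, B')) (hf : ∀ y, ∀ b ∈ R y, f b ∈ R' y)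
    (ha : ∀ γ, f.comp (a.act γ) = (a'.act γ).comp f) :
    IsSection a' R' N fun m σ => push m (onFibre _ f) (c m σ) where
  zero σ := by
    rw [h.zero, push_single]
    rw [Subsingleton.elim (ContinuousMap.comp _ _) (default : Sing 0 (Simp 0 × B'))]
  mem m hm σ := push_mem_supported (onFibre _ f) (fun p hp => hf (σ p.1) p.2 hp) (h.mem m hm σ)
  bd_eq m hm σ := by
    have : lift (fun m σ => push m (onFibre _ f) (c m σ)) σ m =
        (push m (onFibre _ f)).comp (lift c σ m) := by
      refine hom_ext fun τ => ?_
      simp only [LinearMap.comp_apply, lift, extend_single, one_smul, push_push,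
        along_comp_onFibre]
    rw [bd_push, h.bd_eq m hm, this, LinearMap.comp_apply]
  smul m hm γ σ := by
    rw [h.smul m hm, push_push, push_push]
    congr 2
    ext p
    · rfl
    · exact congrArg (fun g : C(B, B') => g p.2) (ha γ)

/-- One more degree of an equivariant section can be chosen when the fibres are acyclic. -/
lemma IsSection.exists_extend (h : IsSection a R N c)
    (hfree : ∀ (γ : Γ) (y : Y), γ • y = y → γ = 1)
    (hR : ∀ (γ : Γ) (y : Y), ∀ b ∈ R y, a.act γ b ∈ R (γ • y))
    (hex : ∀ σ : Sing (N + 1) Y, ExactAt N (totalSpace (R ∘ σ))) :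
    ∃ c' : ChainFamily Y B, IsSection a R (N + 1) c' ∧ ∀ m ≤ N, c' m = c m := by
  classical
  -- These fillers ignore the group. Only those on orbit representatives are kept, and they are
  -- moved by Γ to the rest of each orbit.
  choose d hd hbd using fun σ : Sing (N + 1) Y =>
    (hex σ).exists_bd_eq (h.lift_mem le_rfl σ (bd N (taut (N + 1)))) (h.isCyc_lift σ)
  let s : Setoid (Sing (N + 1) Y) :=
    { r σ τ := ∃ γ : Γ, σ = (translate Y γ).comp τ
      iseqv :=
        { refl σ := ⟨1, by rw [translate_one, ContinuousMap.id_comp]⟩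
          symm := by
            rintro σ τ ⟨γ, rfl⟩
            refine ⟨γ⁻¹, ?_⟩
            rw [← ContinuousMap.comp_assoc, ← translate_mul, inv_mul_cancel, translate_one,
              ContinuousMap.id_comp]
          trans := by
            rintro σ τ ρ ⟨γ, rfl⟩ ⟨δ, rfl⟩
            exact ⟨γ * δ, by rw [translate_mul, ContinuousMap.comp_assoc]⟩ } }
  let rep (σ : Sing (N + 1) Y) : Sing (N + 1) Y := (Quotient.mk s σ).out
  have hrep (σ) : ∃ γ : Γ, σ = (translate Y γ).comp (rep σ) :=
    s.symm (Quotient.exact (Quotient.out_eq (Quotient.mk s σ)))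
  have hrep_smul (γ : Γ) (σ) : rep ((translate Y γ).comp σ) = rep σ :=
    congrArg Quotient.out (Quotient.sound ⟨γ, rfl⟩)
  choose g hg using hrep
  -- Freeness at one vertex shows that the translating element is unique; it therefore depends
  -- equivariantly on the simplex.
  have inj (γ δ : Γ) (σ : Sing (N + 1) Y)
      (e : (translate Y γ).comp σ = (translate Y δ).comp σ) : γ = δ := by
    let t : Simp (N + 1) := stdSimplex.vertex 0
    have := congrArg (fun f : Sing (N + 1) Y => f t) e
    simp only [ContinuousMap.comp_apply, translate_apply] at this
    rw [← inv_mul_eq_one, ← inv_inj, mul_inv_rev, inv_inv, inv_one]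
    exact hfree _ (σ t) (by rw [mul_smul, this, inv_smul_smul])
  have g_smul (γ : Γ) (σ) : g ((translate Y γ).comp σ) = γ * g σ := by
    refine inj _ _ (rep σ) ?_
    have h1 := hg ((translate Y γ).comp σ)
    rw [hrep_smul] at h1
    rw [← h1, translate_mul, ContinuousMap.comp_assoc, ← hg]
  let e (σ : Sing (N + 1) Y) : Ch (N + 1) (Simp (N + 1) × B) :=
    push _ (onFibre _ (a.act (g σ))) (d (rep σ))
  let c' : ChainFamily Y B := Function.update c (N + 1) e
  have hlow (m) (hm : m ≤ N) : c' m = c m :=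
    Function.update_of_ne (by omega) _ _
  have htop : c' (N + 1) = e := Function.update_self _ _ _
  have h' := h.congr hlow
  refine ⟨c', ⟨h'.zero, fun m hm σ => ?_, fun m hm σ => ?_, fun m hm γ σ => ?_⟩, hlow⟩
  · rcases Nat.lt_or_ge m (N + 1) with hlt | hge
    · exact h'.mem m (by omega) σ
    · obtain rfl : m = N + 1 := by omega
      rw [htop]
      refine push_mem_supported _ (fun p hp => ?_) (hd (rep σ))
      have := hR (g σ) (rep σ p.1) p.2 hp
      have e1 : g σ • rep σ p.1 = σ p.1 := by
        conv_rhs => rw [hg σ]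
        rfl
      rw [e1] at this
      exact this
  · rcases Nat.lt_or_ge m N with hlt | hge
    · exact h'.bd_eq m hlt σ
    · obtain rfl : m = N := by omega
      have e1 : lift c' σ m = lift c σ m := by simp only [lift, hlow m le_rfl]
      rw [htop, e1, bd_push, hbd, ← h.lift_smul le_rfl, ← hg]
  · rcases Nat.lt_or_ge m (N + 1) with hlt | hge
    · exact h'.smul m (by omega) γ σ
    · obtain rfl : m = N + 1 := by omega
      rw [htop]
      simp only [e]
      rw [hrep_smul, g_smul, push_push, a.act_mul]
      rfl

/-- Acyclicity of the fibres in a range of degrees provides a section in that range. -/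
lemma IsSection.exists_extend_to (h : IsSection a R N c)
    (hfree : ∀ (γ : Γ) (y : Y), γ • y = y → γ = 1)
    (hR : ∀ (γ : Γ) (y : Y), ∀ b ∈ R y, a.act γ b ∈ R (γ • y)) (k : ℕ)
    (hex : ∀ m, N ≤ m → m < N + k → ∀ σ : Sing (m + 1) Y, ExactAt m (totalSpace (R ∘ σ))) :
    ∃ c' : ChainFamily Y B, IsSection a R (N + k) c' := by
  induction k with
  | zero => exact ⟨c, h⟩
  | succ k ih =>
    obtain ⟨c', h'⟩ := ih fun m h1 h2 => hex m h1 (by omega)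
    obtain ⟨c'', h'', -⟩ := h'.exists_extend hfree hR (hex _ (by omega) (by omega))
    exact ⟨c'', h''⟩

lemma IsSection.exists_extend_forall (h : IsSection a R N c)
    (hfree : ∀ (γ : Γ) (y : Y), γ • y = y → γ = 1)
    (hR : ∀ (γ : Γ) (y : Y), ∀ b ∈ R y, a.act γ b ∈ R (γ • y))
    (hex : ∀ m, N ≤ m → ∀ σ : Sing (m + 1) Y, ExactAt m (totalSpace (R ∘ σ))) :
    ∃ c' : ChainFamily Y B, ∀ M, IsSection a R M c' := by
  have step (k : ℕ) (x : {c : ChainFamily Y B // IsSection a R (N + k) c}) :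
      ∃ y : {c : ChainFamily Y B // IsSection a R (N + (k + 1)) c},
        ∀ m ≤ N + k, y.1 m = x.1 m := by
    obtain ⟨c', h1, h2⟩ := x.2.exists_extend hfree hR (hex _ (by omega))
    exact ⟨⟨c', h1⟩, h2⟩
  choose nxt hnxt using step
  let seq (k : ℕ) : {c : ChainFamily Y B // IsSection a R (N + k) c} :=
    Nat.rec ⟨c, h⟩ (fun k x => nxt k x) k
  have hseq (k j m : ℕ) (hm : m ≤ N + k) : (seq (k + j)).1 m = (seq k).1 m := by
    induction j with
    | zero => rfl
    | succ j ih => rw [← ih]; exact hnxt (k + j) (seq (k + j)) m (by omega)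
  -- Each extension leaves the earlier degrees unchanged, so the diagonal agrees with every stage in
  -- its range.
  refine ⟨fun m => (seq m).1 m, fun M => ?_⟩
  refine ((seq M).2.mono (by omega : M ≤ N + M)).congr fun m hm => ?_
  obtain ⟨j, rfl⟩ := Nat.exists_eq_add_of_le hm
  exact (hseq m j m (by omega)).symm

/-! ### The homotopy to the identity -/

/-- The operator of degree one on chains of a space over `Y` given by chains in simplices. -/
def liftHomotopyOp (k : ∀ m : ℕ, Sing m Y → Ch (m + 1) (Simp m)) (φ : C(T, Y)) (m : ℕ) :
    Ch m T →ₗ[ℚ] Ch (m + 1) T :=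
  extend fun τ => push (m + 1) τ (k m (φ.comp τ))

lemma liftHomotopyOp_push (k : ∀ m : ℕ, Sing m Y → Ch (m + 1) (Simp m)) (φ : C(T, Y)) (f : C(S, T))
    {m : ℕ} (x : Ch m S) :
    liftHomotopyOp k φ m (push m f x) = push (m + 1) f (liftHomotopyOp k (φ.comp f) m x) := by
  suffices h : (liftHomotopyOp k φ m).comp (push m f) =
      (push (m + 1) f).comp (liftHomotopyOp k (φ.comp f) m) from LinearMap.congr_fun h x
  refine hom_ext fun τ => ?_
  simp only [liftHomotopyOp, LinearMap.comp_apply, push_single, extend_single, one_smul, push_push,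
    ContinuousMap.comp_assoc]

lemma liftHomotopyOp_taut (k : ∀ m : ℕ, Sing m Y → Ch (m + 1) (Simp m)) {m : ℕ} (σ : Sing m Y) :
    liftHomotopyOp k σ m (taut m) = k m σ := by
  simp only [liftHomotopyOp, taut, extend_single, one_smul, push_id, ContinuousMap.comp_id]

/-- The chains which define the homotopy from the projection of a section to the identity. -/
def sectionHomotopy (c : ChainFamily Y B) : ∀ m : ℕ, Sing m Y → Ch (m + 1) (Simp m)
  | 0, _ => 0
  | m + 1, σ => cone (simpContraction (stdSimplex.vertex 0)) (m + 1)
      (push (m + 1) ContinuousMap.fst (c (m + 1) σ) - taut (m + 1) -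
        extend (fun τ : Sing m (Simp (m + 1)) => push (m + 1) τ
          (sectionHomotopy c m (σ.comp τ))) (bd m (taut (m + 1))))

lemma sectionHomotopy_succ (c : ChainFamily Y B) (m : ℕ) (σ : Sing (m + 1) Y) :
    sectionHomotopy c (m + 1) σ = cone (simpContraction (stdSimplex.vertex 0)) (m + 1)
      (push (m + 1) ContinuousMap.fst (c (m + 1) σ) - taut (m + 1) -
        liftHomotopyOp (sectionHomotopy c) σ m (bd m (taut (m + 1)))) := rfl

lemma push_fst_lift_zero (h : ∀ σ : Sing 0 Y, c 0 σ = Finsupp.single default 1) (φ : C(T, Y))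
    (x : Ch 0 T) : push 0 ContinuousMap.fst (lift c φ 0 x) = x := by
  suffices h : (push 0 ContinuousMap.fst).comp (lift c φ 0) = LinearMap.id from
    LinearMap.congr_fun h x
  refine hom_ext fun τ => ?_
  simp only [LinearMap.comp_apply, lift, extend_single, one_smul, h, push_single,
    LinearMap.id_apply]
  congr 1
  exact Subsingleton.elim _ _

/-- Acyclic models over Y: the projected section and the identity agree on the empty simplex, and
their difference on each simplex is a cycle in a contractible space once lower degrees are
corrected. -/
lemma bd_sectionHomotopy (h : ∀ M, IsSection a R M c) {m : ℕ} (φ : C(T, Y)) (x : Ch (m + 1) T) :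
    bd (m + 1) (liftHomotopyOp (sectionHomotopy c) φ (m + 1) x) =
      push (m + 1) ContinuousMap.fst (lift c φ (m + 1) x) - x -
        liftHomotopyOp (sectionHomotopy c) φ m (bd m x) := by
  induction m generalizing T with
  | zero =>
    suffices h : (bd 1).comp (liftHomotopyOp (sectionHomotopy c) φ 1) =
        (push 1 ContinuousMap.fst).comp (lift c φ 1) - LinearMap.id -
          (liftHomotopyOp (sectionHomotopy c) φ 0).comp (bd 0) from LinearMap.congr_fun h x
    refine hom_ext fun τ => ?_
    simp only [LinearMap.comp_apply, LinearMap.sub_apply, LinearMap.id_apply]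
    rw [← push_taut τ, liftHomotopyOp_push, bd_push, lift_push, push_push, fst_comp_along,
      ← push_push, bd_push, liftHomotopyOp_push, ← map_sub, ← map_sub, liftHomotopyOp_taut,
      lift_taut, sectionHomotopy_succ, bd_cone_of_isCyc]
    change bd 0 _ = 0
    have e0 : liftHomotopyOp (sectionHomotopy c) (φ.comp τ) 0 = 0 :=
      hom_ext fun ρ => by simp [liftHomotopyOp, sectionHomotopy]
    rw [e0, LinearMap.zero_apply, sub_zero, map_sub, bd_push, (h 1).bd_eq 0 one_pos,
      push_fst_lift_zero (h 0).zero, sub_self]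
  | succ m ih =>
    suffices h : (bd (m + 2)).comp (liftHomotopyOp (sectionHomotopy c) φ (m + 2)) =
        (push (m + 2) ContinuousMap.fst).comp (lift c φ (m + 2)) - LinearMap.id -
          (liftHomotopyOp (sectionHomotopy c) φ (m + 1)).comp (bd (m + 1)) from
      LinearMap.congr_fun h x
    refine hom_ext fun τ => ?_
    simp only [LinearMap.comp_apply, LinearMap.sub_apply, LinearMap.id_apply]
    rw [← push_taut τ, liftHomotopyOp_push, bd_push, lift_push, push_push, fst_comp_along,
      ← push_push, bd_push, liftHomotopyOp_push, ← map_sub, ← map_sub, liftHomotopyOp_taut,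
      lift_taut, sectionHomotopy_succ, bd_cone_of_isCyc]
    change bd (m + 1) _ = 0
    rw [map_sub, map_sub, ih, bd_bd, map_zero, sub_zero, bd_push,
      (h (m + 2)).bd_eq (m + 1) (Nat.lt_succ_self _), sub_self]

/-- Translating σ changes its lift only in the fibre, and the projection to the simplex forgets the
fibre. -/
lemma sectionHomotopy_smul (h : ∀ M, IsSection a R M c) (m : ℕ) (γ : Γ) (σ : Sing m Y) :
    sectionHomotopy c m ((translate Y γ).comp σ) = sectionHomotopy c m σ := by
  induction m with
  | zero => rfl
  | succ m ih =>
    have e : liftHomotopyOp (sectionHomotopy c) ((translate Y γ).comp σ) m =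
        liftHomotopyOp (sectionHomotopy c) σ m := by
      refine hom_ext fun τ => ?_
      simp only [liftHomotopyOp, extend_single, one_smul, ContinuousMap.comp_assoc]
      rw [ih]
    rw [sectionHomotopy_succ, sectionHomotopy_succ, e, (h (m + 1)).smul _ le_rfl, push_push,
      fst_comp_onFibre]

/-! ### Chains modulo the group -/

/-- The span of the differences of translates of chains. -/
def translationChains (Γ : Type) [Group Γ] (m : ℕ) (Y : Type) [TopologicalSpace Y] [MulAction Γ Y]
    [ContinuousConstSMul Γ Y] : Submodule ℚ (Ch m Y) :=
  Submodule.span ℚ {x | ∃ (γ : Γ) (y : Ch m Y), x = push m (translate Y γ) y - y}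

/-- A map such that cycles modulo translation lift, up to boundaries and translation. -/
def LiftsCycles (Γ : Type) [Group Γ] {Y' Y : Type} [TopologicalSpace Y'] [TopologicalSpace Y]
    [MulAction Γ Y'] [ContinuousConstSMul Γ Y'] [MulAction Γ Y] [ContinuousConstSMul Γ Y]
    (π : C(Y', Y)) : Prop :=
  ∀ (m : ℕ) (z : Ch (m + 1) Y), bd m z ∈ translationChains Γ m Y →
    ∃ w : Ch (m + 1) Y', bd m w ∈ translationChains Γ m Y' ∧
      push (m + 1) π w - z ∈ translationChains Γ (m + 1) Y ⊔ LinearMap.range (bd (m + 1))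

variable [MulAction Γ Z] [ContinuousConstSMul Γ Z] [MulAction Γ X] [ContinuousConstSMul Γ X]

lemma map_mem_translationChains {m k : ℕ} (f : Ch m X →ₗ[ℚ] Ch k Z)
    (hf : ∀ (γ : Γ) (x : Ch m X), f (push m (translate X γ) x) = push k (translate Z γ) (f x))
    {x : Ch m X} (hx : x ∈ translationChains Γ m X) : f x ∈ translationChains Γ k Z := by
  have : translationChains Γ m X ≤ (translationChains Γ k Z).comap f := by
    refine Submodule.span_le.2 ?_
    rintro _ ⟨γ, y, rfl⟩
    refine Submodule.subset_span ⟨γ, f y, ?_⟩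
    rw [map_sub, hf]
  exact this hx

lemma push_mem_translationChains {m : ℕ} (f : C(X, Z)) (hf : ∀ (γ : Γ) x, f (γ • x) = γ • f x)
    {x : Ch m X} (hx : x ∈ translationChains Γ m X) : push m f x ∈ translationChains Γ m Z := by
  refine map_mem_translationChains (push m f) (fun γ x => ?_) hx
  rw [push_push, push_push]
  congr 2
  ext y
  exact hf γ y

lemma LiftsCycles.comp {π : C(X, Y)} {ρ : C(Z, X)} (hπ : LiftsCycles Γ π) (hρ : LiftsCycles Γ ρ)
    (hequiv : ∀ (γ : Γ) x, π (γ • x) = γ • π x) : LiftsCycles Γ (π.comp ρ) := by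
  intro m z hz
  obtain ⟨w, hw, hwz⟩ := hπ m z hz
  obtain ⟨v, hv, hvw⟩ := hρ m w hw
  refine ⟨v, hv, ?_⟩
  have : push (m + 1) (π.comp ρ) v - z =
      push (m + 1) π (push (m + 1) ρ v - w) + (push (m + 1) π w - z) := by
    rw [map_sub, push_push]; abel
  rw [this]
  refine Submodule.add_mem _ ?_ hwz
  obtain ⟨x, hx, y, ⟨u, rfl⟩, hxy⟩ := Submodule.mem_sup.1 hvw
  rw [← hxy, map_add, ← bd_push]
  exact Submodule.add_mem_sup (push_mem_translationChains π hequiv hx) ⟨_, rfl⟩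

lemma liftsCycles_id : LiftsCycles Γ (ContinuousMap.id Y) := by
  intro m z hz
  exact ⟨z, hz, by simp⟩

/-- The action on the total space of an equivariant family of subsets. -/
@[reducible]
def totalSpaceAction (a : ContAction Γ B) (R : Y → Set B)
    (hR : ∀ (γ : Γ) (y : Y), ∀ b ∈ R y, a.act γ b ∈ R (γ • y)) : MulAction Γ (totalSpace R) where
  smul γ p := ⟨(γ • p.1.1, a.act γ p.1.2), hR γ _ _ p.2⟩
  one_smul p := Subtype.ext (Prod.ext (one_smul Γ _)
    (congrArg (fun f : C(B, B) => f p.1.2) a.act_one))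
  mul_smul γ δ p := Subtype.ext (Prod.ext (mul_smul γ δ _)
    (congrArg (fun f : C(B, B) => f p.1.2) (a.act_mul γ δ)))

lemma totalSpaceAction_continuousConstSMul (a : ContAction Γ B) (R : Y → Set B)
    (hR : ∀ (γ : Γ) (y : Y), ∀ b ∈ R y, a.act γ b ∈ R (γ • y)) :
    letI := totalSpaceAction a R hR
    ContinuousConstSMul Γ (totalSpace R) := by
  let := totalSpaceAction a R hR
  refine ⟨fun γ => ?_⟩
  have h1 : Continuous fun p : totalSpace R => γ • p.1.1 :=
    (continuous_const_smul γ).comp (by fun_prop)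
  have h2 : Continuous fun p : totalSpace R => a.act γ p.1.2 := by fun_prop
  exact Continuous.subtype_mk (h1.prodMk h2) _

/-- The projection of a total space. -/
def totalSpaceProj (R : Y → Set B) : C(totalSpace R, Y) := ⟨fun p => p.1.1, by fun_prop⟩

/-- A section in all degrees shows that the projection lifts cycles. -/
theorem liftsCycles_totalSpaceProj (a : ContAction Γ B) (R : Y → Set B)
    (hR : ∀ (γ : Γ) (y : Y), ∀ b ∈ R y, a.act γ b ∈ R (γ • y)) {c : ChainFamily Y B}
    (h : ∀ M, IsSection a R M c) :
    letI := totalSpaceAction a R hR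
    haveI := totalSpaceAction_continuousConstSMul a R hR
    LiftsCycles Γ (totalSpaceProj R) := by
  let := totalSpaceAction a R hR
  have := totalSpaceAction_continuousConstSMul a R hR
  -- The lifted chains are supported in the total space. Injectivity of the inclusion on chains then
  -- transfers linearity, the boundary formula and equivariance.
  choose s hs using fun (m : ℕ) (x : Ch m Y) =>
    exists_push_incl_eq (U := totalSpace R) ((h m).lift_mem le_rfl (ContinuousMap.id Y) x)
  let S (m : ℕ) : Ch m Y →ₗ[ℚ] Ch m (totalSpace R) :=
    { toFun := s m
      map_add' x y := push_incl_injective _ (by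
        rw [map_add, hs, hs, hs, map_add])
      map_smul' r x := push_incl_injective _ (by
        rw [RingHom.id_apply, map_smul, hs, hs, map_smul]) }
  have hS (m) (x : Ch m Y) : push m (incl _) (S m x) = lift c (ContinuousMap.id Y) m x := hs m x
  have hbd (m) (x : Ch (m + 1) Y) : bd m (S (m + 1) x) = S m (bd m x) := by
    refine push_incl_injective _ ?_
    have h2 := (h (m + 1)).bd_lift (Nat.lt_succ_self m) (ContinuousMap.id Y) x
    rw [← hS, ← hS, bd_push] at h2
    exact h2
  have hsm (m) (γ : Γ) (x : Ch m Y) :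
      S m (push m (translate Y γ) x) = push m (translate _ γ) (S m x) := by
    refine push_incl_injective _ ?_
    have e1 : (incl (totalSpace R)).comp (translate (totalSpace R) γ) =
        ((along B (translate Y γ)).comp (onFibre Y (a.act γ))).comp (incl (totalSpace R)) := rfl
    have h1 := hS m (push m (translate Y γ) x)
    rw [lift_push, ContinuousMap.id_comp] at h1
    have h2 := (h m).lift_smul le_rfl (ContinuousMap.id Y) γ x
    rw [ContinuousMap.comp_id] at h2
    rw [h2, ← hS, push_push, push_push] at h1
    refine h1.trans ?_
    rw [push_push]
    rfl
  have hK (m) (γ : Γ) (x : Ch m Y) :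
      liftHomotopyOp (sectionHomotopy c) (ContinuousMap.id Y) m (push m (translate Y γ) x) =
        push (m + 1) (translate Y γ)
          (liftHomotopyOp (sectionHomotopy c) (ContinuousMap.id Y) m x) := by
    rw [liftHomotopyOp_push]
    congr 1
    suffices h : liftHomotopyOp (sectionHomotopy c) ((ContinuousMap.id Y).comp (translate Y γ)) m =
      liftHomotopyOp (sectionHomotopy c) (ContinuousMap.id Y) m by rw [h]
    refine hom_ext fun τ => ?_
    simp only [liftHomotopyOp, extend_single, one_smul, ContinuousMap.id_comp]
    rw [sectionHomotopy_smul h]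
  intro m z hz
  refine ⟨S (m + 1) z, ?_, ?_⟩
  · rw [hbd]
    exact map_mem_translationChains _ (hsm m) hz
  -- The error term is the equivariant homotopy operator applied to the boundary of z, so it again
  -- consists of differences of translates.
  · have h1 := bd_sectionHomotopy h (ContinuousMap.id Y) z
    have e : push (m + 1) (totalSpaceProj R) (S (m + 1) z) =
        push (m + 1) ContinuousMap.fst (lift c (ContinuousMap.id Y) (m + 1) z) := by
      rw [← hS, push_push]; rfl
    rw [← e, eq_sub_iff_add_eq] at h1
    rw [← h1, add_comm (bd (m + 1) _)]
    exact Submodule.add_mem_sup (map_mem_translationChains _ (hK m) hz) ⟨_, rfl⟩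

end Sections

end AugmentedChains

namespace AugmentedChains

open Matrix

/-! ### Splitting equivariant idempotents into rank one idempotents -/

section Splitting

variable {Γ : Type} [Group Γ] {n : ℕ} (ρ : Γ →* Matrix (Fin n) (Fin n) ℂ)

lemma map_inv_mul_map (γ : Γ) : ρ γ⁻¹ * ρ γ = 1 := by rw [← map_mul, inv_mul_cancel, map_one]

lemma map_mul_map_inv (γ : Γ) : ρ γ * ρ γ⁻¹ = 1 := by rw [← map_mul, mul_inv_cancel, map_one]

/-- The conjugation action on matrices through a representation. -/
def conjAction : ContAction Γ (Matrix (Fin n) (Fin n) ℂ) where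
  act γ := ⟨fun M => ρ γ * M * ρ γ⁻¹,
    (continuous_const.matrix_mul continuous_id).matrix_mul continuous_const⟩
  act_one := by ext1 M; simp
  act_mul γ δ := by
    ext1 M
    simp only [ContinuousMap.coe_mk, ContinuousMap.comp_apply, map_mul, _root_.mul_inv_rev, mul_assoc]

lemma conjAction_apply (γ : Γ) (M : Matrix (Fin n) (Fin n) ℂ) :
    (conjAction ρ).act γ M = ρ γ * M * ρ γ⁻¹ := rfl

lemma conjAction_mul (γ : Γ) (M M' : Matrix (Fin n) (Fin n) ℂ) :
    (conjAction ρ).act γ M * (conjAction ρ).act γ M' = (conjAction ρ).act γ (M * M') := by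
  simp only [conjAction_apply]
  calc _ = ρ γ * M * (ρ γ⁻¹ * ρ γ) * M' * ρ γ⁻¹ := by simp only [mul_assoc]
    _ = _ := by rw [map_inv_mul_map, mul_one, mul_assoc (ρ γ)]

lemma trace_conjAction (γ : Γ) (M : Matrix (Fin n) (Fin n) ℂ) :
    ((conjAction ρ).act γ M).trace = M.trace := by
  rw [conjAction_apply, Matrix.trace_mul_comm, ← mul_assoc, map_inv_mul_map, one_mul]

lemma conjAction_sub (γ : Γ) (M M' : Matrix (Fin n) (Fin n) ℂ) :
    (conjAction ρ).act γ (M - M') = (conjAction ρ).act γ M - (conjAction ρ).act γ M' := by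
  simp only [conjAction_apply, mul_sub, sub_mul]

/-- The action on pairs of a vector and a covector through a representation. -/
def pairAction : ContAction Γ ((Fin n → ℂ) × (Fin n → ℂ)) where
  act γ := ⟨fun p => (ρ γ *ᵥ p.1, p.2 ᵥ* ρ γ⁻¹),
    (continuous_const.matrix_mulVec continuous_fst).prodMk
      (continuous_snd.matrix_vecMul continuous_const)⟩
  act_one := by ext1 p; simp
  act_mul γ δ := by
    ext1 p
    simp only [ContinuousMap.coe_mk, ContinuousMap.comp_apply, map_mul, _root_.mul_inv_rev, mulVec_mulVec,
      vecMul_vecMul]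

lemma pairAction_apply (γ : Γ) (p : (Fin n → ℂ) × (Fin n → ℂ)) :
    (pairAction ρ).act γ p = (ρ γ *ᵥ p.1, p.2 ᵥ* ρ γ⁻¹) := rfl

lemma conjAction_mem_idemBelow (γ : Γ) {q e : Matrix (Fin n) (Fin n) ℂ} (he : e ∈ idemBelow q) :
    (conjAction ρ).act γ e ∈ idemBelow ((conjAction ρ).act γ q) := by
  obtain ⟨h1, h2, h3, h4⟩ := he
  refine ⟨?_, ?_, ?_, ?_⟩
  · rw [conjAction_mul, h1]
  · rw [trace_conjAction, h2]
  · rw [conjAction_mul, h3]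
  · rw [conjAction_mul, h4]

lemma pairAction_mem_pairBelow (γ : Γ) {q : Matrix (Fin n) (Fin n) ℂ}
    {p : (Fin n → ℂ) × (Fin n → ℂ)} (hp : p ∈ pairBelow q) :
    (pairAction ρ).act γ p ∈ pairBelow ((conjAction ρ).act γ q) := by
  obtain ⟨h1, h2, h3⟩ := hp
  rw [pairAction_apply, conjAction_apply]
  refine ⟨?_, ?_, ?_⟩
  · simp only
    rw [← dotProduct_mulVec, mulVec_mulVec, map_inv_mul_map, one_mulVec, h1]
  · simp only
    rw [mulVec_mulVec, mul_assoc, map_inv_mul_map, mul_one, ← mulVec_mulVec, h2]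
  · simp only
    rw [vecMul_vecMul, ← mul_assoc, ← mul_assoc, map_inv_mul_map, one_mul, ← vecMul_vecMul, h3]

/-- The rank one matrix of a pair of a vector and a covector. -/
def outer : C((Fin n → ℂ) × (Fin n → ℂ), Matrix (Fin n) (Fin n) ℂ) :=
  ⟨fun p => vecMulVec p.1 p.2, continuous_fst.matrix_vecMulVec continuous_snd⟩

lemma outer_mem_idemBelow {q : Matrix (Fin n) (Fin n) ℂ} {p : (Fin n → ℂ) × (Fin n → ℂ)}
    (hp : p ∈ pairBelow q) : outer p ∈ idemBelow q := by
  obtain ⟨h1, h2, h3⟩ := hp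
  change vecMulVec p.1 p.2 ∈ _
  refine ⟨?_, ?_, ?_, ?_⟩
  · rw [vecMulVec_mul_vecMulVec, h1, one_smul]
  · rw [trace_vecMulVec, dotProduct_comm, h1]
  · rw [mul_vecMulVec, h2]
  · rw [vecMulVec_mul, h3]

variable {Y : Type} [TopologicalSpace Y] [MulAction Γ Y] [ContinuousConstSMul Γ Y]

/-- The bundle of rank one idempotents below an equivariant idempotent lifts cycles. -/
theorem liftsCycles_idemBelow (hfree : ∀ (γ : Γ) (y : Y), γ • y = y → γ = 1) {r : ℕ} (hr : 1 ≤ r)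
    (q : C(Y, Matrix (Fin n) (Fin n) ℂ)) (hq : ∀ y, q y * q y = q y)
    (ht : ∀ y, (q y).trace = r)
    (hR : ∀ (γ : Γ) (y : Y), ∀ e ∈ idemBelow (q y), (conjAction ρ).act γ e ∈ idemBelow (q (γ • y)))
    (hγ : ∀ (γ : Γ) y, q (γ • y) = (conjAction ρ).act γ (q y)) :
    letI := totalSpaceAction (conjAction ρ) (fun y => idemBelow (q y)) hR
    haveI := totalSpaceAction_continuousConstSMul (conjAction ρ) (fun y => idemBelow (q y)) hR
    LiftsCycles Γ (totalSpaceProj fun y => idemBelow (q y)) := by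
  have H (m : ℕ) : Contraction (Simp (m + 1)) := simpContraction (stdSimplex.vertex 0)
  obtain ⟨c, hc⟩ := exists_isSection_zero (pairAction ρ) fun y => pairBelow (q y)
  -- Below index 2r the fibre of dual pairs is exact, so lifts exist for simplices with up to 2r
  -- vertices.
  obtain ⟨c, hc⟩ := hc.exists_extend_to hfree
    (fun γ y p hp => by rw [hγ]; exact pairAction_mem_pairBelow ρ γ hp) (2 * r)
    fun m _ hm σ => exactAt_totalSpace_pairBelow (H m) (q.comp σ) (fun t => hq _)
      (fun t => ht _) (by omega)
  have hc' : IsSection (conjAction ρ) (fun y => idemBelow (q y)) (0 + 2 * r) _ :=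
    hc.map outer (fun y p hp => outer_mem_idemBelow hp) fun γ => by
      ext1 p
      change vecMulVec (ρ γ *ᵥ p.1) (p.2 ᵥ* ρ γ⁻¹) = ρ γ * vecMulVec p.1 p.2 * ρ γ⁻¹
      rw [mul_vecMulVec, vecMulVec_mul]
  -- From index 2r on the fibre of idempotents is exact. The two ranges meet with no gap.
  obtain ⟨c', hc'⟩ := hc'.exists_extend_forall hfree hR
    fun m hm σ => exactAt_totalSpace_idemBelow (H m) (q.comp σ) (fun t => hq _) (fun t => ht _) hr
      (by omega)
  exact liftsCycles_totalSpaceProj (conjAction ρ) _ hR hc'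

/-- Mutually orthogonal equivariant idempotents of rank one with sum `q`. -/
structure IsSplitting {r : ℕ} (q : Y → Matrix (Fin n) (Fin n) ℂ)
    (E : Fin r → C(Y, Matrix (Fin n) (Fin n) ℂ)) : Prop where
  smul (i : Fin r) (γ : Γ) (y : Y) : E i (γ • y) = (conjAction ρ).act γ (E i y)
  idem (i : Fin r) (y : Y) : E i y * E i y = E i y
  trace (i : Fin r) (y : Y) : (E i y).trace = 1
  ortho (i j : Fin r) (hij : i ≠ j) (y : Y) : E i y * E j y = 0
  sum (y : Y) : ∑ i, E i y = q y

/-- After pulling back along a map which lifts cycles, an equivariant idempotent of trace `r`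
splits into rank one idempotents. -/
theorem exists_isSplitting (r : ℕ) (Y : Type) [TopologicalSpace Y] [MulAction Γ Y]
    [ContinuousConstSMul Γ Y] (hfree : ∀ (γ : Γ) (y : Y), γ • y = y → γ = 1)
    (q : C(Y, Matrix (Fin n) (Fin n) ℂ)) (hq : ∀ y, q y * q y = q y)
    (ht : ∀ y, (q y).trace = r)
    (hγ : ∀ (γ : Γ) y, q (γ • y) = (conjAction ρ).act γ (q y)) :
    ∃ (Y' : Type) (_ : TopologicalSpace Y') (_ : MulAction Γ Y') (_ : ContinuousConstSMul Γ Y')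
      (π : C(Y', Y)) (E : Fin r → C(Y', Matrix (Fin n) (Fin n) ℂ)),
      LiftsCycles Γ π ∧ (∀ (γ : Γ) y, π (γ • y) = γ • π y) ∧ IsSplitting ρ (q ∘ π) E := by
  induction r generalizing Y with
  | zero =>
    refine ⟨Y, _, _, ‹_›, ContinuousMap.id Y, finZeroElim, liftsCycles_id, fun _ _ => rfl,
      ⟨fun i => i.elim0, fun i => i.elim0, fun i => i.elim0, fun i => i.elim0, fun y => ?_⟩⟩
    -- An idempotent of trace zero factors through the zero space and so vanishes.
    obtain ⟨P, Q, -, h⟩ := exists_factor_of_idempotent (hq y) (ht y)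
    simp only [Finset.univ_eq_empty, Finset.sum_empty, Function.comp_apply, ContinuousMap.id_apply]
    rw [← h]
    ext i j
    simp [Matrix.mul_apply]
  | succ r ih =>
    have hR : ∀ (γ : Γ) (y : Y), ∀ e ∈ idemBelow (q y),
        (conjAction ρ).act γ e ∈ idemBelow (q (γ • y)) := fun γ y e he => by
      rw [hγ]; exact conjAction_mem_idemBelow ρ γ he
    let i1 := totalSpaceAction (conjAction ρ) (fun y => idemBelow (q y)) hR
    have i2 := totalSpaceAction_continuousConstSMul (conjAction ρ) (fun y => idemBelow (q y)) hR
    have hlift := liftsCycles_idemBelow ρ hfree (Nat.succ_pos r) q hq ht hR hγ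
    let e : C(totalSpace fun y => idemBelow (q y), Matrix (Fin n) (Fin n) ℂ) :=
      ⟨fun p => p.1.2, by fun_prop⟩
    have he (p : totalSpace fun y => idemBelow (q y)) : e p ∈ idemBelow (q p.1.1) := p.2
    let p₁ := totalSpaceProj fun y => idemBelow (q y)
    let q₁ : C(totalSpace fun y => idemBelow (q y), Matrix (Fin n) (Fin n) ℂ) :=
      ⟨fun p => q p.1.1 - e p, by fun_prop⟩
    have hq₁ (p) : q₁ p = q p.1.1 - e p := rfl
    have hesmul (γ : Γ) (p) : e (γ • p) = (conjAction ρ).act γ (e p) := rfl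
    obtain ⟨Y', _, _, _, π, E, hπ, hπγ, hE⟩ := ih (totalSpace fun y => idemBelow (q y))
      (fun γ p hp => hfree γ p.1.1 (congrArg (fun x => x.1.1) hp)) q₁
      (fun p => by
        obtain ⟨h1, -, h3, h4⟩ := he p
        rw [hq₁, mul_sub, sub_mul, sub_mul, hq, h1, h3, h4, sub_self, sub_zero])
      (fun p => by
        rw [hq₁, Matrix.trace_sub, ht, (he p).2.1]
        push_cast
        ring)
      (fun γ p => by
        rw [hq₁, hq₁, conjAction_sub, ← hγ, hesmul]
        rfl)
    have hp₁ (γ : Γ) (p) : p₁ (γ • p) = γ • p₁ p := rfl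
    -- The new idempotents sum to the complement q - e, so orthogonality puts each of them below it
    -- and hence makes it orthogonal to e.
    have hqE (i y) : q₁ (π y) * E i y = E i y := by
      have := hE.sum y
      simp only [Function.comp_apply] at this
      rw [← this, Finset.sum_mul, Finset.sum_eq_single i (fun j _ hj => hE.ortho j i hj y)
        (fun h => absurd (Finset.mem_univ i) h), hE.idem]
    have hEq (i y) : E i y * q₁ (π y) = E i y := by
      have := hE.sum y
      simp only [Function.comp_apply] at this
      rw [← this, Finset.mul_sum, Finset.sum_eq_single i (fun j _ hj => hE.ortho i j hj.symm y)
        (fun h => absurd (Finset.mem_univ i) h), hE.idem]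
    have heE (i y) : e (π y) * E i y = 0 := by
      obtain ⟨h1, -, -, h4⟩ := he (π y)
      rw [← hqE, ← mul_assoc, hq₁, mul_sub, h1, h4, sub_self, zero_mul]
    have hEe (i y) : E i y * e (π y) = 0 := by
      obtain ⟨h1, -, h3, -⟩ := he (π y)
      rw [← hEq, mul_assoc, hq₁, sub_mul, h1, h3, sub_self, mul_zero]
    refine ⟨Y', _, _, ‹_›, p₁.comp π, Fin.cons (e.comp π) E, hlift.comp hπ hp₁, fun γ y => ?_, ?_⟩
    · rw [ContinuousMap.comp_apply, hπγ]; rfl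
    refine ⟨fun i γ y => ?_, fun i y => ?_, fun i y => ?_, fun i j hij y => ?_, fun y => ?_⟩
    · refine Fin.cases ?_ (fun i => ?_) i
      · simp only [Fin.cons_zero, ContinuousMap.comp_apply, hπγ, hesmul]
      · simp only [Fin.cons_succ]
        exact hE.smul i γ y
    · refine Fin.cases ?_ (fun i => ?_) i
      · simp only [Fin.cons_zero, ContinuousMap.comp_apply]
        exact (he _).1
      · simp only [Fin.cons_succ]
        exact hE.idem i y
    · refine Fin.cases ?_ (fun i => ?_) i
      · simp only [Fin.cons_zero, ContinuousMap.comp_apply]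
        exact (he _).2.1
      · simp only [Fin.cons_succ]
        exact hE.trace i y
    · revert hij
      refine Fin.cases ?_ (fun i => ?_) i <;> refine Fin.cases ?_ (fun j => ?_) j <;> intro hij
      · exact absurd rfl hij
      · simpa only [Fin.cons_zero, Fin.cons_succ, ContinuousMap.comp_apply] using heE j y
      · simpa only [Fin.cons_zero, Fin.cons_succ, ContinuousMap.comp_apply] using hEe i y
      · simpa only [Fin.cons_succ] using
          hE.ortho i j (fun h => hij (congrArg Fin.succ h)) y
    · rw [Fin.sum_univ_succ]
      simp only [Fin.cons_zero, Fin.cons_succ]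
      rw [hE.sum]
      exact add_sub_cancel (e (π y)) (q (p₁ (π y)))

end Splitting

end AugmentedChains

namespace AugmentedChains

open Topology

/-! ### Discrete torsion-free groups acting on homogeneous spaces -/

section Covering

variable {G : Type} [Group G] [TopologicalSpace G] [IsTopologicalGroup G] [T2Space G]

instance subgroup_continuousConstSMul_quotient (Γ K : Subgroup G) :
    ContinuousConstSMul Γ (G ⧸ K) where
  continuous_const_smul γ := continuous_const_smul (γ : G)

/-- The stabiliser of gK in Γ is the intersection of a closed discrete subgroup with a compact one.
It is finite, so its elements have finite order. -/
lemma eq_one_of_conj_mem_compact {Γ K : Subgroup G} [DiscreteTopology Γ]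
    (hK : IsCompact (K : Set G)) (hΓ : ∀ γ : Γ, IsOfFinOrder γ → γ = 1) (g : G) {γ : G}
    (hγ : γ ∈ Γ) (h : g⁻¹ * γ * g ∈ K) : γ = 1 := by
  let S : Subgroup G := Γ ⊓ K.comap (MulAut.conj g⁻¹).toMonoidHom
  have hS : (S : Set G) = (Γ : Set G) ∩ (fun x => g * x * g⁻¹) '' (K : Set G) := by
    ext x
    refine and_congr Iff.rfl ⟨fun hx => ⟨g⁻¹ * x * g, by simpa using hx, by group⟩, ?_⟩
    rintro ⟨k, hk, rfl⟩
    simpa [mul_assoc] using hk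
  have hc : IsCompact (S : Set G) := by
    rw [hS, Set.inter_comm]
    exact (hK.image (by fun_prop)).inter_right Subgroup.isClosed_of_discrete
  have hd : _root_.IsDiscrete (S : Set G) :=
    (isDiscrete_iff_discreteTopology.2 ‹DiscreteTopology Γ›).mono inf_le_left
  have hfin := hc.finite hd
  have hmem : γ ∈ S := ⟨hγ, by simpa using h⟩
  have hord : IsOfFinOrder γ := finite_powers.1 (hfin.subset (by
    rintro _ ⟨k, rfl⟩
    exact pow_mem hmem k))
  have := hΓ ⟨γ, hγ⟩ ((Function.Injective.isOfFinOrder_iff Γ.subtype_injective).1 hord)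
  exact congrArg Subtype.val this

lemma isQuotientCoveringMap_orbitRel {Γ K : Subgroup G} [DiscreteTopology Γ]
    (hK : IsCompact (K : Set G)) (hΓ : ∀ γ : Γ, IsOfFinOrder γ → γ = 1) :
    IsQuotientCoveringMap
      (fun x : G ⧸ K => (Quotient.mk _ x : MulAction.orbitRel.Quotient Γ (G ⧸ K))) Γ where
  toIsQuotientMap := isQuotientMap_quotient_mk'
  continuous_const_smul := (subgroup_continuousConstSMul_quotient Γ K).continuous_const_smul
  apply_eq_iff_mem_orbit := Quotient.eq.trans MulAction.orbitRel_apply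
  disjoint e := by
    obtain ⟨g, rfl⟩ := QuotientGroup.mk_surjective e
    have hcl : IsClosed ((fun γ : Γ => (γ : G)) '' {1}ᶜ) :=
      Subgroup.isClosed_of_discrete.isClosedEmbedding_subtypeVal.isClosedMap _
        (isClosed_discrete _)
    -- The nontrivial elements of Γ form a closed set that misses the conjugate of K by g.
    -- Compactness of K keeps it missed for nearby pairs, which gives proper discontinuity.
    have hev : ∀ᶠ w : G × G in 𝓝 (g, g), ∀ k ∈ (K : Set G),
        w.1 * k * w.2⁻¹ ∉ (fun γ : Γ => (γ : G)) '' {1}ᶜ := by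
      refine hK.eventually_forall_of_forall_eventually fun k hk => ?_
      have hcont : Continuous fun z : (G × G) × G => z.1.1 * z.2 * z.1.2⁻¹ := by fun_prop
      refine hcont.continuousAt.eventually_mem (hcl.isOpen_compl.mem_nhds ?_)
      rintro ⟨γ, hγ, h⟩
      simp only at h
      refine hγ (Subtype.ext (eq_one_of_conj_mem_compact hK hΓ g γ.2 ?_))
      rw [h]
      simpa [mul_assoc] using hk
    rw [nhds_prod_eq] at hev
    obtain ⟨W, hW, hWW⟩ := Filter.eventually_prod_self_iff'.1 hev
    refine ⟨QuotientGroup.mk '' W, QuotientGroup.isOpenMap_coe.image_mem_nhds hW, fun γ => ?_⟩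
    rintro ⟨_, ⟨_, ⟨w, hw, rfl⟩, rfl⟩, ⟨w', hw', h⟩⟩
    by_contra hne
    have hk : w'⁻¹ * (γ * w) ∈ K := QuotientGroup.eq.1 h
    refine hWW w' hw' w hw _ hk ⟨γ, hne, ?_⟩
    simp [mul_assoc]

end Covering

/-! ### Chains of a quotient by a covering action -/

section Quotient

variable {Γ X L : Type} [Group Γ] [TopologicalSpace X] [TopologicalSpace L] [MulAction Γ X]
  {p : C(X, L)}

instance simp_preconnectedSpace (m : ℕ) : PreconnectedSpace (Simp m) :=
  Subtype.preconnectedSpace (convex_stdSimplex ℝ (Fin m)).isPreconnected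

lemma exists_lift_sing (hp : IsQuotientCoveringMap p Γ) {m : ℕ} (σ : Sing m L) :
    ∃ τ : Sing m X, p.comp τ = σ := by
  cases m with
  | zero => exact ⟨default, Subsingleton.elim _ _⟩
  | succ m =>
    let H : Contraction (Simp (m + 1)) := simpContraction (stdSimplex.vertex 0)
    obtain ⟨x, hx⟩ := hp.surjective (σ H.pt)
    -- The reversed contraction of the simplex starts at a constant map, which lifts; the end of the
    -- lifted homotopy lifts σ.
    let K : C(unitInterval × Simp (m + 1), L) :=
      ⟨fun s => σ (H.homotopy (unitInterval.symm s.1, s.2)), by fun_prop⟩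
    have hK : ∀ a, K (0, a) = p (ContinuousMap.const (Simp (m + 1)) x a) := fun a => by
      simp only [K, ContinuousMap.coe_mk, unitInterval.symm_zero, H.apply_one,
        ContinuousMap.const_apply, hx]
    refine ⟨(hp.isCoveringMap.liftHomotopy K (ContinuousMap.const _ x) hK).comp (atTime 1), ?_⟩
    ext1 a
    refine (congrFun (hp.isCoveringMap.liftHomotopy_lifts K (ContinuousMap.const _ x) hK)
      (1, a)).trans ?_
    simp only [K, ContinuousMap.coe_mk, unitInterval.symm_one, H.apply_zero]

lemma push_surjective (hp : IsQuotientCoveringMap p Γ) (m : ℕ) :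
    Function.Surjective (push m p) := by
  intro z
  induction z using Finsupp.induction_linear with
  | zero => exact ⟨0, map_zero _⟩
  | add a b ha hb =>
    obtain ⟨x, rfl⟩ := ha
    obtain ⟨y, rfl⟩ := hb
    exact ⟨x + y, map_add _ _ _⟩
  | single σ a =>
    obtain ⟨τ, rfl⟩ := exists_lift_sing hp σ
    exact ⟨Finsupp.single τ a, push_single _ _ _⟩

variable [ContinuousConstSMul Γ X]

/-- Match the two lifts at one vertex by an element of Γ; uniqueness of lifts on a connected simplex
does the rest. -/
lemma exists_translate_eq (hp : IsQuotientCoveringMap p Γ) {m : ℕ} {σ τ : Sing m X}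
    (h : p.comp σ = p.comp τ) : ∃ γ : Γ, σ = (translate X γ).comp τ := by
  cases m with
  | zero => exact ⟨1, Subsingleton.elim _ _⟩
  | succ m =>
    let t : Simp (m + 1) := stdSimplex.vertex 0
    obtain ⟨γ, hγ⟩ := hp.apply_eq_iff_mem_orbit.1 (congrArg (fun f : Sing (m + 1) L => f t) h)
    refine ⟨γ, DFunLike.coe_injective (hp.isCoveringMap.eq_of_comp_eq σ.continuous
      ((translate X γ).comp τ).continuous ?_ t hγ.symm)⟩
    funext s
    refine (congrArg (fun f : Sing (m + 1) L => f s) h).trans ?_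
    exact (hp.map_smul γ).symm

lemma push_eq_zero_of_mem_translationChains {Z : Type} [TopologicalSpace Z] {f : C(X, Z)}
    (hf : ∀ (γ : Γ) x, f (γ • x) = f x) {m : ℕ} {z : Ch m X}
    (hz : z ∈ translationChains Γ m X) : push m f z = 0 := by
  have : translationChains Γ m X ≤ LinearMap.ker (push m f) := by
    refine Submodule.span_le.2 ?_
    rintro _ ⟨γ, y, rfl⟩
    have e : f.comp (translate X γ) = f := by ext x; exact hf γ x
    simp [push_push, e]
  exact this hz

lemma mem_translationChains_of_push_eq_zero (hp : IsQuotientCoveringMap p Γ) {m : ℕ} {z : Ch m X}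
    (hz : push m p z = 0) : z ∈ translationChains Γ m X := by
  choose s hs using fun σ : Sing m L => exists_lift_sing hp σ
  -- Replacing every simplex by the chosen lift of its image is a translation of that simplex, and
  -- the replacement depends only on the image chain.
  have key (x : Ch m X) : x - extend (fun σ => Finsupp.single (s σ) (1 : ℚ)) (push m p x) ∈
      translationChains Γ m X := by
    induction x using Finsupp.induction_linear with
    | zero => simp
    | add a b ha hb =>
      rw [map_add, map_add, add_sub_add_comm]
      exact Submodule.add_mem _ ha hb
    | single σ a =>
      obtain ⟨γ, hγ⟩ := exists_translate_eq hp (hs (p.comp σ)).symm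
      refine Submodule.subset_span ⟨γ, Finsupp.single (s (p.comp σ)) a, ?_⟩
      rw [push_single, push_single, extend_single, ← hγ]
      simp
  have := key z
  rwa [hz, map_zero, sub_zero] at this

/-- A map into `L` from a space which is covered by the source of a cycle lifting map is surjective
on reduced homology. -/
theorem exists_cycle_push_sub_mem_range (hp : IsQuotientCoveringMap p Γ) {Y' F : Type}
    [TopologicalSpace Y'] [TopologicalSpace F] [MulAction Γ Y'] [ContinuousConstSMul Γ Y']
    {π : C(Y', X)} (hπ : LiftsCycles Γ π) {Θ : C(Y', F)} (hΘ : ∀ (γ : Γ) y, Θ (γ • y) = Θ y)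
    {f : C(F, L)} (hf : f.comp Θ = p.comp π) {m : ℕ} {z : Ch (m + 1) L} (hz : bd m z = 0) :
    ∃ u : Ch (m + 1) F, bd m u = 0 ∧ push (m + 1) f u - z ∈ LinearMap.range (bd (m + 1)) := by
  obtain ⟨x, rfl⟩ := push_surjective hp (m + 1) z
  rw [bd_push] at hz
  obtain ⟨w, hw, hwx⟩ := hπ m x (mem_translationChains_of_push_eq_zero hp hz)
  refine ⟨push (m + 1) Θ w, ?_, ?_⟩
  · rw [bd_push]
    exact push_eq_zero_of_mem_translationChains hΘ hw
  · rw [push_push, hf, ← push_push, ← map_sub]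
    obtain ⟨a, ha, b, ⟨c, rfl⟩, hab⟩ := Submodule.mem_sup.1 hwx
    rw [← hab, map_add, push_eq_zero_of_mem_translationChains (fun γ x => hp.map_smul γ) ha,
      zero_add, ← bd_push]
    exact ⟨_, rfl⟩

end Quotient

/-! ### The flag bundle -/

section Flags

open Matrix

variable {n : ℕ}

lemma isCompact_specialUnitary :
    IsCompact (specialUnitary n : Set (SpecialLinearGroup (Fin n) ℂ)) := by
  have h1 : IsCompact {M : Matrix (Fin n) (Fin n) ℂ | M ∈ unitaryGroup (Fin n) ℂ} := by
    have hb : IsCompact (Set.univ.pi fun _ : Fin n => Set.univ.pi fun _ : Fin n =>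
        Metric.closedBall (0 : ℂ) 1) :=
      isCompact_univ_pi fun _ => isCompact_univ_pi fun _ => isCompact_closedBall 0 1
    refine IsCompact.of_isClosed_subset hb ?_ ?_
    · have : {M : Matrix (Fin n) (Fin n) ℂ | M ∈ unitaryGroup (Fin n) ℂ} =
          {M | M * star M = 1} := by
        ext M; exact mem_unitaryGroup_iff
      rw [this]
      exact isClosed_eq (continuous_id.matrix_mul continuous_star) continuous_const
    · intro M hM i _ j _
      simpa using entry_norm_bound_of_unitary hM i j
  exact SpecialLinearGroup.isClosedEmbedding_val.isCompact_preimage h1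

/-- The inclusion of the special linear group into the matrices. -/
def toMat : SpecialLinearGroup (Fin n) ℂ →* Matrix (Fin n) (Fin n) ℂ :=
  SpecialLinearGroup.coeMonoidHom

lemma det_toMat (g : SpecialLinearGroup (Fin n) ℂ) : (toMat g).det = 1 := g.2

/-- The rows of `g` are eigenvectors for the given idempotents. -/
def IsFrame (e : Fin n → Matrix (Fin n) (Fin n) ℂ) (g : SpecialLinearGroup (Fin n) ℂ) : Prop :=
  ∀ i, Matrix.single i i 1 * toMat g = toMat g * e i

lemma single_mul_single_self (i : Fin n) :
    (Matrix.single i i 1 : Matrix (Fin n) (Fin n) ℂ) * Matrix.single i i 1 =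
      Matrix.single i i 1 := by
  rw [Matrix.single_mul_single_same, one_mul]

/-- A matrix intertwining idempotents with the diagonal ones can be scaled to determinant one. -/
def scaleRow (i₀ : Fin n) (u : Matrix (Fin n) (Fin n) ℂ) : Matrix (Fin n) (Fin n) ℂ :=
  diagonal (Function.update 1 i₀ u.det⁻¹) * u

lemma det_scaleRow (i₀ : Fin n) {u : Matrix (Fin n) (Fin n) ℂ} (hu : u.det ≠ 0) :
    (scaleRow i₀ u).det = 1 := by
  rw [scaleRow, det_mul, det_diagonal, Finset.prod_update_of_mem (Finset.mem_univ i₀)]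
  simp [hu]

lemma single_mul_diagonal_comm (i : Fin n) (d : Fin n → ℂ) :
    Matrix.single i i 1 * diagonal d = diagonal d * Matrix.single i i 1 := by
  ext a b
  rw [mul_diagonal, diagonal_mul]
  by_cases h : i = a ∧ i = b
  · obtain ⟨rfl, rfl⟩ := h
    ring
  · rw [Matrix.single_apply, if_neg h]
    ring

lemma single_mul_scaleRow (i₀ : Fin n) {u M : Matrix (Fin n) (Fin n) ℂ} {i : Fin n}
    (h : Matrix.single i i 1 * u = u * M) :
    Matrix.single i i 1 * scaleRow i₀ u = scaleRow i₀ u * M := by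
  rw [scaleRow, ← mul_assoc, single_mul_diagonal_comm, mul_assoc, h, mul_assoc]

/-- Write each idempotent as a vector times a covector. The covectors are the rows of the frame; the
idempotents summing to 1 makes the vectors the columns of its inverse. Scaling one row fixes the
determinant. -/
lemma exists_isFrame (hn : 0 < n) {e : Fin n → Matrix (Fin n) (Fin n) ℂ}
    (h1 : ∀ i, e i * e i = e i) (h2 : ∀ i, (e i).trace = 1) (h3 : ∑ i, e i = 1) :
    ∃ g, IsFrame e g := by
  choose v φ hvφ he using fun i => exists_eq_vecMulVec (h1 i) (h2 i)
  let Φ : Matrix (Fin n) (Fin n) ℂ := Matrix.of φ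
  let V : Matrix (Fin n) (Fin n) ℂ := (Matrix.of v)ᵀ
  have hVΦ : V * Φ = 1 := by
    rw [← h3]
    ext a b
    simp only [Matrix.sum_apply, he, Matrix.mul_apply, vecMulVec_apply, V, Φ, transpose_apply,
      Matrix.of_apply]
  have hΦV : Φ * V = 1 := mul_eq_one_comm.1 hVΦ
  have hdet : Φ.det ≠ 0 := by
    intro h
    have := congrArg det hΦV
    rw [det_mul, h, zero_mul, det_one] at this
    exact zero_ne_one this
  have hΦ (i) : Matrix.single i i 1 * Φ = Φ * e i := by
    have e1 : e i = V * (Matrix.single i i 1 * Φ) := by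
      rw [he]
      ext a b
      simp [V, Φ, Matrix.mul_apply, Matrix.single_apply, vecMulVec_apply, Finset.sum_ite_eq,
        ite_and]
    rw [e1, ← mul_assoc, hΦV, one_mul]
  exact ⟨⟨scaleRow ⟨0, hn⟩ Φ, det_scaleRow _ hdet⟩, fun i => single_mul_scaleRow _ (hΦ i)⟩

/-- The quotient of two frames commutes with all diagonal idempotents, so it is a diagonal matrix
and lies in B. -/
lemma IsFrame.mk_eq {e : Fin n → Matrix (Fin n) (Fin n) ℂ} {g g' : SpecialLinearGroup (Fin n) ℂ}
    (hg : IsFrame e g) (hg' : IsFrame e g') :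
    (Quotient.mk _ g : FlagManifold n) = Quotient.mk _ g' := by
  refine Quotient.sound ?_
  rw [← Quotient.eq_iff_equiv, Quotient.eq, QuotientGroup.rightRel_apply]
  intro i j hij
  have hcomm : Matrix.single i i 1 * toMat (g' * g⁻¹) = toMat (g' * g⁻¹) * Matrix.single i i 1 := by
    have hgi : toMat g * toMat g⁻¹ = 1 := map_mul_map_inv toMat g
    have hgi' : toMat g⁻¹ * toMat g = 1 := map_inv_mul_map toMat g
    rw [map_mul]
    calc _ = (Matrix.single i i 1 * toMat g') * toMat g⁻¹ := by rw [mul_assoc]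
      _ = toMat g' * (toMat g⁻¹ * toMat g) * e i * toMat g⁻¹ := by rw [hg', hgi', mul_one]
      _ = toMat g' * toMat g⁻¹ * (toMat g * e i) * toMat g⁻¹ := by simp only [mul_assoc]
      _ = toMat g' * toMat g⁻¹ * Matrix.single i i 1 * (toMat g * toMat g⁻¹) := by
          rw [← hg]; simp only [mul_assoc]
      _ = _ := by rw [hgi, mul_one]
  have := congrFun (congrFun hcomm i) j
  rw [Matrix.mul_single_apply_of_ne _ _ _ _ _ hij.ne,
    Matrix.single_mul_apply_same, one_mul] at this
  exact this

variable {Y : Type} [TopologicalSpace Y]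

/-- The flag of a splitting of the identity into rank one idempotents. -/
def flagOf (hn : 0 < n) {E : Fin n → C(Y, Matrix (Fin n) (Fin n) ℂ)}
    (h1 : ∀ i y, E i y * E i y = E i y) (h2 : ∀ i y, (E i y).trace = 1)
    (h3 : ∀ y, ∑ i, E i y = 1) (y : Y) : FlagManifold n :=
  Quotient.mk _ (exists_isFrame hn (fun i => h1 i y) (fun i => h2 i y) (h3 y)).choose

lemma flagOf_eq (hn : 0 < n) {E : Fin n → C(Y, Matrix (Fin n) (Fin n) ℂ)}
    (h1 : ∀ i y, E i y * E i y = E i y) (h2 : ∀ i y, (E i y).trace = 1)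
    (h3 : ∀ y, ∑ i, E i y = 1) {y : Y} {g : SpecialLinearGroup (Fin n) ℂ}
    (hg : IsFrame (fun i => E i y) g) : flagOf hn h1 h2 h3 y = Quotient.mk _ g :=
  (exists_isFrame hn (fun i => h1 i y) (fun i => h2 i y) (h3 y)).choose_spec.mk_eq hg

lemma continuous_flagOf (hn : 0 < n) {E : Fin n → C(Y, Matrix (Fin n) (Fin n) ℂ)}
    (h1 : ∀ i y, E i y * E i y = E i y) (h2 : ∀ i y, (E i y).trace = 1)
    (h3 : ∀ y, ∑ i, E i y = 1) (h4 : ∀ i j, i ≠ j → ∀ y, E i y * E j y = 0) :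
    Continuous (flagOf hn h1 h2 h3) := by
  rw [continuous_iff_continuousAt]
  intro y₀
  obtain ⟨g, hg⟩ := exists_isFrame hn (fun i => h1 i y₀) (fun i => h2 i y₀) (h3 y₀)
  -- This sum intertwines the idempotents at y with the diagonal ones and equals g at the base
  -- point. After rescaling it is a continuous frame wherever it is invertible.
  let u (y : Y) : Matrix (Fin n) (Fin n) ℂ :=
    ∑ i, Matrix.single i i 1 * toMat g * E i y
  have hu : Continuous u := continuous_finsetSum _ fun i _ =>
    continuous_const.matrix_mul (E i).continuous
  have hu₀ : u y₀ = toMat g := by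
    simp only [u]
    have : ∀ i, Matrix.single i i 1 * toMat g * E i y₀ = toMat g * E i y₀ :=
      fun i => by rw [hg i, mul_assoc, h1]
    rw [Finset.sum_congr rfl fun i _ => this i, ← Finset.mul_sum, h3, mul_one]
  have hfr (y i) : Matrix.single i i 1 * u y = u y * E i y := by
    simp only [u]
    rw [Finset.mul_sum, Finset.sum_mul, Finset.sum_eq_single i, Finset.sum_eq_single i]
    · rw [← mul_assoc, ← mul_assoc, single_mul_single_self, mul_assoc _ (E i y), h1]
    · intro j _ hj
      rw [mul_assoc, h4 j i hj, mul_zero]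
    · simp
    · intro j _ hj
      rw [← mul_assoc, ← mul_assoc, Matrix.single_mul_single_of_ne _ _ _ _ hj.symm, zero_mul,
        zero_mul]
    · simp
  let U : Set Y := {y | (u y).det ≠ 0}
  have hU : IsOpen U := isOpen_ne_fun hu.matrix_det continuous_const
  have hy₀ : y₀ ∈ U := by
    change (u y₀).det ≠ 0
    rw [hu₀, det_toMat]; exact one_ne_zero
  let s (y : U) : SpecialLinearGroup (Fin n) ℂ := ⟨scaleRow ⟨0, hn⟩ (u y), det_scaleRow _ y.2⟩
  have huU : Continuous fun y : U => u y := hu.comp continuous_subtype_val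
  have hs : Continuous s := by
    refine Continuous.subtype_mk (Continuous.matrix_mul (Continuous.matrix_diagonal ?_) huU) _
    exact continuous_const.update _ (huU.matrix_det.inv₀ fun y => y.2)
  have heq : flagOf hn h1 h2 h3 ∘ Subtype.val = fun y : U => (Quotient.mk _ (s y) : FlagManifold n) :=
    funext fun y => flagOf_eq hn h1 h2 h3 fun i => single_mul_scaleRow _ (hfr y i)
  have hc : Continuous (flagOf hn h1 h2 h3 ∘ (Subtype.val : U → Y)) := by
    rw [heq]; exact continuous_quotient_mk'.comp hs
  exact (hU.isOpenEmbedding_subtypeVal.continuousAt_iff (x := ⟨y₀, hy₀⟩)).1 hc.continuousAt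

/-- The projection of the flag bundle is surjective on reduced homology. -/
theorem exists_cycle_flagBundle (hn : 0 < n) (Γ : Subgroup (SpecialLinearGroup (Fin n) ℂ))
    [DiscreteTopology Γ] (hΓ : ∀ γ : Γ, IsOfFinOrder γ → γ = 1) {m : ℕ}
    {z : Ch (m + 1) (LocallySymmetricSpace n Γ)} (hz : bd m z = 0) :
    ∃ u : Ch (m + 1) (FlagBundle n Γ), bd m u = 0 ∧
      push (m + 1) (flagBundleProj n Γ) u - z ∈ LinearMap.range (bd (m + 1)) := by
  have hcov := isQuotientCoveringMap_orbitRel (isCompact_specialUnitary (n := n)) hΓ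
  let p : C(SymmetricSpace n, LocallySymmetricSpace n Γ) := ⟨_, hcov.continuous⟩
  have hp : IsQuotientCoveringMap p Γ := hcov
  have hfree : ∀ (γ : Γ) (x : SymmetricSpace n), γ • x = x → γ = 1 := fun γ x h => by
    have := hp.isCancelSMul
    exact IsCancelSMul.right_cancel γ 1 x (by rw [h, one_smul])
  let ρ : Γ →* Matrix (Fin n) (Fin n) ℂ := toMat.comp Γ.subtype
  -- The constant idempotent 1 is equivariant of trace n; splitting it produces full flags.
  obtain ⟨Y, _, _, _, π, E, hπ, hπγ, hE⟩ := exists_isSplitting ρ n (SymmetricSpace n) hfree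
    (ContinuousMap.const _ 1) (fun _ => mul_one 1) (fun _ => by simp)
    (fun γ _ => by
      rw [conjAction_apply, ContinuousMap.const_apply, ContinuousMap.const_apply, mul_one,
        map_mul_map_inv])
  have hfl := continuous_flagOf hn hE.idem hE.trace hE.sum hE.ortho
  let Θ : C(Y, FlagBundle n Γ) :=
    ⟨fun y => Quotient.mk _ (flagOf hn hE.idem hE.trace hE.sum y, π y),
      continuous_quotient_mk'.comp (hfl.prodMk π.continuous)⟩
  refine exists_cycle_push_sub_mem_range hp hπ (Θ := Θ) (fun γ y => ?_) rfl hz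
  suffices h : flagOf hn hE.idem hE.trace hE.sum y =
      MulOpposite.op γ • flagOf hn hE.idem hE.trace hE.sum (γ • y) by
    have hrel : balancedSetoid Γ (FlagManifold n) (SymmetricSpace n)
        (flagOf hn hE.idem hE.trace hE.sum y, π y)
        (flagOf hn hE.idem hE.trace hE.sum (γ • y), π (γ • y)) := ⟨γ, h, hπγ γ y⟩
    exact (Quotient.sound hrel).symm
  obtain ⟨g, hg⟩ := exists_isFrame hn (fun i => hE.idem i y) (fun i => hE.trace i y) (hE.sum y)
  -- Conjugating the idempotents by γ multiplies a frame by γ⁻¹ on the right. This is the relation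
  -- that defines the balanced product.
  have hg' : IsFrame (fun i => E i (γ • y)) (g * (γ : SpecialLinearGroup (Fin n) ℂ)⁻¹) := by
    intro i
    simp only [hE.smul]
    rw [conjAction_apply, map_mul, ← mul_assoc, hg i]
    change _ = toMat g * toMat (γ : SpecialLinearGroup (Fin n) ℂ)⁻¹ *
      (toMat (γ : SpecialLinearGroup (Fin n) ℂ) * E i y *
        toMat (γ : SpecialLinearGroup (Fin n) ℂ)⁻¹)
    calc _ = toMat g * (toMat (γ : SpecialLinearGroup (Fin n) ℂ)⁻¹ *
          toMat (γ : SpecialLinearGroup (Fin n) ℂ)) * E i y *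
            toMat (γ : SpecialLinearGroup (Fin n) ℂ)⁻¹ := by
          rw [map_inv_mul_map toMat, mul_one]
      _ = _ := by simp only [mul_assoc]
  rw [flagOf_eq hn hE.idem hE.trace hE.sum hg, flagOf_eq hn hE.idem hE.trace hE.sum hg']
  refine congrArg (Quotient.mk _) ?_
  change g = g * (γ : SpecialLinearGroup (Fin n) ℂ)⁻¹ * γ
  rw [inv_mul_cancel_right]

end Flags

end AugmentedChains

namespace AugmentedChains

/-! ### Maps on homology of complexes of vector spaces -/

section Modules

variable {ι : Type} {c : ComplexShape ι} {K L : HomologicalComplex (ModuleCat.{0} ℚ) c}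

lemma exists_iCycles_eq {k j : ι} (hj : c.next k = j) {x : K.X k} (hx : K.d k j x = 0) :
    ∃ z : K.cycles k, K.iCycles k z = x := by
  let φ : ModuleCat.of ℚ ℚ ⟶ K.X k := ModuleCat.ofHom (LinearMap.toSpanSingleton ℚ _ x)
  have hφ : φ ≫ K.d k j = 0 := by
    ext
    simp [φ, hx]
  refine ⟨K.liftCycles φ j hj hφ (1 : ℚ), ?_⟩
  have h := ConcreteCategory.congr_hom (K.liftCycles_i φ j hj hφ) (1 : ℚ)
  refine h.trans ?_
  simp [φ]

lemma iCycles_injective (k : ι) : Function.Injective (K.iCycles k) :=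
  (ModuleCat.mono_iff_injective _).1 inferInstance

lemma homologyπ_surjective (k : ι) : Function.Surjective (K.homologyπ k) :=
  (ModuleCat.epi_iff_surjective _).1 inferInstance

lemma d_iCycles_apply (k j : ι) (z : K.cycles k) : K.d k j (K.iCycles k z) = 0 := by
  have h := ConcreteCategory.congr_hom (K.iCycles_d k j) z
  exact h

lemma iCycles_toCycles_apply (i k : ι) (x : K.X i) :
    K.iCycles k (K.toCycles i k x) = K.d i k x :=
  ConcreteCategory.congr_hom (K.toCycles_i i k) x

lemma homologyπ_toCycles_apply (i k : ι) (x : K.X i) : K.homologyπ k (K.toCycles i k x) = 0 :=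
  ConcreteCategory.congr_hom (K.toCycles_comp_homologyπ i k) x

lemma exists_toCycles_eq {i k : ι} (hi : c.prev k = i) {z : K.cycles k}
    (hz : K.homologyπ k z = 0) : ∃ x, K.toCycles i k x = z := by
  have hex := ShortComplex.exact_of_g_is_cokernel
    (ShortComplex.mk _ _ (K.toCycles_comp_homologyπ i k)) (K.homologyIsCokernel i k hi)
  exact (ShortComplex.moduleCat_exact_iff _).1 hex z hz

lemma homologyMap_homologyπ_apply (f : K ⟶ L) (k : ι) (z : K.cycles k) :
    HomologicalComplex.homologyMap f k (K.homologyπ k z) =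
      L.homologyπ k (HomologicalComplex.cyclesMap f k z) :=
  ConcreteCategory.congr_hom (HomologicalComplex.homologyπ_naturality f k) z

lemma iCycles_cyclesMap_apply (f : K ⟶ L) (k : ι) (z : K.cycles k) :
    L.iCycles k (HomologicalComplex.cyclesMap f k z) = f.f k (K.iCycles k z) :=
  ConcreteCategory.congr_hom (HomologicalComplex.cyclesMap_i f k) z

lemma homologyMap_surjective (f : K ⟶ L) {i k j : ι} (hj : c.next k = j)
    (h : ∀ z : L.X k, L.d k j z = 0 → ∃ u : K.X k, K.d k j u = 0 ∧
      ∃ v : L.X i, f.f k u - z = L.d i k v) :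
    Function.Surjective (HomologicalComplex.homologyMap f k) := by
  intro x
  obtain ⟨z, rfl⟩ := homologyπ_surjective k x
  obtain ⟨u, hu, v, hv⟩ := h _ (d_iCycles_apply k j z)
  obtain ⟨u, rfl⟩ := exists_iCycles_eq hj hu
  refine ⟨K.homologyπ k u, ?_⟩
  rw [homologyMap_homologyπ_apply, ← sub_eq_zero, ← map_sub]
  have : HomologicalComplex.cyclesMap f k u - z = L.toCycles i k v := by
    refine iCycles_injective k ?_
    rw [map_sub, iCycles_cyclesMap_apply, hv, iCycles_toCycles_apply]
  rw [this, homologyπ_toCycles_apply]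

lemma homologyMap_injective (f : K ⟶ L) {i k j : ι} (hi : c.prev k = i)
    (h : ∀ z : K.X k, K.d k j z = 0 → (∃ v : L.X i, L.d i k v = f.f k z) →
      ∃ v : K.X i, K.d i k v = z) :
    Function.Injective (HomologicalComplex.homologyMap f k) := by
  refine (injective_iff_map_eq_zero _).2 fun x hx => ?_
  obtain ⟨z, rfl⟩ := homologyπ_surjective k x
  rw [homologyMap_homologyπ_apply] at hx
  obtain ⟨v, hv⟩ := exists_toCycles_eq hi hx
  obtain ⟨w, hw⟩ := h _ (d_iCycles_apply k j z)
    ⟨v, by rw [← iCycles_toCycles_apply, hv, iCycles_cyclesMap_apply]⟩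
  have : z = K.toCycles i k w := iCycles_injective k (by rw [iCycles_toCycles_apply, hw])
  rw [this, homologyπ_toCycles_apply]

end Modules

/-! ### Comparison with singular homology -/

section Comparison

variable {X Y : Type} [TopologicalSpace X] [TopologicalSpace Y]

/-- The singular chain complex with rational coefficients. -/
abbrev singChains (X : Type) [TopologicalSpace X] : ChainComplex (ModuleCat.{0} ℚ) ℕ :=
  (TopCat.toSSet.obj (TopCat.of X)).chainComplex (ModuleCat.of ℚ ℚ)

/-- The map of singular chain complexes induced by a continuous map. -/
abbrev singChainsMap (f : C(X, Y)) : singChains X ⟶ singChains Y :=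
  SSet.chainComplexMap (TopCat.toSSet.map (TopCat.ofHom f)) (ModuleCat.of ℚ ℚ)

/-- The element of the singular chain complex given by a singular simplex. -/
def simplexChain {k : ℕ} (σ : Sing (k + 1) X) : (singChains X).X k :=
  (TopCat.toSSet.obj (TopCat.of X)).ιChainComplex (R := ModuleCat.of ℚ ℚ)
    ((TopCat.toSSetObjEquiv (TopCat.of X) (Opposite.op (SimplexCategory.mk k))).symm σ) (1 : ℚ)

/-- The comparison from augmented chains to the singular chain complex. -/
def toSingChains (k : ℕ) : Ch (k + 1) X →ₗ[ℚ] (singChains X).X k := extend simplexChain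

/-- Both sides are coproducts of copies of ℚ indexed by singular simplices; the inverse comes from
the universal property. -/
lemma toSingChains_bijective (k : ℕ) :
    Function.Bijective (toSingChains k : Ch (k + 1) X →ₗ[ℚ] (singChains X).X k) := by
  let S := TopCat.toSSet.obj (TopCat.of X)
  let e := TopCat.toSSetObjEquiv (TopCat.of X) (Opposite.op (SimplexCategory.mk k))
  let s : Limits.Cofan fun _ : S.obj (Opposite.op (SimplexCategory.mk k)) => ModuleCat.of ℚ ℚ :=
    Limits.Cofan.mk (ModuleCat.of ℚ (Ch (k + 1) X)) fun x =>
      ModuleCat.ofHom (Finsupp.lsingle (e x))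
  let g : (singChains X).X k ⟶ ModuleCat.of ℚ (Ch (k + 1) X) :=
    (S.isColimitChainComplexXCofan (ModuleCat.of ℚ ℚ) k).desc s
  have hg (x) : S.ιChainComplex x ≫ g = ModuleCat.ofHom (Finsupp.lsingle (e x)) :=
    (S.isColimitChainComplexXCofan (ModuleCat.of ℚ ℚ) k).fac s ⟨x⟩
  refine Function.bijective_iff_has_inverse.2 ⟨g, fun z => ?_, fun z => ?_⟩
  · suffices h : g.hom.comp (toSingChains k) = LinearMap.id from LinearMap.congr_fun h z
    refine hom_ext fun σ => ?_
    simp only [LinearMap.comp_apply, toSingChains, extend_single, one_smul, LinearMap.id_apply]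
    have := ConcreteCategory.congr_hom (hg (e.symm σ)) (1 : ℚ)
    refine this.trans ?_
    simp
  · suffices h : g ≫ ModuleCat.ofHom (toSingChains k) = 𝟙 _ from ConcreteCategory.congr_hom h z
    refine SSet.chainComplex_hom_ext (X := S) fun x => ?_
    rw [← Category.assoc, hg]
    ext
    simp [toSingChains, simplexChain, e]
    rfl

lemma d_toSingChains (k : ℕ) (z : Ch (k + 2) X) :
    (singChains X).d (k + 1) k (toSingChains (k + 1) z) = toSingChains k (bd (k + 1) z) := by
  suffices h : ((singChains X).d (k + 1) k).hom.comp (toSingChains (k + 1)) =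
    (toSingChains k).comp (bd (k + 1)) from LinearMap.congr_fun h z
  refine hom_ext fun σ => ?_
  simp only [LinearMap.comp_apply, bd_single, map_sum, map_smul]
  simp only [toSingChains, extend_single, one_smul]
  have := ConcreteCategory.congr_hom ((TopCat.toSSet.obj (TopCat.of X)).ιChainComplex_d
    (R := ModuleCat.of ℚ ℚ)
    ((TopCat.toSSetObjEquiv (TopCat.of X) (Opposite.op (SimplexCategory.mk (k + 1)))).symm σ))
    (1 : ℚ)
  refine this.trans ?_
  simp only [ModuleCat.hom_sum, LinearMap.sum_apply]
  refine Finset.sum_congr rfl fun i _ => ?_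
  have hface : (TopCat.toSSet.obj (TopCat.of X)).δ i
      ((TopCat.toSSetObjEquiv (TopCat.of X) (Opposite.op (SimplexCategory.mk (k + 1)))).symm σ) =
      (TopCat.toSSetObjEquiv (TopCat.of X) (Opposite.op (SimplexCategory.mk k))).symm
        (face i σ) := rfl
  rw [hface]
  have hz (a : ℤ) (φ : ModuleCat.of ℚ ℚ ⟶ (singChains X).X k) :
      (a • φ).hom (1 : ℚ) = (a : ℚ) • φ.hom (1 : ℚ) := by
    rw [ModuleCat.hom_zsmul, LinearMap.smul_apply, Int.cast_smul_eq_zsmul]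
  rw [hz]
  push_cast
  rfl

lemma map_toSingChains (f : C(X, Y)) (k : ℕ) (z : Ch (k + 1) X) :
    (singChainsMap f).f k (toSingChains k z) = toSingChains k (push (k + 1) f z) := by
  suffices h : ((singChainsMap f).f k).hom.comp (toSingChains k) =
    (toSingChains k).comp (push (k + 1) f) from LinearMap.congr_fun h z
  refine hom_ext fun σ => ?_
  simp only [LinearMap.comp_apply, push_single, toSingChains, extend_single, one_smul]
  exact ConcreteCategory.congr_hom (SSet.ι_chainComplexMap_f _ _
    (TopCat.toSSet.map (TopCat.ofHom f)) (ModuleCat.of ℚ ℚ)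
    ((TopCat.toSSetObjEquiv (TopCat.of X) (Opposite.op (SimplexCategory.mk k))).symm σ)) (1 : ℚ)

instance simpOne_subsingleton : Subsingleton (Simp 1) :=
  ⟨fun s t => by
    ext i
    have hs := stdSimplex.sum_eq_one s
    have ht := stdSimplex.sum_eq_one t
    simp only [Fin.sum_univ_one] at hs ht
    rw [Subsingleton.elim i 0]
    exact hs.trans ht.symm⟩

lemma push_one_surjective {f : C(X, Y)} (hf : Function.Surjective f) :
    Function.Surjective (push 1 f) := by
  intro z
  induction z using Finsupp.induction_linear with
  | zero => exact ⟨0, map_zero _⟩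
  | add a b ha hb =>
    obtain ⟨x, rfl⟩ := ha
    obtain ⟨y, rfl⟩ := hb
    exact ⟨x + y, map_add _ _ _⟩
  | single σ a =>
    obtain ⟨x, hx⟩ := hf (σ (stdSimplex.vertex 0))
    refine ⟨Finsupp.single (ContinuousMap.const _ x) a, ?_⟩
    rw [push_single]
    congr 1
    ext t
    rw [ContinuousMap.comp_apply, ContinuousMap.const_apply, hx,
      Subsingleton.elim t (stdSimplex.vertex 0)]

/-- Lifting cycles in augmented chains gives the lifting of cycles in the singular chain complex. -/
lemma exists_cycle_singChains {f : C(X, Y)} (hf : Function.Surjective f)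
    (h : ∀ (m : ℕ) (z : Ch (m + 1) Y), bd m z = 0 → ∃ u : Ch (m + 1) X, bd m u = 0 ∧
      push (m + 1) f u - z ∈ LinearMap.range (bd (m + 1))) {k j : ℕ}
    (hj : (ComplexShape.down ℕ).next k = j) (z : (singChains Y).X k)
    (hz : (singChains Y).d k j z = 0) :
    ∃ u : (singChains X).X k, (singChains X).d k j u = 0 ∧ ∃ v : (singChains Y).X (k + 1),
      (singChainsMap f).f k u - z = (singChains Y).d (k + 1) k v := by
  obtain ⟨z, rfl⟩ := (toSingChains_bijective k).2 z
  cases k with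
  | zero =>
    -- In degree 0 every chain is a cycle of the unaugmented complex, so reduced cycles do not
    -- suffice and surjectivity on points is used.
    obtain ⟨u, rfl⟩ := push_one_surjective hf z
    refine ⟨toSingChains 0 u, ?_, 0, ?_⟩
    · rw [ChainComplex.next_nat_zero] at hj
      subst hj
      rw [(singChains X).shape 0 0 (by simp)]
      rfl
    · rw [map_toSingChains, sub_self, map_zero]
  | succ k =>
    rw [ChainComplex.next_nat_succ] at hj
    subst hj
    rw [d_toSingChains] at hz
    obtain ⟨u, hu, v, hv⟩ := h (k + 1) z ((toSingChains_bijective k).1 (by rw [hz, map_zero]))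
    refine ⟨toSingChains (k + 1) u, ?_, toSingChains (k + 2) v, ?_⟩
    · rw [d_toSingChains, hu, map_zero]
    · rw [map_toSingChains, ← map_sub, ← hv, d_toSingChains]

lemma singularHomologyMap_surjective {f : C(X, Y)} (hf : Function.Surjective f)
    (h : ∀ (m : ℕ) (z : Ch (m + 1) Y), bd m z = 0 → ∃ u : Ch (m + 1) X, bd m u = 0 ∧
      push (m + 1) f u - z ∈ LinearMap.range (bd (m + 1))) (k : ℕ) :
    Function.Surjective (singularHomologyMap ℚ k f) :=
  homologyMap_surjective (singChainsMap f) rfl (exists_cycle_singChains hf h rfl)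

lemma singularCohomologyMap_injective {f : C(X, Y)} (hf : Function.Surjective f)
    (h : ∀ (m : ℕ) (z : Ch (m + 1) Y), bd m z = 0 → ∃ u : Ch (m + 1) X, bd m u = 0 ∧
      push (m + 1) f u - z ∈ LinearMap.range (bd (m + 1))) (k : ℕ) :
    Function.Injective (singularCohomologyMap ℚ k f) := by
  refine homologyMap_injective (i := (ComplexShape.up ℕ).prev k) (j := k + 1)
    ((singularCochainComplexFunctor ℚ).map (TopCat.ofHom f).op) rfl ?_
  intro φ hφ hψ
  obtain ⟨ψ, hψ⟩ := hψ
  let φ' : (singChains Y).X k ⟶ ModuleCat.of ℚ ℚ := φ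
  -- For k = 0 this index is again 0 and the differential is zero, so the argument covers degree 0
  -- without a separate case.
  let j := (ComplexShape.up ℕ).prev k
  let ψ' : (singChains X).X j ⟶ ModuleCat.of ℚ ℚ := ψ
  have hφ' : (singChains Y).d (k + 1) k ≫ φ' = 0 := hφ
  have hψ' : (singChains X).d k j ≫ ψ' = (singChainsMap f).f k ≫ φ' := hψ
  -- If the pullback of the cocycle is a coboundary, the cocycle vanishes on images of cycles of X.
  -- It also vanishes on boundaries, hence on every cycle of Y.
  have hker : LinearMap.ker ((singChains Y).d k j).hom ≤ LinearMap.ker φ'.hom := by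
    intro z hz
    obtain ⟨u, hu, v, hv⟩ := exists_cycle_singChains hf h (j := j) rfl z hz
    have h1 : φ' ((singChains Y).d (k + 1) k v) = 0 := ConcreteCategory.congr_hom hφ' v
    have h2 : ψ' ((singChains X).d k j u) = φ' ((singChainsMap f).f k u) :=
      ConcreteCategory.congr_hom hψ' u
    rw [hu, map_zero] at h2
    rw [← hv, map_sub, ← h2, zero_sub, neg_eq_zero] at h1
    exact h1
  -- Over a field, a functional that vanishes on the kernel of the differential factors through it,
  -- so the cocycle is a coboundary.
  obtain ⟨χ, hχ⟩ : φ'.hom ∈ LinearMap.range ((singChains Y).d k j).hom.dualMap := by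
    rw [LinearMap.range_dualMap_eq_dualAnnihilator_ker, Submodule.mem_dualAnnihilator]
    exact fun z hz => hker hz
  exact ⟨ModuleCat.ofHom χ, ModuleCat.hom_ext hχ⟩

end Comparison

end AugmentedChains

end

theorem mainTheorem7 (n : ℕ) (hn : 2 ≤ n)
    (Γ : Subgroup (Matrix.SpecialLinearGroup (Fin n) ℂ)) [DiscreteTopology Γ]
    (hΓ : ∀ γ : Γ, IsOfFinOrder γ → γ = 1) :
    (∀ k : ℕ, Function.Injective (singularCohomologyMap ℚ k (flagBundleProj n Γ))) ∧
      (∀ k : ℕ, Function.Surjective (singularHomologyMap ℚ k (flagBundleProj n Γ))) := by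
  have hsurj : Function.Surjective (flagBundleProj n Γ) := by
    rintro ⟨x⟩
    exact ⟨Quotient.mk _ (Quotient.mk _ 1, x), rfl⟩
  have hlift := fun (m : ℕ) (z : AugmentedChains.Ch (m + 1) (LocallySymmetricSpace n Γ)) hz =>
    AugmentedChains.exists_cycle_flagBundle (by omega) Γ hΓ (z := z) hz
  exact ⟨AugmentedChains.singularCohomologyMap_injective hsurj hlift,
    AugmentedChains.singularHomologyMap_surjective hsurj hlift⟩
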